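/- Let $N\ge 1$ be an integer. For $a,b\in\mathbb R$ put $c=\frac{a+b+1}{2}$. Let $L^2_a$ and $H^2_b$ be the closures of $C_c^\infty(\mathbb R^N\setminus\{0\})$ (realized as spaces of real-valued functions, with $\nabla$ the weak gradient on $\mathbb R^N\setminus\{0\}$) under the norms $$\|u\|_{L^2_a}=\Big(\int_{\mathbb R^N}|x|^{-2a}|u|^2\,dx\Big)^{1/2},\qquad \|u\|_{H^2_b}=\Big(\int_{\mathbb R^N}|x|^{-2b}|\nabla u|^2\,dx\Big)^{1/2}.$$ Let $S_{2,a,b}$ be the largest constant $S$ such that $S\,\|\varphi\|_{L^2_c}^2\le\|\varphi\|_{H^2_b}\|\varphi\|_{L^2_a}$ for all $\varphi\in C_c^\infty(\mathbb R^N\setminus\{0\})$, and for $0\ne u\in H^2_b\cap L^2_a$ let $$\delta_{2,a,b}(u)=\frac{\|u\|_{H^2_b}\|u\|_{L^2_a}}{\|u\|_{L^2_c}^2}-S_{2,a,b}.$$ Suppose that $(N,a,b)$ satisfies one of the following conditions: 1. $0\le b<\frac{N-2}{2}$, $a<\frac{Nb}{N-2}$ and $a+b+1=\frac{2bN}{N-2}$;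 in this case let $\mathcal M_{2,a,b}=\big\{k\exp\big(-\tfrac{\lambda}{b+1-a}|x|^{b+1-a}\big):k\in\mathbb R,\ \lambda>0\big\}$; 2. $\frac{N-2}{2}<b\le N-2$ and $N(b-a+3)=2(3b-a+3)$; in this case let $\mathcal M_{2,a,b}=\big\{k|x|^{2b+2-N}\exp\big(-\tfrac{\lambda}{b+1-a}|x|^{b+1-a}\big):k\in\mathbb R,\ \lambda>0\big\}$. Then there is a constant $C>0$ depending only on $N,a,b$ such that for all $u\in H^2_b\cap L^2_a$, $u\neq 0$, $$\inf_{v\in\mathcal M_{2,a,b}}\frac{\|u-v\|_{H^2_b}\,\|u-v\|_{L^2_a}}{\|u\|_{H^2_b}\,\|u\|_{L^2_a}}\le C\,\delta_{2,a,b}(u).$$ Moreover the exponent $1$ of the deficit is sharp: for every $t>1$ there is no constant $C$ such that the left-hand side is at most $C\,\delta_{2,a,b}(u)^t$ for all $u\in H^2_b\cap L^2_a$, $u\ne0$. -/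

import Mathlib

open MeasureTheory Filter Topology
open scoped ContDiff Gradient

noncomputable section

namespace CKN

/-- `ℝ^N` with the Euclidean norm and Lebesgue measure. -/
abbrev E (N : ℕ) : Type := EuclideanSpace ℝ (Fin N)

/-- Test functions: `φ ∈ C_c^∞(ℝ^N ∖ {0})`. -/
structure IsTest {N : ℕ} (φ : E N → ℝ) : Prop where
  smooth : ContDiff ℝ ∞ φ
  compact : HasCompactSupport φ
  zero_notMem : (0 : E N) ∉ tsupport φ

/-- `G` is a weak gradient of `u` on `ℝ^N ∖ {0}`: both are locally integrable there and
`∫ u ∇φ = - ∫ φ G` for all `φ ∈ C_c^∞(ℝ^N ∖ {0})`. -/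
structure HasWeakGrad {N : ℕ} (u : E N → ℝ) (G : E N → E N) : Prop where
  locInt : LocallyIntegrableOn u {0}ᶜ volume
  locInt_grad : LocallyIntegrableOn G {0}ᶜ volume
  integral_eq : ∀ φ : E N → ℝ, IsTest φ → ∫ x, u x • ∇ φ x = - ∫ x, φ x • G x

/-- `u` has a weak gradient on `ℝ^N ∖ {0}`. -/
def WeaklyDiff {N : ℕ} (u : E N → ℝ) : Prop := ∃ G : E N → E N, HasWeakGrad u G

open Classical in
/-- The weak gradient of `u` (unique up to null sets); zero if there is none. -/
def weakGrad {N : ℕ} (u : E N → ℝ) : E N → E N :=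
  if h : WeaklyDiff u then h.choose else 0

/-- `(∫ |x|^{-2a} |f|²)^{1/2}`, with values in `[0, ∞]`. -/
def eWeightedNorm {N : ℕ} {F : Type*} [NormedAddCommGroup F] [NormedSpace ℝ F]
    (a : ℝ) (f : E N → F) : ENNReal :=
  eLpNorm (fun x => ‖x‖ ^ (-a) • f x) 2 volume

/-- `‖u‖_{L^2_a}` with values in `[0, ∞]`. -/
def eLNorm {N : ℕ} (a : ℝ) (u : E N → ℝ) : ENNReal := eWeightedNorm a u

/-- `‖u‖_{H^2_b} = (∫ |x|^{-2b} |∇u|²)^{1/2}` with values in `[0, ∞]`. -/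
def eHNorm {N : ℕ} (b : ℝ) (u : E N → ℝ) : ENNReal := eWeightedNorm b (weakGrad u)

/-- `‖u‖_{L^2_a}` as a real number. -/
def lNorm {N : ℕ} (a : ℝ) (u : E N → ℝ) : ℝ := (eLNorm a u).toReal

/-- `‖u‖_{H^2_b}` as a real number. -/
def hNorm {N : ℕ} (b : ℝ) (u : E N → ℝ) : ℝ := (eHNorm b u).toReal

/-- `u ∈ L^2_a`, the closure of `C_c^∞(ℝ^N ∖ {0})` under `‖·‖_{L^2_a}`. -/
def MemL {N : ℕ} (a : ℝ) (u : E N → ℝ) : Prop :=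
  AEStronglyMeasurable u volume ∧
    ∃ φ : ℕ → E N → ℝ, (∀ n, IsTest (φ n)) ∧
      Tendsto (fun n => eLNorm a (u - φ n)) atTop (𝓝 0)

/-- `u ∈ H^2_b`, the closure (completion, realized as a space of functions) of
`C_c^∞(ℝ^N ∖ {0})` under `‖·‖_{H^2_b}`. Since this norm only sees the gradient, the
approximating test functions are also required to converge to `u` in `L^1_loc(ℝ^N ∖ {0})`;
this picks out the right function among all those that differ from it by a constant. -/
def MemH {N : ℕ} (b : ℝ) (u : E N → ℝ) : Prop :=
  WeaklyDiff u ∧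
    ∃ φ : ℕ → E N → ℝ, (∀ n, IsTest (φ n)) ∧
      (∀ K : Set (E N), IsCompact K → K ⊆ {0}ᶜ →
        Tendsto (fun n => ∫⁻ x in K, ‖u x - φ n x‖ₑ) atTop (𝓝 0)) ∧
      Tendsto (fun n => eHNorm b (u - φ n)) atTop (𝓝 0)

/-- The best constant `S_{2,a,b}`: the largest `S` with
`S ‖φ‖_{L^2_c}² ≤ ‖φ‖_{H^2_b} ‖φ‖_{L^2_a}` for all `φ ∈ C_c^∞(ℝ^N ∖ {0})`,
where `c = (a + b + 1) / 2`. -/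
def bestConst (N : ℕ) (a b : ℝ) : ℝ :=
  sSup {S : ℝ | ∀ φ : E N → ℝ, IsTest φ →
    S * lNorm ((a + b + 1) / 2) φ ^ 2 ≤ hNorm b φ * lNorm a φ}

/-- The deficit `δ_{2,a,b}(u) = ‖u‖_{H^2_b} ‖u‖_{L^2_a} / ‖u‖_{L^2_c}² - S_{2,a,b}`,
where `c = (a + b + 1) / 2`. -/
def deficit {N : ℕ} (a b : ℝ) (u : E N → ℝ) : ℝ :=
  hNorm b u * lNorm a u / lNorm ((a + b + 1) / 2) u ^ 2 - bestConst N a b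

/-- The family of minimizers `M_{2,a,b}`:
`k exp(-(lam / (b+1-a)) |x|^{b+1-a})` if `b < (N-2)/2`, and
`k |x|^{2b+2-N} exp(-(lam / (b+1-a)) |x|^{b+1-a})` otherwise, with `k ∈ ℝ`, `lam > 0`. -/
def minimizers (N : ℕ) (a b : ℝ) : Set (E N → ℝ) :=
  {v | ∃ k lam : ℝ, 0 < lam ∧ ∀ x : E N,
    v x = k * (if b < ((N : ℝ) - 2) / 2 then 1 else ‖x‖ ^ (2 * b + 2 - (N : ℝ))) *
      Real.exp (-(lam / (b + 1 - a)) * ‖x‖ ^ (b + 1 - a))}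

/-- `inf_{v ∈ M_{2,a,b}} ‖u-v‖_{H^2_b} ‖u-v‖_{L^2_a} / (‖u‖_{H^2_b} ‖u‖_{L^2_a})`. -/
def strongDist {N : ℕ} (a b : ℝ) (u : E N → ℝ) : ℝ :=
  ⨅ v : minimizers N a b,
    hNorm b (u - v.1) * lNorm a (u - v.1) / (hNorm b u * lNorm a u)

end CKN

end

/-! Write 2γ = b + 1 - a. In both regimes γ > 0, and with κ = 0 in the first and κ = 2b + 2 - N in
the second, every test function φ and every real λ satisfy ‖∇φ + (λ|x|^{2γ-2} - κ|x|^{-2}) φ x‖_b² =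
‖∇φ‖_b² + λ²‖φ‖_a² - λNγ‖φ‖_c² (`Approx.norm_identity`). Here the square is expanded and the cross
terms are integrated by parts along the dilation field. The left side is nonnegative for all λ, so
the discriminant in λ yields the inequality with constant Nγ/2. The constant is sharp because the
field on the left vanishes for the profile g = |x|^κ exp(-(λ/2γ)|x|^{2γ}).

Stability: for u = w g the left side equals ∫ |x|^{-2b} g² |∇w|². A weighted Poincaré inequality for
w (`exists_stretched_poincare`, used in `exists_twisted_poincare`) bounds ‖u - kg‖_c² by C/λ times
this quantity for some k. The field is the same for u - kg as for u, so the identity for u - kg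
bounds ‖∇(u - kg)‖_b² + λ²‖u - kg‖_a² by a multiple of it, uniformly in λ. That sum is at least 2λ
times the product of the two norms. For λ = ‖∇u‖_b / ‖u‖_a the left side for u is exactly
2λ(‖∇u‖_b‖u‖_a - (Nγ/2)‖u‖_c²), so λ cancels and the estimate is linear in the deficit
(`exists_stability`). The Poincaré inequality is transported by the radial map y ↦ μ|y|^{1/γ-1}y
from the Gaussian one, which follows by rotating a product of two Gaussians
(`exists_gaussian_poincare`).

All this is done for test functions. `MemH.approx` shows that elements of H²_b ∩ L²_a are limits of
test functions in all the relevant norms at once, by Hardy's inequality and logarithmic cut-offs.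

Sharpness of the exponent: perturb g by εφ with φ odd. The deficit is O(ε²) by the identity.
Minimizers are even, so no v removes the odd part, and the inequality applied to u - v bounds the
distance below by a multiple of ε² (`exists_deficit_le_strongDist`). A power t > 1 of the deficit is
then too small. -/

open scoped ENNReal

noncomputable section

/-! ### Calculus away from the origin and Euler's identity -/

namespace CKN

variable {N : ℕ}

/-- Functions that are smooth on `ℝ^N ∖ {0}`. -/
def SmoothOff (h : E N → ℝ) : Prop := ∀ x ≠ 0, ContDiffAt ℝ ∞ h x

theorem SmoothOff.differentiableAt {h : E N → ℝ} (hh : SmoothOff h) {x : E N} (hx : x ≠ 0) :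
    DifferentiableAt ℝ h x := (hh x hx).differentiableAt (by simp)

theorem SmoothOff.continuousOn {h : E N → ℝ} (hh : SmoothOff h) : ContinuousOn h {0}ᶜ :=
  fun x hx => (hh x hx).continuousAt.continuousWithinAt

theorem SmoothOff.mul {h k : E N → ℝ} (hh : SmoothOff h) (hk : SmoothOff k) :
    SmoothOff (fun x => h x * k x) := fun x hx => (hh x hx).mul (hk x hx)

theorem SmoothOff.const_mul {h : E N → ℝ} (hh : SmoothOff h) (k : ℝ) :
    SmoothOff (fun x => k * h x) := fun x hx => contDiffAt_const.mul (hh x hx)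

theorem smoothOff_rpow (p : ℝ) : SmoothOff (fun x : E N => ‖x‖ ^ p) := fun _ hx =>
  (contDiffAt_norm ℝ hx).rpow_const_of_ne (norm_ne_zero_iff.2 hx)

theorem IsTest.smoothOff {φ : E N → ℝ} (h : IsTest φ) : SmoothOff φ :=
  fun _ _ => h.smooth.contDiffAt

theorem IsTest.differentiable {φ : E N → ℝ} (h : IsTest φ) : Differentiable ℝ φ :=
  h.smooth.differentiable (by simp)

theorem ContinuousOn.gradient_of_smoothOff {h : E N → ℝ} (hh : SmoothOff h) :
    ContinuousOn (∇ h) {0}ᶜ := by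
  intro x hx
  have : ContinuousAt (fderiv ℝ h) x :=
    ((hh x hx).fderiv_right (m := 0) (by simp)).continuousAt
  exact ((InnerProductSpace.toDual ℝ (E N)).symm.continuous.continuousAt.comp this).continuousWithinAt

theorem gradient_mul {u v : E N → ℝ} {x : E N} (hu : DifferentiableAt ℝ u x)
    (hv : DifferentiableAt ℝ v x) :
    ∇ (fun y => u y * v y) x = u x • ∇ v x + v x • ∇ u x := by
  refine HasGradientAt.gradient (hasGradientAt_iff_hasFDerivAt.2 ?_)
  simp only [map_add, map_smul, toDual_gradient]
  exact hu.hasFDerivAt.mul hv.hasFDerivAt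

theorem gradient_add {u v : E N → ℝ} {x : E N} (hu : DifferentiableAt ℝ u x)
    (hv : DifferentiableAt ℝ v x) :
    ∇ (fun y => u y + v y) x = ∇ u x + ∇ v x := by
  refine HasGradientAt.gradient (hasGradientAt_iff_hasFDerivAt.2 ?_)
  simp only [map_add, toDual_gradient]
  exact hu.hasFDerivAt.add hv.hasFDerivAt

theorem gradient_const_mul {u : E N → ℝ} {x : E N} (hu : DifferentiableAt ℝ u x) (k : ℝ) :
    ∇ (fun y => k * u y) x = k • ∇ u x := by
  refine HasGradientAt.gradient (hasGradientAt_iff_hasFDerivAt.2 ?_)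
  simp only [map_smul, toDual_gradient]
  exact hu.hasFDerivAt.const_mul k

theorem hasGradientAt_comp_norm {f : ℝ → ℝ} {f' : ℝ} {x : E N} (hx : x ≠ 0)
    (hf : HasDerivAt f f' ‖x‖) :
    HasGradientAt (fun y : E N => f ‖y‖) ((f' / ‖x‖) • x) x := by
  have hn : ‖x‖ ≠ 0 := norm_ne_zero_iff.2 hx
  have h1 : HasFDerivAt (fun y : E N => ‖y‖) (‖x‖⁻¹ • innerSL ℝ x) x := by
    have h2 := (hasStrictFDerivAt_norm_sq x).hasFDerivAt.sqrt (by positivity)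
    simp only [Real.sqrt_sq (norm_nonneg _)] at h2
    convert! h2 using 1
    ext y
    simp
    field_simp
  rw [hasGradientAt_iff_hasFDerivAt]
  convert! hf.comp_hasFDerivAt x h1 using 1
  ext y
  simp
  field_simp

theorem hasGradientAt_rpow (p : ℝ) {x : E N} (hx : x ≠ 0) :
    HasGradientAt (fun y : E N => ‖y‖ ^ p) ((p * ‖x‖ ^ (p - 2)) • x) x := by
  have hn : 0 < ‖x‖ := norm_pos_iff.2 hx
  have := hasGradientAt_comp_norm hx (Real.hasDerivAt_rpow_const (p := p) (Or.inl hn.ne'))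
  convert! this using 2
  rw [show p - 1 = p - 2 + 1 by ring, Real.rpow_add hn, Real.rpow_one]
  field_simp

theorem IsTest.eventuallyEq_zero {φ : E N → ℝ} (h : IsTest φ) : φ =ᶠ[𝓝 0] 0 :=
  notMem_tsupport_iff_eventuallyEq.1 h.zero_notMem

theorem IsTest.gradient_eq_zero {φ : E N → ℝ} {x : E N} (hx : x ∉ tsupport φ) : ∇ φ x = 0 := by
  have := (notMem_tsupport_iff_eventuallyEq.1 hx).gradient_eq
  rw [this]
  exact gradient_const' (F := E N) (0 : ℝ) ▸ rfl

/-- A function dominated in support by a test function and continuous off the origin is continuous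
with compact support. -/
theorem IsTest.continuous_of_support {F : Type*} [NormedAddCommGroup F] {φ : E N → ℝ}
    (h : IsTest φ) {f : E N → F} (hf : ContinuousOn f {0}ᶜ) (hs : ∀ x ∉ tsupport φ, f x = 0) :
    Continuous f ∧ HasCompactSupport f := by
  refine ⟨continuous_iff_continuousAt.2 fun x => ?_, HasCompactSupport.intro h.compact hs⟩
  by_cases hx : x = 0
  · have : f =ᶠ[𝓝 x] fun _ => 0 := by
      have : (tsupport φ)ᶜ ∈ 𝓝 x := (isClosed_tsupport φ).isOpen_compl.mem_nhds
        (by rw [hx]; exact h.zero_notMem)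
      filter_upwards [this] with y hy using hs y hy
    exact continuousAt_const.congr this.symm
  · exact hf.continuousAt (isOpen_compl_singleton.mem_nhds hx)

theorem IsTest.integrable_of_support {F : Type*} [NormedAddCommGroup F] {φ : E N → ℝ}
    (h : IsTest φ) {f : E N → F} (hf : ContinuousOn f {0}ᶜ) (hs : ∀ x ∉ tsupport φ, f x = 0) :
    Integrable f :=
  (h.continuous_of_support hf hs).1.integrable_of_hasCompactSupport (h.continuous_of_support hf hs).2

theorem IsTest.of_support {φ f : E N → ℝ} (h : IsTest φ) (hf : SmoothOff f)
    (hs : ∀ x ∉ tsupport φ, f x = 0) : IsTest f where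
  smooth := contDiff_iff_contDiffAt.2 fun x => by
    by_cases hx : x = 0
    · have : f =ᶠ[𝓝 x] fun _ => 0 := by
        have : (tsupport φ)ᶜ ∈ 𝓝 x := (isClosed_tsupport φ).isOpen_compl.mem_nhds
          (by rw [hx]; exact h.zero_notMem)
        filter_upwards [this] with y hy using hs y hy
      exact contDiffAt_const.congr_of_eventuallyEq this
    · exact hf x hx
  compact := HasCompactSupport.intro h.compact hs
  zero_notMem := fun h0 => h.zero_notMem <|
    closure_minimal (fun x hx => by by_contra hc; exact hx (hs x hc)) (isClosed_tsupport φ) h0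

theorem IsTest.mul {φ h : E N → ℝ} (hφ : IsTest φ) (hh : SmoothOff h) :
    IsTest (fun x => φ x * h x) :=
  hφ.of_support (hφ.smoothOff.mul hh) fun x hx => by
    rw [image_eq_zero_of_notMem_tsupport hx, zero_mul]

theorem IsTest.const_mul {φ : E N → ℝ} (hφ : IsTest φ) (k : ℝ) :
    IsTest (fun x => k * φ x) :=
  hφ.of_support (hφ.smoothOff.const_mul k) fun x hx => by
    rw [image_eq_zero_of_notMem_tsupport hx, mul_zero]

theorem IsTest.add {φ ψ : E N → ℝ} (hφ : IsTest φ) (hψ : IsTest ψ) :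
    IsTest (fun x => φ x + ψ x) where
  smooth := hφ.smooth.add hψ.smooth
  compact := hφ.compact.add hψ.compact
  zero_notMem := by
    rw [notMem_tsupport_iff_eventuallyEq]
    filter_upwards [hφ.eventuallyEq_zero, hψ.eventuallyEq_zero] with x h1 h2
    simp [h1, h2]

theorem IsTest.sub {φ ψ : E N → ℝ} (hφ : IsTest φ) (hψ : IsTest ψ) :
    IsTest (fun x => φ x - ψ x) := by
  convert! hφ.add (hψ.const_mul (-1)) using 2
  ring

theorem IsTest.integral_mul_fderiv {φ : E N → ℝ} (hφ : IsTest φ) {h : E N → ℝ}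
    (hh : ContDiff ℝ 1 h) (v : E N) :
    ∫ x, h x * fderiv ℝ φ x v = - ∫ x, fderiv ℝ h x v * φ x := by
  have c1 : Continuous fun x => fderiv ℝ φ x v :=
    (hφ.smooth.continuous_fderiv (by simp)).clm_apply continuous_const
  have c2 : Continuous fun x => fderiv ℝ h x v :=
    (hh.continuous_fderiv (by simp)).clm_apply continuous_const
  have s1 : HasCompactSupport fun x => fderiv ℝ φ x v := hφ.compact.fderiv_apply (𝕜 := ℝ) v
  refine integral_mul_fderiv_eq_neg_fderiv_mul_of_integrable ?_ ?_ ?_ ?_ ?_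
  · exact (c2.mul hφ.smooth.continuous).integrable_of_hasCompactSupport hφ.compact.mul_left
  · exact (hh.continuous.mul c1).integrable_of_hasCompactSupport s1.mul_left
  · exact (hh.continuous.mul hφ.smooth.continuous).integrable_of_hasCompactSupport
      hφ.compact.mul_left
  · exact fun x _ => hh.differentiable (by simp) x
  · exact fun x _ => hφ.differentiable x

theorem IsTest.integrable_gradient {φ : E N → ℝ} (hφ : IsTest φ) : Integrable (∇ φ) :=
  hφ.integrable_of_support (ContinuousOn.gradient_of_smoothOff hφ.smoothOff)
    fun _ hx => IsTest.gradient_eq_zero hx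

theorem IsTest.integral_gradient {φ : E N → ℝ} (hφ : IsTest φ) : ∫ x, ∇ φ x = 0 := by
  refine ext_inner_right ℝ fun v => ?_
  rw [inner_zero_left, real_inner_comm, ← integral_inner hφ.integrable_gradient]
  have := hφ.integral_mul_fderiv (h := fun _ => 1) contDiff_const v
  have e : ∀ x, inner ℝ v (∇ φ x) = fderiv ℝ φ x v := fun x => by
    rw [real_inner_comm, inner_gradient_left]
  simp_rw [e]
  simpa using this

/-- Euler's identity for the dilation vector field. -/
theorem IsTest.integral_inner_gradient {φ : E N → ℝ} (hφ : IsTest φ) :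
    ∫ x, inner ℝ x (∇ φ x) = - (N * ∫ x, φ x) := by
  have key : ∀ x, inner ℝ x (∇ φ x) =
      ∑ i, x i * fderiv ℝ φ x (EuclideanSpace.single i (1:ℝ)) := fun x => by
    rw [real_inner_comm, inner_gradient_left]
    conv_lhs => arg 2; rw [← (EuclideanSpace.basisFun (Fin N) ℝ).sum_repr x]
    simp
  have hi : ∀ i, ∫ x : E N, x i * fderiv ℝ φ x (EuclideanSpace.single i (1:ℝ)) = - ∫ x, φ x := by
    intro i
    rw [hφ.integral_mul_fderiv (h := fun x => x i) (by fun_prop)]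
    congr 2
    ext x
    have : HasFDerivAt (fun x : E N => x i) (EuclideanSpace.proj i : E N →L[ℝ] ℝ) x :=
      (EuclideanSpace.proj i : E N →L[ℝ] ℝ).hasFDerivAt
    rw [this.fderiv]
    simp
  simp_rw [key]
  rw [integral_finsetSum]
  · simp [hi]
  · intro i _
    have c1 : Continuous fun x => fderiv ℝ φ x (EuclideanSpace.single i (1:ℝ)) :=
      (hφ.smooth.continuous_fderiv (by simp)).clm_apply continuous_const
    have s1 := hφ.compact.fderiv_apply (𝕜 := ℝ) (EuclideanSpace.single i (1:ℝ))
    have c2 : Continuous fun x : E N => x i := by fun_prop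
    exact (c2.mul c1).integrable_of_hasCompactSupport s1.mul_left

/-- Euler's identity applied to |x|^p φ². Every cross term in the expansion of the twisted norm has
this form. -/
theorem IsTest.integral_rpow_inner_gradient {φ : E N → ℝ} (hφ : IsTest φ) (p : ℝ) :
    2 * ∫ x, ‖x‖ ^ p * (φ x * inner ℝ x (∇ φ x)) = - ((N + p) * ∫ x, ‖x‖ ^ p * φ x ^ 2) := by
  have h1 : IsTest (fun x => φ x * (φ x * ‖x‖ ^ p)) :=
    hφ.mul (hφ.smoothOff.mul (smoothOff_rpow p))
  have h2 := h1.integral_inner_gradient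
  have i1 : Integrable fun x => ‖x‖ ^ p * (φ x * inner ℝ x (∇ φ x)) :=
    hφ.integrable_of_support ((smoothOff_rpow p).continuousOn.mul (hφ.smooth.continuous.continuousOn.mul
      (continuousOn_id.inner (𝕜 := ℝ) (ContinuousOn.gradient_of_smoothOff hφ.smoothOff)))) fun x hx => by
        rw [image_eq_zero_of_notMem_tsupport hx]; simp
  have i2 : Integrable fun x => ‖x‖ ^ p * φ x ^ 2 :=
    hφ.integrable_of_support ((smoothOff_rpow p).continuousOn.mul
      (hφ.smooth.continuous.continuousOn.pow 2)) fun x hx => by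
        rw [image_eq_zero_of_notMem_tsupport hx]; simp
  have key : ∀ x, inner ℝ x (∇ (fun x => φ x * (φ x * ‖x‖ ^ p)) x) =
      2 * (‖x‖ ^ p * (φ x * inner ℝ x (∇ φ x))) + p * (‖x‖ ^ p * φ x ^ 2) := by
    intro x
    by_cases hx : x = 0
    · have : φ x = 0 := by rw [hx]; exact hφ.eventuallyEq_zero.self_of_nhds
      rw [this, hx, inner_zero_left, inner_zero_left]; simp
    have hr := hasGradientAt_rpow p hx
    rw [gradient_mul (v := fun x => φ x * ‖x‖ ^ p) (hφ.differentiable x)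
        ((hφ.differentiable x).mul hr.differentiableAt),
      gradient_mul (hφ.differentiable x) hr.differentiableAt, hr.gradient]
    have hn : 0 < ‖x‖ := norm_pos_iff.2 hx
    have e : ‖x‖ ^ p = ‖x‖ ^ (p - 2) * ‖x‖ ^ 2 := by
      rw [← Real.rpow_natCast, ← Real.rpow_add hn]; norm_num
    simp only [inner_add_right, inner_smul_right, real_inner_self_eq_norm_sq]
    rw [e]
    ring
  simp_rw [key] at h2
  rw [integral_add (i1.const_mul 2) (i2.const_mul p), integral_const_mul, integral_const_mul] at h2
  have e3 : ∫ x, φ x * (φ x * ‖x‖ ^ p) = ∫ x, ‖x‖ ^ p * φ x ^ 2 := by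
    congr 1; ext x; ring
  rw [e3] at h2
  linarith

end CKN

/-! ### Weighted norms and weak gradients -/

namespace CKN

variable {N : ℕ} {F : Type*} [NormedAddCommGroup F] [NormedSpace ℝ F]

theorem measurable_weight (a : ℝ) : Measurable fun x : E N => ‖x‖ ^ (-a) :=
  measurable_norm.pow_const _

theorem aesm_weight {f : E N → F} (a : ℝ) (hf : AEStronglyMeasurable f volume) :
    AEStronglyMeasurable (fun x => ‖x‖ ^ (-a) • f x) volume :=
  (measurable_weight a).aestronglyMeasurable.smul hf

theorem eWeightedNorm_congr {f g : E N → F} (a : ℝ) (h : f =ᵐ[volume] g) :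
    eWeightedNorm a f = eWeightedNorm a g :=
  eLpNorm_congr_ae (h.mono fun x hx => by simp only [hx])

theorem eWeightedNorm_mono {F' : Type*} [NormedAddCommGroup F'] [NormedSpace ℝ F']
    {f : E N → F} {g : E N → F'} {a a' : ℝ}
    (h : ∀ᵐ x : E N, ‖x‖ ^ (-a) * ‖f x‖ ≤ ‖x‖ ^ (-a') * ‖g x‖) :
    eWeightedNorm a f ≤ eWeightedNorm a' g := by
  refine eLpNorm_mono_ae (h.mono fun x hx => ?_)
  rw [norm_smul, norm_smul, Real.norm_of_nonneg (by positivity), Real.norm_of_nonneg (by positivity)]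
  exact hx

theorem eWeightedNorm_add_le {f g : E N → F} (a : ℝ) (hf : AEStronglyMeasurable f volume)
    (hg : AEStronglyMeasurable g volume) :
    eWeightedNorm a (fun x => f x + g x) ≤ eWeightedNorm a f + eWeightedNorm a g := by
  have := eLpNorm_add_le (aesm_weight a hf) (aesm_weight a hg) (p := 2) (by norm_num)
  refine le_trans (le_of_eq ?_) this
  exact eLpNorm_congr_ae (ae_of_all _ fun x => by simp [smul_add])

theorem eWeightedNorm_neg (f : E N → F) (a : ℝ) :
    eWeightedNorm a (fun x => - f x) = eWeightedNorm a f := by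
  unfold eWeightedNorm
  rw [← eLpNorm_neg]
  exact eLpNorm_congr_ae (ae_of_all _ fun x => by simp)

theorem eWeightedNorm_sub_le {f g : E N → F} (a : ℝ) (hf : AEStronglyMeasurable f volume)
    (hg : AEStronglyMeasurable g volume) :
    eWeightedNorm a (fun x => f x - g x) ≤ eWeightedNorm a f + eWeightedNorm a g := by
  have := eWeightedNorm_add_le a hf hg.neg
  simp only [Pi.neg_apply, ← sub_eq_add_neg] at this
  rwa [show eWeightedNorm a (-g) = _ from eWeightedNorm_neg g a] at this

theorem eWeightedNorm_const_smul (f : E N → F) (a k : ℝ) :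
    eWeightedNorm a (fun x => k • f x) = ENNReal.ofReal |k| * eWeightedNorm a f := by
  unfold eWeightedNorm
  rw [← Real.norm_eq_abs, ofReal_norm, ← eLpNorm_const_smul]
  exact eLpNorm_congr_ae (ae_of_all _ fun x => by simp [smul_comm k])

theorem eWeightedNorm_sq (f : E N → F) (a : ℝ) :
    eWeightedNorm a f ^ 2 = ∫⁻ x, ENNReal.ofReal (‖x‖ ^ (-(2 * a)) * ‖f x‖ ^ 2) := by
  have := eLpNorm_nnreal_pow_eq_lintegral (p := 2) (f := fun x : E N => ‖x‖ ^ (-a) • f x)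
    (μ := volume) (by norm_num)
  unfold eWeightedNorm
  simp only [NNReal.coe_ofNat, ENNReal.rpow_ofNat, ENNReal.coe_ofNat] at this
  rw [this]
  congr 1
  ext x
  rw [← ofReal_norm, ← ENNReal.ofReal_pow (norm_nonneg _), norm_smul, mul_pow,
    Real.norm_of_nonneg (by positivity), ← Real.rpow_natCast, ← Real.rpow_mul (norm_nonneg _)]
  congr 4
  push_cast; ring

theorem toReal_eWeightedNorm_sq (f : E N → F) (a : ℝ) (hf : AEStronglyMeasurable f volume) :
    (eWeightedNorm a f).toReal ^ 2 = ∫ x, ‖x‖ ^ (-(2 * a)) * ‖f x‖ ^ 2 := by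
  rw [← ENNReal.toReal_pow, eWeightedNorm_sq, integral_eq_lintegral_of_nonneg_ae]
  · exact ae_of_all _ fun x => by positivity
  · exact (measurable_norm.pow_const _).aestronglyMeasurable.mul (hf.norm.pow 2)

theorem IsTest.eWeightedNorm_lt_top {φ : E N → ℝ} (h : IsTest φ) {f : E N → F} (a : ℝ)
    (hf : ContinuousOn f {0}ᶜ) (hs : ∀ x ∉ tsupport φ, f x = 0) : eWeightedNorm a f < ⊤ := by
  have := h.continuous_of_support (f := fun x => ‖x‖ ^ (-a) • f x)
    ((smoothOff_rpow _).continuousOn.smul hf) fun x hx => by rw [hs x hx, smul_zero]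
  exact (this.1.memLp_of_hasCompactSupport this.2).2

theorem IsTest.eWeightedNorm_lt_top' {φ : E N → ℝ} (h : IsTest φ) (a : ℝ) :
    eWeightedNorm a φ < ⊤ :=
  h.eWeightedNorm_lt_top a h.smooth.continuous.continuousOn fun _ => image_eq_zero_of_notMem_tsupport

theorem IsTest.eWeightedNorm_gradient_lt_top {φ : E N → ℝ} (h : IsTest φ) (a : ℝ) :
    eWeightedNorm a (∇ φ) < ⊤ :=
  h.eWeightedNorm_lt_top a (ContinuousOn.gradient_of_smoothOff h.smoothOff)
    fun _ => IsTest.gradient_eq_zero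

theorem IsTest.aesm {φ : E N → ℝ} (h : IsTest φ) : AEStronglyMeasurable φ volume :=
  h.smooth.continuous.aestronglyMeasurable

theorem IsTest.aesm_gradient {φ : E N → ℝ} (h : IsTest φ) : AEStronglyMeasurable (∇ φ) volume :=
  h.integrable_gradient.1

theorem integrable_smul_of_locallyIntegrableOn {F' : Type*} [NormedAddCommGroup F']
    [NormedSpace ℝ F'] {φ : E N → ℝ} (h : IsTest φ)
    {u : E N → ℝ} {f : E N → F'} (hu : LocallyIntegrableOn u {0}ᶜ volume)
    (hf : ContinuousOn f {0}ᶜ) (hs : ∀ x ∉ tsupport φ, f x = 0) :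
    Integrable fun x => u x • f x := by
  have hK : tsupport φ ⊆ {0}ᶜ := fun x hx h0 => h.zero_notMem (h0 ▸ hx)
  have hi : IntegrableOn u (tsupport φ) := hu.integrableOn_compact_subset hK h.compact
  rw [← integrableOn_iff_integrable_of_support_subset (s := tsupport φ)]
  · exact hi.smul_continuousOn (hf.mono hK) h.compact
  · intro x hx
    by_contra hc
    exact hx (by simp [hs x hc])

theorem integrable_smul_of_locallyIntegrableOn' {φ : E N → ℝ} (h : IsTest φ)
    {G : E N → F} (hG : LocallyIntegrableOn G {0}ᶜ volume) :
    Integrable fun x => φ x • G x := by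
  have hK : tsupport φ ⊆ {0}ᶜ := fun x hx h0 => h.zero_notMem (h0 ▸ hx)
  have hi : IntegrableOn G (tsupport φ) := hG.integrableOn_compact_subset hK h.compact
  rw [← integrableOn_iff_integrable_of_support_subset (s := tsupport φ)]
  · exact hi.continuousOn_smul h.smooth.continuous.continuousOn h.compact
  · intro x hx
    by_contra hc
    exact hx (by simp [image_eq_zero_of_notMem_tsupport hc])

theorem HasWeakGrad.add {u v : E N → ℝ} {G H : E N → E N} (hu : HasWeakGrad u G)
    (hv : HasWeakGrad v H) : HasWeakGrad (fun x => u x + v x) (fun x => G x + H x) where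
  locInt := hu.locInt.add hv.locInt
  locInt_grad := hu.locInt_grad.add hv.locInt_grad
  integral_eq φ hφ := by
    have hg := ContinuousOn.gradient_of_smoothOff hφ.smoothOff
    simp only [add_smul, smul_add]
    rw [integral_add, integral_add, hu.integral_eq φ hφ, hv.integral_eq φ hφ, neg_add]
    · exact integrable_smul_of_locallyIntegrableOn' hφ hu.locInt_grad
    · exact integrable_smul_of_locallyIntegrableOn' hφ hv.locInt_grad
    · exact integrable_smul_of_locallyIntegrableOn hφ hu.locInt hg fun _ => IsTest.gradient_eq_zero
    · exact integrable_smul_of_locallyIntegrableOn hφ hv.locInt hg fun _ => IsTest.gradient_eq_zero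

theorem HasWeakGrad.const_mul {u : E N → ℝ} {G : E N → E N} (hu : HasWeakGrad u G) (k : ℝ) :
    HasWeakGrad (fun x => k * u x) (fun x => k • G x) where
  locInt x hx := by
    obtain ⟨t, ht, h⟩ := hu.locInt x hx
    exact ⟨t, ht, Integrable.const_mul h k⟩
  locInt_grad x hx := by
    obtain ⟨t, ht, h⟩ := hu.locInt_grad x hx
    exact ⟨t, ht, Integrable.smul k h⟩
  integral_eq φ hφ := by
    simp only [mul_smul, smul_comm _ k]
    rw [integral_smul, integral_smul, hu.integral_eq φ hφ, smul_neg]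

theorem HasWeakGrad.sub {u v : E N → ℝ} {G H : E N → E N} (hu : HasWeakGrad u G)
    (hv : HasWeakGrad v H) : HasWeakGrad (fun x => u x - v x) (fun x => G x - H x) := by
  convert! hu.add (hv.const_mul (-1)) using 2
  · ring
  · simp [sub_eq_add_neg]

/-- For a test function φ the product φu is again a test function, and its gradient integrates to
zero. -/
theorem SmoothOff.hasWeakGrad {u : E N → ℝ} (hu : SmoothOff u) : HasWeakGrad u (∇ u) where
  locInt := hu.continuousOn.locallyIntegrableOn (measurableSet_singleton 0).compl
  locInt_grad := (ContinuousOn.gradient_of_smoothOff hu).locallyIntegrableOn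
    (measurableSet_singleton 0).compl
  integral_eq φ hφ := by
    have h := (hφ.mul hu).integral_gradient
    have key : ∀ x, ∇ (fun x => φ x * u x) x = φ x • ∇ u x + u x • ∇ φ x := by
      intro x
      by_cases hx : x = 0
      · have hn : x ∉ tsupport φ := hx ▸ hφ.zero_notMem
        have hn' : x ∉ tsupport fun x => φ x * u x := hx ▸ (hφ.mul hu).zero_notMem
        rw [IsTest.gradient_eq_zero hn, IsTest.gradient_eq_zero hn',
          image_eq_zero_of_notMem_tsupport hn]
        simp
      · exact gradient_mul (hφ.differentiable x) (hu.differentiableAt hx)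
    simp_rw [key] at h
    rw [integral_add] at h
    · exact eq_neg_of_add_eq_zero_right h
    · exact hφ.integrable_of_support (hφ.smooth.continuous.continuousOn.smul
        (ContinuousOn.gradient_of_smoothOff hu)) fun x hx => by
          rw [image_eq_zero_of_notMem_tsupport hx, zero_smul]
    · exact hφ.integrable_of_support (hu.continuousOn.smul
        (ContinuousOn.gradient_of_smoothOff hφ.smoothOff)) fun x hx => by
          rw [IsTest.gradient_eq_zero hx, smul_zero]

theorem WeaklyDiff.hasWeakGrad {u : E N → ℝ} (h : WeaklyDiff u) : HasWeakGrad u (weakGrad u) := by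
  rw [weakGrad, dif_pos h]
  exact h.choose_spec

section

variable [NeZero N]

theorem ae_ne_zero : ∀ᵐ x : E N, x ≠ 0 := by
  rw [ae_iff]
  simpa only [ne_eq, not_not, Set.ofPred_eq_eq_singleton] using measure_singleton (0 : E N)

theorem aesm_of_locallyIntegrableOn {F' : Type*} [NormedAddCommGroup F'] {f : E N → F'} (hf : LocallyIntegrableOn f {0}ᶜ volume) :
    AEStronglyMeasurable f volume := by
  have := hf.aestronglyMeasurable
  rwa [restrict_compl_singleton] at this

theorem HasWeakGrad.aesm {u : E N → ℝ} {G : E N → E N} (h : HasWeakGrad u G) :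
    AEStronglyMeasurable u volume := aesm_of_locallyIntegrableOn h.locInt

theorem HasWeakGrad.aesm_grad {u : E N → ℝ} {G : E N → E N} (h : HasWeakGrad u G) :
    AEStronglyMeasurable G volume := aesm_of_locallyIntegrableOn h.locInt_grad

/-- The fundamental lemma of the calculus of variations. It makes the choice inside `weakGrad`
harmless, so that `eHNorm` can be computed from any weak gradient. -/
theorem HasWeakGrad.ae_eq {u : E N → ℝ} {G H : E N → E N} (hG : HasWeakGrad u G)
    (hH : HasWeakGrad u H) : G =ᵐ[volume] H := by
  have h0 := isOpen_compl_singleton.ae_eq_zero_of_integral_contDiff_smul_eq_zero (μ := volume)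
    (U := {(0 : E N)}ᶜ) (hG.locInt_grad.sub hH.locInt_grad) fun φ h1 h2 h3 => by
      have hφ : IsTest φ := ⟨h1, h2, fun h => h3 h rfl⟩
      simp only [Pi.sub_apply, smul_sub]
      rw [integral_sub (integrable_smul_of_locallyIntegrableOn' hφ hG.locInt_grad)
        (integrable_smul_of_locallyIntegrableOn' hφ hH.locInt_grad)]
      have e1 := hG.integral_eq φ hφ
      have e2 := hH.integral_eq φ hφ
      rw [e1, neg_inj] at e2
      rw [e2, sub_self]
  filter_upwards [h0, ae_ne_zero] with x hx hx0
  exact sub_eq_zero.1 (hx hx0)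

theorem HasWeakGrad.eHNorm_eq {u : E N → ℝ} {G : E N → E N} (h : HasWeakGrad u G) (b : ℝ) :
    eHNorm b u = eWeightedNorm b G := by
  have hw : WeaklyDiff u := ⟨G, h⟩
  refine eWeightedNorm_congr b ?_
  rw [weakGrad, dif_pos hw]
  exact hw.choose_spec.ae_eq h

end

theorem eWeightedNorm_tendsto {f : E N → F} {g : ℕ → E N → F} (a : ℝ)
    (hf : AEStronglyMeasurable f volume) (hg : ∀ n, AEStronglyMeasurable (g n) volume)
    (h : Tendsto (fun n => eWeightedNorm a (fun x => f x - g n x)) atTop (𝓝 0)) :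
    Tendsto (fun n => eWeightedNorm a (g n)) atTop (𝓝 (eWeightedNorm a f)) := by
  have h1 : ∀ n, eWeightedNorm a (g n) ≤
      eWeightedNorm a f + eWeightedNorm a (fun x => f x - g n x) := fun n => by
    have := eWeightedNorm_sub_le (g := fun x => f x - g n x) a hf (hf.sub (hg n))
    simpa only [sub_sub_cancel, add_sub_cancel] using this
  have h2 : ∀ n, eWeightedNorm a f - eWeightedNorm a (fun x => f x - g n x) ≤
      eWeightedNorm a (g n) := fun n => by
    rw [tsub_le_iff_right]
    have := eWeightedNorm_add_le (g := fun x => f x - g n x) a (hg n) (hf.sub (hg n))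
    simpa only [sub_sub_cancel, add_sub_cancel] using this
  refine tendsto_of_tendsto_of_tendsto_of_le_of_le ?_ ?_ h2 h1
  · have := ENNReal.Tendsto.sub (tendsto_const_nhds (x := eWeightedNorm a f) (f := atTop)) h
      (Or.inr (by simp))
    simpa using this
  · have := (tendsto_const_nhds (x := eWeightedNorm a f) (f := atTop)).add h
    simpa using this

end CKN

/-! ### The norm identity, Hardy's inequality and the sharp inequality -/

namespace CKN

variable {N : ℕ}

/-- The relations between the exponents shared by both parameter regimes: `2γ = b + 1 - a` is the
exponent in the exponential and `κ` the exponent of the power in the minimizers. -/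
structure Params (N : ℕ) (a b γ κ : ℝ) : Prop where
  three_le : 3 ≤ N
  pos : 0 < γ
  a_eq : a = b + 1 - 2 * γ
  power : κ * (2 * b + 2 - N - κ) = 0
  scale : N - 2 * b - 2 + 2 * κ = (N - 2) * γ

/-- `G + (α |x|^{2γ-2} + β |x|^{-2}) u x`. -/
def twisted (γ α β : ℝ) (u : E N → ℝ) (G : E N → E N) (x : E N) : E N :=
  G x + ((α * ‖x‖ ^ (2 * γ - 2) + β * ‖x‖ ^ (-2 : ℝ)) * u x) • x

/-- The square is expanded pointwise, and the two terms containing φ ⟨x, ∇φ⟩ are turned into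
weighted L² norms by Euler's identity with p = -2(b+1-γ) and p = -2(b+1). -/
theorem IsTest.twisted_norm_sq {φ : E N → ℝ} (hφ : IsTest φ) (b γ α β : ℝ) :
    (eWeightedNorm b (twisted γ α β φ (∇ φ))).toReal ^ 2 =
      (eWeightedNorm b (∇ φ)).toReal ^ 2 + α ^ 2 * (eWeightedNorm (b + 1 - 2 * γ) φ).toReal ^ 2 +
      (β ^ 2 - β * (N - 2 * b - 2)) * (eWeightedNorm (b + 1) φ).toReal ^ 2 +
      (2 * α * β - α * (N - 2 * b - 2 + 2 * γ)) *
        (eWeightedNorm (b + 1 - γ) φ).toReal ^ 2 := by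
  have hg := ContinuousOn.gradient_of_smoothOff hφ.smoothOff
  have hφc : ContinuousOn φ {0}ᶜ := hφ.smooth.continuous.continuousOn
  have hw : ∀ p : ℝ, ContinuousOn (fun x : E N => ‖x‖ ^ p) {0}ᶜ :=
    fun p => (smoothOff_rpow p).continuousOn
  have hin : ContinuousOn (fun x => inner ℝ x (∇ φ x)) {0}ᶜ := continuousOn_id.inner (𝕜 := ℝ) hg
  have ht : AEStronglyMeasurable (twisted γ α β φ (∇ φ)) volume := by
    refine (hφ.integrable_of_support ?_ fun x hx => ?_).1
    · exact hg.add (((((hw _).const_mul α).add ((hw _).const_mul β)).mul hφc).smul continuousOn_id)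
    · rw [twisted, IsTest.gradient_eq_zero hx, image_eq_zero_of_notMem_tsupport hx]; simp
  rw [toReal_eWeightedNorm_sq _ _ ht, toReal_eWeightedNorm_sq _ _ hφ.aesm_gradient,
    toReal_eWeightedNorm_sq _ _ hφ.aesm, toReal_eWeightedNorm_sq _ _ hφ.aesm,
    toReal_eWeightedNorm_sq _ _ hφ.aesm]
  have i0 : Integrable fun x => ‖x‖ ^ (-(2 * b)) * ‖∇ φ x‖ ^ 2 :=
    hφ.integrable_of_support ((hw _).mul (hg.norm.pow 2)) fun x hx => by
      rw [IsTest.gradient_eq_zero hx]; simp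
  have i1 : ∀ p : ℝ, Integrable fun x => ‖x‖ ^ p * ‖φ x‖ ^ 2 := fun p =>
    hφ.integrable_of_support ((hw _).mul (hφc.norm.pow 2)) fun x hx => by
      rw [image_eq_zero_of_notMem_tsupport hx]; simp
  have i2 : ∀ p : ℝ, Integrable fun x => ‖x‖ ^ p * (φ x * inner ℝ x (∇ φ x)) := fun p =>
    hφ.integrable_of_support ((hw _).mul (hφc.mul hin)) fun x hx => by
      rw [image_eq_zero_of_notMem_tsupport hx]; simp
  have key : ∀ᵐ x : E N, ‖x‖ ^ (-(2 * b)) * ‖twisted γ α β φ (∇ φ) x‖ ^ 2 =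
      ‖x‖ ^ (-(2 * b)) * ‖∇ φ x‖ ^ 2 +
      (α ^ 2 * (‖x‖ ^ (-(2 * (b + 1 - 2 * γ))) * ‖φ x‖ ^ 2) +
      (β ^ 2 * (‖x‖ ^ (-(2 * (b + 1))) * ‖φ x‖ ^ 2) +
      (2 * α * β * (‖x‖ ^ (-(2 * (b + 1 - γ))) * ‖φ x‖ ^ 2) +
      (2 * α * (‖x‖ ^ (-(2 * (b + 1 - γ))) * (φ x * inner ℝ x (∇ φ x))) +
      2 * β * (‖x‖ ^ (-(2 * (b + 1))) * (φ x * inner ℝ x (∇ φ x))))))) := by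
    refine ae_of_all _ fun x => ?_
    by_cases hx : x = 0
    · have h1 : φ x = 0 := by rw [hx]; exact hφ.eventuallyEq_zero.self_of_nhds
      simp [twisted, h1]
    have hn : 0 < ‖x‖ := norm_pos_iff.2 hx
    have e2 : ‖x‖ ^ (-(2 * (b + 1))) = ‖x‖ ^ (-(2 * b)) * ‖x‖ ^ (-2 : ℝ) := by
      rw [← Real.rpow_add hn]; ring_nf
    have e3 : ‖x‖ ^ (-(2 * (b + 1 - γ))) = ‖x‖ ^ (-(2 * b)) * ‖x‖ ^ (2 * γ - 2) := by
      rw [← Real.rpow_add hn]; ring_nf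
    have e4 : ‖x‖ ^ (-(2 * (b + 1 - 2 * γ))) =
        ‖x‖ ^ (-(2 * b)) * (‖x‖ ^ (2 * γ - 2)) ^ 2 * ‖x‖ ^ 2 := by
      rw [← Real.rpow_natCast, ← Real.rpow_natCast, ← Real.rpow_mul hn.le, ← Real.rpow_add hn,
        ← Real.rpow_add hn]
      push_cast; ring_nf
    have e5 : ‖x‖ ^ (-2 : ℝ) * ‖x‖ ^ 2 = 1 := by
      rw [← Real.rpow_natCast, ← Real.rpow_add hn]; norm_num
    rw [e2, e3, e4, twisted, norm_add_sq_real, norm_smul, inner_smul_right, real_inner_comm]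
    simp only [Real.norm_eq_abs, mul_pow, sq_abs]
    linear_combination (‖x‖ ^ (-(2 * b)) * φ x ^ 2 * β * (2 * α * ‖x‖ ^ (2 * γ - 2) +
      β * ‖x‖ ^ (-2 : ℝ))) * e5
  have hE : ∀ p : ℝ, 2 * ∫ x, ‖x‖ ^ p * (φ x * inner ℝ x (∇ φ x)) =
      - ((N + p) * ∫ x, ‖x‖ ^ p * ‖φ x‖ ^ 2) := fun p => by
    simpa using hφ.integral_rpow_inner_gradient p
  rw [integral_congr_ae key, integral_add i0, integral_add ((i1 _).const_mul _),
    integral_add ((i1 _).const_mul _), integral_add ((i1 _).const_mul _),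
    integral_add ((i2 _).const_mul _) ((i2 _).const_mul _)]
  · simp only [integral_const_mul]
    linear_combination α * hE (-(2 * (b + 1 - γ))) + β * hE (-(2 * (b + 1)))
  · exact ((i2 _).const_mul _).add ((i2 _).const_mul _)
  · exact ((i1 _).const_mul _).add (((i2 _).const_mul _).add ((i2 _).const_mul _))
  · exact ((i1 _).const_mul _).add (((i1 _).const_mul _).add
      (((i2 _).const_mul _).add ((i2 _).const_mul _)))
  · exact ((i1 _).const_mul _).add (((i1 _).const_mul _).add (((i1 _).const_mul _).add
      (((i2 _).const_mul _).add ((i2 _).const_mul _))))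

/-- The case α = 0 of the expansion, with β = (N-2b-2)/2 minimizing β² - β(N-2b-2); the value of γ
plays no role. -/
theorem IsTest.hardy {φ : E N → ℝ} (hφ : IsTest φ) (b : ℝ) :
    ENNReal.ofReal (|N - 2 * b - 2| / 2) * eWeightedNorm (b + 1) φ ≤ eWeightedNorm b (∇ φ) := by
  have h := hφ.twisted_norm_sq b 1 0 ((N - 2 * b - 2) / 2)
  rw [← ENNReal.toReal_le_toReal
    (ENNReal.mul_ne_top ENNReal.ofReal_ne_top (hφ.eWeightedNorm_lt_top' _).ne)
    (hφ.eWeightedNorm_gradient_lt_top _).ne, ENNReal.toReal_mul,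
    ENNReal.toReal_ofReal (by positivity)]
  refine (pow_le_pow_iff_left₀ (by positivity) ENNReal.toReal_nonneg two_ne_zero).1 ?_
  rw [mul_pow, div_pow, sq_abs]
  nlinarith [sq_nonneg (eWeightedNorm b (twisted 1 0 ((N - 2 * b - 2) / 2) φ (∇ φ))).toReal]

/-- Pairs of a function and its weak gradient that are simultaneous limits of test functions in
all the weighted norms at hand. -/
structure Approx (a b : ℝ) (u : E N → ℝ) (G : E N → E N) : Prop where
  grad : HasWeakGrad u G
  seq : ∃ φ : ℕ → E N → ℝ, (∀ n, IsTest (φ n)) ∧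
    Tendsto (fun n => eWeightedNorm a (fun x => u x - φ n x)) atTop (𝓝 0) ∧
    Tendsto (fun n => eWeightedNorm (b + 1) (fun x => u x - φ n x)) atTop (𝓝 0) ∧
    Tendsto (fun n => eWeightedNorm b (fun x => G x - ∇ (φ n) x)) atTop (𝓝 0)

variable {a b : ℝ} {F : Type*} [NormedAddCommGroup F] [NormedSpace ℝ F]

theorem eWeightedNorm_zero (a : ℝ) : eWeightedNorm a (fun _ : E N => (0 : F)) = 0 := by
  simp [eWeightedNorm]

theorem IsTest.approx {φ : E N → ℝ} (h : IsTest φ) : Approx a b φ (∇ φ) where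
  grad := h.smoothOff.hasWeakGrad
  seq := ⟨fun _ => φ, fun _ => h, by simp [eWeightedNorm_zero], by simp [eWeightedNorm_zero],
    by simp [eWeightedNorm_zero]⟩

theorem tendsto_eWeightedNorm_add {f g : E N → F} {f' g' : ℕ → E N → F} (a : ℝ)
    (hf : AEStronglyMeasurable f volume) (hg : AEStronglyMeasurable g volume)
    (hf' : ∀ n, AEStronglyMeasurable (f' n) volume) (hg' : ∀ n, AEStronglyMeasurable (g' n) volume)
    (h : Tendsto (fun n => eWeightedNorm a (fun x => f x - f' n x)) atTop (𝓝 0))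
    (h' : Tendsto (fun n => eWeightedNorm a (fun x => g x - g' n x)) atTop (𝓝 0)) :
    Tendsto (fun n => eWeightedNorm a (fun x => (f x + g x) - (f' n x + g' n x))) atTop (𝓝 0) := by
  have := h.add h'
  rw [add_zero] at this
  refine tendsto_of_tendsto_of_tendsto_of_le_of_le tendsto_const_nhds this (fun _ => zero_le)
    fun n => ?_
  have := eWeightedNorm_add_le a (hf.sub (hf' n)) (hg.sub (hg' n))
  refine le_trans (le_of_eq ?_) this
  congr 1; ext x
  simp only [Pi.sub_apply]; abel

theorem tendsto_eWeightedNorm_const_smul {f : E N → F} {f' : ℕ → E N → F} (a k : ℝ)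
    (h : Tendsto (fun n => eWeightedNorm a (fun x => f x - f' n x)) atTop (𝓝 0)) :
    Tendsto (fun n => eWeightedNorm a (fun x => k • f x - k • f' n x)) atTop (𝓝 0) := by
  simp only [← smul_sub, eWeightedNorm_const_smul]
  simpa using ENNReal.Tendsto.const_mul h (Or.inr (ENNReal.ofReal_ne_top (r := |k|)))

theorem Approx.const_mul {u : E N → ℝ} {G : E N → E N} (h : Approx a b u G) (k : ℝ) :
    Approx a b (fun x => k * u x) (fun x => k • G x) where
  grad := h.grad.const_mul k
  seq := by
    obtain ⟨φ, h1, h2, h3, h4⟩ := h.seq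
    refine ⟨fun n x => k * φ n x, fun n => (h1 n).const_mul k,
      tendsto_eWeightedNorm_const_smul a k h2, tendsto_eWeightedNorm_const_smul _ k h3, ?_⟩
    simp only [gradient_const_mul ((h1 _).differentiable _)]
    exact tendsto_eWeightedNorm_const_smul b k h4

theorem eWeightedNorm_lt_top_of_tendsto {f : E N → F} {g : ℕ → E N → F}
    (hf : AEStronglyMeasurable f volume) (hg : ∀ n, AEStronglyMeasurable (g n) volume)
    (h : Tendsto (fun n => eWeightedNorm a (fun x => f x - g n x)) atTop (𝓝 0))
    (hl : ∀ n, eWeightedNorm a (g n) < ⊤) : eWeightedNorm a f < ⊤ := by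
  obtain ⟨n, hn⟩ := (h.eventually (gt_mem_nhds (zero_lt_one (α := ℝ≥0∞)))).exists
  have := eWeightedNorm_add_le (g := fun x => f x - g n x) a (hg n) (hf.sub (hg n))
  simp only [add_sub_cancel] at this
  exact this.trans_lt (ENNReal.add_lt_top.2 ⟨hl n, hn.trans ENNReal.one_lt_top⟩)

theorem aesm_twisted {u : E N → ℝ} {G : E N → E N} (γ α β : ℝ)
    (hu : AEStronglyMeasurable u volume) (hG : AEStronglyMeasurable G volume) :
    AEStronglyMeasurable (twisted γ α β u G) volume :=
  hG.add (((((measurable_norm.pow_const _).const_mul α).add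
    ((measurable_norm.pow_const _).const_mul β)).aestronglyMeasurable.mul hu).smul
      continuous_id.aestronglyMeasurable)

section

variable [NeZero N]

theorem Approx.add {u v : E N → ℝ} {G H : E N → E N} (hu : Approx a b u G)
    (hv : Approx a b v H) : Approx a b (fun x => u x + v x) (fun x => G x + H x) where
  grad := hu.grad.add hv.grad
  seq := by
    obtain ⟨φ, h1, h2, h3, h4⟩ := hu.seq
    obtain ⟨ψ, k1, k2, k3, k4⟩ := hv.seq
    refine ⟨fun n x => φ n x + ψ n x, fun n => (h1 n).add (k1 n), ?_, ?_, ?_⟩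
    · exact tendsto_eWeightedNorm_add _ hu.grad.aesm hv.grad.aesm (fun n => (h1 n).aesm)
        (fun n => (k1 n).aesm) h2 k2
    · exact tendsto_eWeightedNorm_add _ hu.grad.aesm hv.grad.aesm (fun n => (h1 n).aesm)
        (fun n => (k1 n).aesm) h3 k3
    · simp only [gradient_add ((h1 _).differentiable _) ((k1 _).differentiable _)]
      exact tendsto_eWeightedNorm_add _ hu.grad.aesm_grad hv.grad.aesm_grad
        (fun n => (h1 n).aesm_gradient) (fun n => (k1 n).aesm_gradient) h4 k4

theorem Approx.sub {u v : E N → ℝ} {G H : E N → E N} (hu : Approx a b u G)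
    (hv : Approx a b v H) : Approx a b (fun x => u x - v x) (fun x => G x - H x) := by
  convert! hu.add (hv.const_mul (-1)) using 2
  · ring
  · simp [sub_eq_add_neg]

theorem Approx.norm_lt_top {u : E N → ℝ} {G : E N → E N} (h : Approx a b u G) :
    eWeightedNorm a u < ⊤ ∧ eWeightedNorm (b + 1) u < ⊤ ∧ eWeightedNorm b G < ⊤ := by
  obtain ⟨φ, h1, h2, h3, h4⟩ := h.seq
  exact ⟨eWeightedNorm_lt_top_of_tendsto h.grad.aesm (fun n => (h1 n).aesm) h2
      fun n => (h1 n).eWeightedNorm_lt_top' a,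
    eWeightedNorm_lt_top_of_tendsto h.grad.aesm (fun n => (h1 n).aesm) h3
      fun n => (h1 n).eWeightedNorm_lt_top' _,
    eWeightedNorm_lt_top_of_tendsto h.grad.aesm_grad (fun n => (h1 n).aesm_gradient) h4
      fun n => (h1 n).eWeightedNorm_gradient_lt_top _⟩

/-- Pointwise |x|^{-c} ≤ |x|^{-a} + |x|^{-a'}: the second weight dominates inside the unit ball, the
first outside. It gives control of the L²_c norm from the L²_a and Hardy norms. -/
theorem eWeightedNorm_interpolate {f : E N → F} {c a' : ℝ} (h1 : a ≤ c) (h2 : c ≤ a')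
    (hf : AEStronglyMeasurable f volume) :
    eWeightedNorm c f ≤ eWeightedNorm a f + eWeightedNorm a' f := by
  refine le_trans ?_ (eLpNorm_add_le (aesm_weight a hf) (aesm_weight a' hf) (by norm_num))
  refine eLpNorm_mono_ae (ae_ne_zero.mono fun x hx => ?_)
  have hn : 0 < ‖x‖ := norm_pos_iff.2 hx
  rw [Pi.add_apply, ← add_smul, norm_smul, norm_smul, Real.norm_of_nonneg (by positivity),
    Real.norm_of_nonneg (by positivity)]
  refine mul_le_mul_of_nonneg_right ?_ (norm_nonneg _)
  rcases le_total ‖x‖ 1 with h | h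
  · have := Real.rpow_le_rpow_of_exponent_ge hn h (neg_le_neg h2)
    have : 0 ≤ ‖x‖ ^ (-a) := by positivity
    linarith
  · have := Real.rpow_le_rpow_of_exponent_le h (neg_le_neg h1)
    have : 0 ≤ ‖x‖ ^ (-a') := by positivity
    linarith

theorem eWeightedNorm_twisted_le {u : E N → ℝ} {G : E N → E N} (γ α β : ℝ)
    (hu : AEStronglyMeasurable u volume) (hG : AEStronglyMeasurable G volume) :
    eWeightedNorm b (twisted γ α β u G) ≤ eWeightedNorm b G +
      ENNReal.ofReal |α| * eWeightedNorm (b + 1 - 2 * γ) u +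
      ENNReal.ofReal |β| * eWeightedNorm (b + 1) u := by
  have m : ∀ α p : ℝ, AEStronglyMeasurable (fun x : E N => (α * ‖x‖ ^ p * u x) • x) volume :=
    fun α p => (((measurable_norm.pow_const p).const_mul α).aestronglyMeasurable.mul hu).smul
      continuous_id.aestronglyMeasurable
  have e : twisted γ α β u G = fun x => (G x + (α * ‖x‖ ^ (2 * γ - 2) * u x) • x) +
      (β * ‖x‖ ^ (-2 : ℝ) * u x) • x := by
    ext1 x
    rw [twisted, add_assoc, ← add_smul]
    congr 2; ring
  have bound : ∀ α p a' : ℝ, p - b + 1 = - a' →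
      eWeightedNorm b (fun x : E N => (α * ‖x‖ ^ p * u x) • x) ≤
        ENNReal.ofReal |α| * eWeightedNorm a' u := by
    intro α p a' hp
    rw [← eWeightedNorm_const_smul]
    refine eWeightedNorm_mono (ae_ne_zero.mono fun x hx => le_of_eq ?_)
    have hn : 0 < ‖x‖ := norm_pos_iff.2 hx
    rw [← hp, norm_smul, norm_mul, norm_mul, norm_smul, Real.norm_of_nonneg (r := ‖x‖ ^ p)
      (by positivity), Real.rpow_add hn, Real.rpow_sub hn, Real.rpow_one, Real.rpow_neg hn.le]
    field_simp
  rw [e]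
  refine (eWeightedNorm_add_le b (hG.add (m _ _)) (m _ _)).trans ?_
  refine add_le_add ((eWeightedNorm_add_le b hG (m _ _)).trans ?_) (bound _ _ _ (by ring))
  exact add_le_add le_rfl (bound _ _ _ (by ring))

/-- Both sides are continuous along the approximating sequence, so the expansion for test functions
passes to the limit. With α = λ and β = -κ, `Params.power` cancels the Hardy term and `Params.scale`
turns the coefficient of the L²_c term into -λNγ. -/
theorem Approx.norm_identity {γ κ : ℝ} (hp : Params N a b γ κ) {u : E N → ℝ} {G : E N → E N}
    (h : Approx a b u G) (lam : ℝ) :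
    (eWeightedNorm b (twisted γ lam (-κ) u G)).toReal ^ 2 =
      (eWeightedNorm b G).toReal ^ 2 + lam ^ 2 * (eWeightedNorm a u).toReal ^ 2 -
        lam * (N * γ) * (eWeightedNorm ((a + b + 1) / 2) u).toReal ^ 2 := by
  have htop := h.norm_lt_top
  obtain ⟨φ, h1, h2, h3, h4⟩ := h.seq
  have mu := h.grad.aesm
  have mG := h.grad.aesm_grad
  have ea := hp.a_eq
  have hγ := hp.pos
  have ec : (a + b + 1) / 2 = b + 1 - γ := by rw [ea]; ring
  have lc1 : a ≤ b + 1 - γ := by linarith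
  have lc2 : b + 1 - γ ≤ b + 1 := by linarith
  have h5 : Tendsto (fun n => eWeightedNorm (b + 1 - γ) (fun x => u x - φ n x)) atTop (𝓝 0) := by
    have := h2.add h3
    rw [add_zero] at this
    exact tendsto_of_tendsto_of_tendsto_of_le_of_le tendsto_const_nhds this (fun _ => zero_le)
      fun n => eWeightedNorm_interpolate lc1 lc2 (mu.sub (h1 n).aesm)
  have h6 : Tendsto (fun n => eWeightedNorm b (fun x => twisted γ lam (-κ) u G x -
      twisted γ lam (-κ) (φ n) (∇ (φ n)) x)) atTop (𝓝 0) := by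
    have k2 := ENNReal.Tendsto.const_mul h2 (Or.inr (ENNReal.ofReal_ne_top (r := |lam|)))
    have k3 := ENNReal.Tendsto.const_mul h3 (Or.inr (ENNReal.ofReal_ne_top (r := |-κ|)))
    have := (h4.add k2).add k3
    simp only [add_zero, mul_zero] at this
    refine tendsto_of_tendsto_of_tendsto_of_le_of_le tendsto_const_nhds this (fun _ => zero_le)
      fun n => ?_
    refine le_trans (le_of_eq ?_) ((eWeightedNorm_twisted_le (u := fun x => u x - φ n x)
      (G := fun x => G x - ∇ (φ n) x) γ lam (-κ) (mu.sub (h1 n).aesm)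
      (mG.sub (h1 n).aesm_gradient)).trans (by rw [ea]))
    congr 1
    ext1 x
    simp only [twisted, mul_sub, sub_smul]
    abel
  have t1 := eWeightedNorm_tendsto a mu (fun n => (h1 n).aesm) h2
  have t4 := eWeightedNorm_tendsto b mG (fun n => (h1 n).aesm_gradient) h4
  have t5 := eWeightedNorm_tendsto _ mu (fun n => (h1 n).aesm) h5
  have t6 := eWeightedNorm_tendsto b (aesm_twisted γ lam (-κ) mu mG)
    (fun n => aesm_twisted γ lam (-κ) (h1 n).aesm (h1 n).aesm_gradient) h6
  have f5 : eWeightedNorm (b + 1 - γ) u ≠ ⊤ := ((eWeightedNorm_interpolate lc1 lc2 mu).trans_lt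
    (ENNReal.add_lt_top.2 ⟨htop.1, htop.2.1⟩)).ne
  have f6 : eWeightedNorm b (twisted γ lam (-κ) u G) ≠ ⊤ := by
    refine ((eWeightedNorm_twisted_le γ lam (-κ) mu mG).trans_lt ?_).ne
    rw [← ea]
    exact ENNReal.add_lt_top.2 ⟨ENNReal.add_lt_top.2 ⟨htop.2.2, ENNReal.mul_lt_top
      ENNReal.ofReal_lt_top htop.1⟩, ENNReal.mul_lt_top ENNReal.ofReal_lt_top htop.2.1⟩
  have r1 := ((ENNReal.tendsto_toReal htop.1.ne).comp t1).pow 2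
  have r4 := ((ENNReal.tendsto_toReal htop.2.2.ne).comp t4).pow 2
  have r5 := ((ENNReal.tendsto_toReal f5).comp t5).pow 2
  have r6 := ((ENNReal.tendsto_toReal f6).comp t6).pow 2
  rw [ec]
  refine tendsto_nhds_unique r6 (((r4.add (r1.const_mul (lam ^ 2))).sub
    (r5.const_mul (lam * (N * γ)))).congr fun n => ?_)
  simp only [Function.comp]
  rw [(h1 n).twisted_norm_sq b γ lam (-κ), ← ea]
  linear_combination (eWeightedNorm (b + 1) (φ n)).toReal ^ 2 * hp.power +
     lam * (eWeightedNorm (b + 1 - γ) (φ n)).toReal ^ 2 * hp.scale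

theorem Approx.norm_c_lt_top {γ κ : ℝ} (hp : Params N a b γ κ) {u : E N → ℝ} {G : E N → E N}
    (h : Approx a b u G) : eWeightedNorm ((a + b + 1) / 2) u < ⊤ := by
  have := hp.pos
  have := hp.a_eq
  exact (eWeightedNorm_interpolate (a := a) (a' := b + 1) (by linarith) (by linarith)
    h.grad.aesm).trans_lt (ENNReal.add_lt_top.2 ⟨h.norm_lt_top.1, h.norm_lt_top.2.1⟩)

/-- The sharp Caffarelli-Kohn-Nirenberg inequality. -/
theorem Approx.inequality {γ κ : ℝ} (hp : Params N a b γ κ) {u : E N → ℝ} {G : E N → E N}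
    (h : Approx a b u G) :
    N * γ / 2 * (eWeightedNorm ((a + b + 1) / 2) u).toReal ^ 2 ≤
      (eWeightedNorm b G).toReal * (eWeightedNorm a u).toReal := by
  set A := (eWeightedNorm a u).toReal
  set B := (eWeightedNorm b G).toReal
  set C := (eWeightedNorm ((a + b + 1) / 2) u).toReal ^ 2
  have hA : 0 ≤ A := ENNReal.toReal_nonneg
  have hB : 0 ≤ B := ENNReal.toReal_nonneg
  -- The norm identity exhibits this quadratic in s as a square, so its discriminant is nonpositive.
  have hq : ∀ s : ℝ, 0 ≤ A ^ 2 * (s * s) + -(N * γ * C) * s + B ^ 2 := fun s => by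
    have := h.norm_identity hp s
    nlinarith [sq_nonneg (eWeightedNorm b (twisted γ s (-κ) u G)).toReal]
  have hd := discrim_le_zero hq
  rw [discrim] at hd
  have : (N * γ * C) ^ 2 ≤ (2 * (B * A)) ^ 2 := by nlinarith
  have := abs_le_of_sq_le_sq' this (by positivity)
  linarith [this.2]

end

end CKN

/-! ### Logarithmic cut-offs and approximation by test functions -/

namespace CKN

variable {N : ℕ} {a b : ℝ}

/-- A smooth bump on `ℝ`, equal to `1` on `[-1, 1]` and supported in `[-2, 2]`. -/
def bump : ContDiffBump (0 : ℝ) := ⟨1, 2, one_pos, one_lt_two⟩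

theorem exists_bump_deriv_bound : ∃ C : ℝ, 0 < C ∧ ∀ s, |deriv bump s| ≤ C := by
  have h1 : Continuous (deriv (bump : ℝ → ℝ)) :=
    (bump.contDiff (n := 1)).continuous_deriv (by simp)
  obtain ⟨C, hC⟩ := h1.bounded_above_of_compact_support bump.hasCompactSupport.deriv
  exact ⟨|C| + 1, by positivity, fun s => (hC s).trans ((le_abs_self C).trans (by linarith))⟩

open Classical in
/-- Logarithmic cut-off functions. -/
def cutoff (N n : ℕ) (x : E N) : ℝ := if x = 0 then 0 else bump (Real.log ‖x‖ / (n + 1))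

theorem cutoff_eq {n : ℕ} {x : E N} (hx : x ≠ 0) :
    cutoff N n x = bump (Real.log ‖x‖ / (n + 1)) := if_neg hx

theorem cutoff_nonneg (n : ℕ) (x : E N) : 0 ≤ cutoff N n x := by
  unfold cutoff
  split_ifs
  · exact le_rfl
  · exact bump.nonneg

theorem cutoff_le_one (n : ℕ) (x : E N) : cutoff N n x ≤ 1 := by
  unfold cutoff
  split_ifs
  · exact zero_le_one
  · exact bump.le_one

theorem cutoff_neg (n : ℕ) (x : E N) : cutoff N n (-x) = cutoff N n x := by simp [cutoff]

theorem cutoff_eq_one {n : ℕ} {x : E N} (hx : x ≠ 0) (hn : |Real.log ‖x‖| ≤ n + 1) :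
    cutoff N n x = 1 := by
  rw [cutoff_eq hx]
  refine bump.one_of_mem_closedBall ?_
  rw [mem_closedBall_zero_iff, Real.norm_eq_abs, abs_div, abs_of_pos (by positivity : (0:ℝ) < n + 1)]
  exact div_le_one_of_le₀ hn (by positivity)

theorem cutoff_eq_zero {n : ℕ} {x : E N} (hn : 2 * (n + 1) ≤ |Real.log ‖x‖|) :
    cutoff N n x = 0 := by
  unfold cutoff
  split_ifs
  · rfl
  · refine bump.zero_of_le_dist ?_
    rw [dist_zero_right, Real.norm_eq_abs, abs_div, abs_of_pos (by positivity : (0:ℝ) < n + 1),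
      le_div_iff₀ (by positivity)]
    exact hn

theorem smoothOff_cutoff (n : ℕ) : SmoothOff (cutoff N n) := fun x hx => by
  have h : ContDiffAt ℝ ∞ (fun y : E N => bump (Real.log ‖y‖ / (n + 1))) x :=
    bump.contDiff.contDiffAt.comp x
      (((contDiffAt_norm ℝ hx).log (norm_ne_zero_iff.2 hx)).div_const _)
  refine h.congr_of_eventuallyEq ?_
  filter_upwards [isOpen_compl_singleton.mem_nhds (show x ∈ ({0}ᶜ : Set (E N)) from hx)] with y hy
  exact cutoff_eq hy

theorem isTest_cutoff (n : ℕ) : IsTest (cutoff N n) := by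
  have hz : cutoff N n =ᶠ[𝓝 0] 0 := by
    have := Metric.ball_mem_nhds (0 : E N) (Real.exp_pos (-(2 * (n + 1))))
    filter_upwards [this] with y hy
    by_cases h0 : y = 0
    · simp [cutoff, h0]
    refine cutoff_eq_zero ?_
    have hn : 0 < ‖y‖ := norm_pos_iff.2 h0
    have : Real.log ‖y‖ < -(2 * (n + 1)) := (Real.log_lt_iff_lt_exp hn).2 (by simpa using hy)
    rw [abs_of_neg (this.trans_le (by simp; positivity))]
    linarith
  refine ⟨contDiff_iff_contDiffAt.2 fun x => ?_, ?_, notMem_tsupport_iff_eventuallyEq.2 hz⟩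
  · by_cases hx : x = 0
    · rw [hx]
      exact contDiffAt_const.congr_of_eventuallyEq hz
    · exact smoothOff_cutoff n x hx
  · refine HasCompactSupport.intro (isCompact_closedBall (0 : E N) (Real.exp (2 * (n + 1))))
      fun x hx => cutoff_eq_zero ?_
    rw [mem_closedBall_zero_iff, not_le] at hx
    have hn : 0 < ‖x‖ := (Real.exp_pos _).trans hx
    exact ((Real.lt_log_iff_exp_lt hn).2 hx).le.trans (le_abs_self _)

/-- Cutting off in log|x| at scale n + 1 gives a gradient of size |x|^{-1}/(n + 1). The error u∇χ_n
is therefore the Hardy norm of u times a factor tending to zero. -/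
theorem exists_cutoff_gradient_bound : ∃ C : ℝ, 0 < C ∧ ∀ (N n : ℕ) (x : E N), x ≠ 0 →
    ‖∇ (cutoff N n) x‖ ≤ C / (n + 1) * ‖x‖⁻¹ := by
  obtain ⟨C, hC, h⟩ := exists_bump_deriv_bound
  refine ⟨C, hC, fun N n x hx => ?_⟩
  have hn : 0 < ‖x‖ := norm_pos_iff.2 hx
  have hd : HasDerivAt (fun s : ℝ => bump (Real.log s / (n + 1)))
      (deriv bump (Real.log ‖x‖ / (n + 1)) * (‖x‖⁻¹ / (n + 1))) ‖x‖ :=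
    ((bump.contDiff (n := 1)).differentiable (by simp) _).hasDerivAt.comp _
      ((Real.hasDerivAt_log hn.ne').div_const _)
  have hg := hasGradientAt_comp_norm hx hd
  have he : ∇ (cutoff N n) x = ∇ (fun y : E N => bump (Real.log ‖y‖ / (n + 1))) x := by
    refine Filter.EventuallyEq.gradient_eq ?_
    filter_upwards [isOpen_compl_singleton.mem_nhds (show x ∈ ({0}ᶜ : Set (E N)) from hx)] with y hy
    exact cutoff_eq hy
  rw [he, hg.gradient, norm_smul, Real.norm_eq_abs, abs_div, abs_mul, abs_div, abs_norm, abs_inv,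
    abs_norm, abs_of_pos (by positivity : (0:ℝ) < n + 1), div_mul_cancel₀ _ hn.ne']
  calc _ ≤ C * (‖x‖⁻¹ / (n + 1)) := by gcongr; exact h _
    _ = _ := by ring

theorem tendsto_cutoff {x : E N} (hx : x ≠ 0) : ∀ᶠ n in atTop, cutoff N n x = 1 := by
  obtain ⟨m, hm⟩ := exists_nat_ge |Real.log ‖x‖|
  filter_upwards [eventually_ge_atTop m] with n hn
  refine cutoff_eq_one hx (hm.trans ?_)
  have : (m : ℝ) ≤ n := by exact_mod_cast hn
  linarith

theorem gradient_cutoff_mul {u : E N → ℝ} (n : ℕ) {x : E N} (hu : DifferentiableAt ℝ u x) :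
    ∇ (fun y => cutoff N n y * u y) x = cutoff N n x • ∇ u x + u x • ∇ (cutoff N n) x :=
  gradient_mul ((isTest_cutoff n).differentiable x) hu

section

variable [NeZero N] {F : Type*} [NormedAddCommGroup F] [NormedSpace ℝ F]

theorem tendsto_eWeightedNorm_cutoff {f : E N → F} (hf : AEStronglyMeasurable f volume)
    (h : eWeightedNorm a f < ⊤) :
    Tendsto (fun n => eWeightedNorm a (fun x => f x - cutoff N n x • f x)) atTop (𝓝 0) := by
  have hsq : Tendsto (fun n => eWeightedNorm a (fun x => f x - cutoff N n x • f x) ^ 2)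
      atTop (𝓝 0) := by
    simp only [eWeightedNorm_sq]
    have := tendsto_lintegral_of_dominated_convergence' (μ := (volume : Measure (E N)))
      (F := fun n x => ENNReal.ofReal (‖x‖ ^ (-(2 * a)) * ‖f x - cutoff N n x • f x‖ ^ 2))
      (f := fun _ => 0) (fun x => ENNReal.ofReal (‖x‖ ^ (-(2 * a)) * ‖f x‖ ^ 2)) ?_ ?_ ?_ ?_
    · simpa using this
    · intro n
      exact ((measurable_norm.pow_const _).aemeasurable.mul (((hf.sub
        ((isTest_cutoff n).aesm.smul hf)).norm.aemeasurable).pow_const 2)).ennreal_ofReal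
    · intro n
      refine ae_of_all _ fun x => ENNReal.ofReal_le_ofReal ?_
      refine mul_le_mul_of_nonneg_left ?_ (by positivity)
      refine pow_le_pow_left₀ (norm_nonneg _) ?_ 2
      rw [show f x - cutoff N n x • f x = (1 - cutoff N n x) • f x by rw [sub_smul, one_smul],
        norm_smul, Real.norm_of_nonneg (by linarith [cutoff_le_one n x])]
      exact mul_le_of_le_one_left (norm_nonneg _) (by linarith [cutoff_nonneg n x])
    · rw [← eWeightedNorm_sq]
      exact (ENNReal.pow_lt_top h).ne
    · filter_upwards [ae_ne_zero] with x hx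
      refine tendsto_const_nhds.congr' ?_
      filter_upwards [tendsto_cutoff hx] with n hn
      simp [hn]
  have := hsq.ennrpow_const (1 / 2)
  rw [ENNReal.zero_rpow_of_pos (by norm_num)] at this
  refine this.congr fun n => ?_
  rw [← ENNReal.rpow_natCast, ← ENNReal.rpow_mul]
  norm_num

theorem eWeightedNorm_smul_gradient_cutoff {C : ℝ} (hC0 : 0 < C)
    (hC : ∀ (N n : ℕ) (x : E N), x ≠ 0 → ‖∇ (cutoff N n) x‖ ≤ C / (n + 1) * ‖x‖⁻¹)
    (u : E N → ℝ) (n : ℕ) :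
    eWeightedNorm b (fun x => u x • ∇ (cutoff N n) x) ≤
      ENNReal.ofReal (C / (n + 1)) * eWeightedNorm (b + 1) u := by
  have hp : 0 < C / (n + 1) := by positivity
  rw [← abs_of_pos hp, ← eWeightedNorm_const_smul]
  refine eWeightedNorm_mono (ae_ne_zero.mono fun x hx => ?_)
  have hn : 0 < ‖x‖ := norm_pos_iff.2 hx
  rw [neg_add, Real.rpow_add hn, Real.rpow_neg_one, norm_smul, norm_smul,
    Real.norm_of_nonneg hp.le]
  calc _ ≤ ‖x‖ ^ (-b) * (‖u x‖ * (C / (n + 1) * ‖x‖⁻¹)) := by gcongr; exact hC N n x hx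
    _ = _ := by ring

theorem tendsto_const_div_mul {r : ℝ≥0∞} (hr : r < ⊤) (C : ℝ) :
    Tendsto (fun n : ℕ => ENNReal.ofReal (C / (n + 1)) * r) atTop (𝓝 0) := by
  have h1 : Tendsto (fun n : ℕ => C / ((n : ℝ) + 1)) atTop (𝓝 0) :=
    tendsto_const_nhds.div_atTop (tendsto_atTop_add_const_right _ _ tendsto_natCast_atTop_atTop)
  have h2 := ENNReal.tendsto_ofReal h1
  simpa using ENNReal.Tendsto.mul_const h2 (Or.inr hr.ne)

theorem SmoothOff.approx {u : E N → ℝ} (hu : SmoothOff u) (h1 : eWeightedNorm a u < ⊤)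
    (h2 : eWeightedNorm (b + 1) u < ⊤) (h3 : eWeightedNorm b (∇ u) < ⊤) :
    Approx a b u (∇ u) where
  grad := hu.hasWeakGrad
  seq := by
    obtain ⟨C, hC0, hC⟩ := exists_cutoff_gradient_bound
    have mu := hu.hasWeakGrad.aesm
    have mG := hu.hasWeakGrad.aesm_grad
    refine ⟨fun n x => cutoff N n x * u x, fun n => (isTest_cutoff n).mul hu,
      tendsto_eWeightedNorm_cutoff mu h1, tendsto_eWeightedNorm_cutoff mu h2, ?_⟩
    have := (tendsto_eWeightedNorm_cutoff mG h3).add (tendsto_const_div_mul h2 C)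
    rw [add_zero] at this
    refine tendsto_of_tendsto_of_tendsto_of_le_of_le tendsto_const_nhds this (fun _ => zero_le)
      fun n => ?_
    refine le_trans ?_ (add_le_add le_rfl (eWeightedNorm_smul_gradient_cutoff hC0 hC u n))
    refine le_trans (le_of_eq ?_) (eWeightedNorm_sub_le b (mG.sub ((isTest_cutoff n).aesm.smul mG))
      (mu.smul (isTest_cutoff n).aesm_gradient))
    refine eWeightedNorm_congr b (ae_ne_zero.mono fun x hx => ?_)
    simp only [gradient_cutoff_mul n (hu.differentiableAt hx)]
    abel

/-- Hardy's inequality passes to limits that only converge in `L^1_loc`. -/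
theorem hardy_of_tendsto {u : E N → ℝ} {G : E N → E N} (hG : HasWeakGrad u G)
    (hb : (N : ℝ) - 2 * b - 2 ≠ 0) {φ : ℕ → E N → ℝ} (h1 : ∀ n, IsTest (φ n))
    (h2 : ∀ K : Set (E N), IsCompact K → K ⊆ {0}ᶜ →
        Tendsto (fun n => ∫⁻ x in K, ‖u x - φ n x‖ₑ) atTop (𝓝 0))
    (h3 : Tendsto (fun n => eWeightedNorm b (fun x => G x - ∇ (φ n) x)) atTop (𝓝 0))
    {ψ : E N → ℝ} (hψ : IsTest ψ) :
    eWeightedNorm (b + 1) (fun x => u x - ψ x) ≤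
      (ENNReal.ofReal (|N - 2 * b - 2| / 2))⁻¹ * eWeightedNorm b (fun x => G x - ∇ ψ x) := by
  set c := ENNReal.ofReal (|N - 2 * b - 2| / 2)
  have hc0 : c ≠ 0 := by simpa [c] using hb
  have hct : c ≠ ⊤ := ENNReal.ofReal_ne_top
  have mu := hG.aesm
  have mG := hG.aesm_grad
  have hgs : ∀ n, ∇ (fun x => φ n x - ψ x) = fun x => ∇ (φ n) x - ∇ ψ x := fun n => by
    ext1 x
    have := gradient_add ((h1 n).differentiable x) ((hψ.const_mul (-1)).differentiable x)
    rw [gradient_const_mul (hψ.differentiable x)] at this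
    simpa [sub_eq_add_neg] using this
  have t1 : ∀ n, eWeightedNorm (b + 1) (fun x => φ n x - ψ x) ≤
      c⁻¹ * eWeightedNorm b (fun x => ∇ (φ n) x - ∇ ψ x) := fun n => by
    rw [← ENNReal.mul_le_iff_le_inv hc0 hct, ← hgs]
    exact ((h1 n).sub hψ).hardy b
  have t2 : Tendsto (fun n => (c⁻¹ * eWeightedNorm b (fun x => ∇ (φ n) x - ∇ ψ x)) ^ 2) atTop
      (𝓝 ((c⁻¹ * eWeightedNorm b (fun x => G x - ∇ ψ x)) ^ 2)) := by
    refine ENNReal.Tendsto.pow (ENNReal.Tendsto.const_mul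
      (eWeightedNorm_tendsto b (mG.sub hψ.aesm_gradient)
        (fun n => (h1 n).aesm_gradient.sub hψ.aesm_gradient) ?_) (Or.inr (ENNReal.inv_ne_top.2 hc0)))
    simpa using h3
  set R := (c⁻¹ * eWeightedNorm b (fun x => G x - ∇ ψ x)) ^ 2 with hR
  set f : E N → ℝ≥0∞ := fun x => ENNReal.ofReal (‖x‖ ^ (-(2 * (b + 1))) * ‖u x - ψ x‖ ^ 2) with hf
  have local_bound : ∀ K : Set (E N), IsCompact K → K ⊆ {0}ᶜ → ∫⁻ x in K, f x ≤ R := by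
    intro K hK hK0
    have hm : TendstoInMeasure (volume.restrict K) φ atTop u := by
      refine tendstoInMeasure_of_tendsto_eLpNorm (p := 1) one_ne_zero
        (fun n => (h1 n).aesm.restrict) mu.restrict ?_
      simp only [eLpNorm_one_eq_lintegral_enorm, Pi.sub_apply]
      refine (h2 K hK hK0).congr fun n => ?_
      simp only [← enorm_neg (u _ - _), neg_sub]
    obtain ⟨ns, hns, hae⟩ := hm.exists_seq_tendsto_ae
    set g : ℕ → E N → ℝ≥0∞ := fun i x =>
      ENNReal.ofReal (‖x‖ ^ (-(2 * (b + 1))) * ‖φ (ns i) x - ψ x‖ ^ 2) with hg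
    -- L¹ convergence on K gives almost everywhere convergence of a subsequence; Fatou's lemma then
    -- carries the bound over to u.
    have hfg : ∀ᵐ x ∂volume.restrict K, f x = liminf (fun i => g i x) atTop := by
      filter_upwards [hae] with x hx
      refine (Tendsto.liminf_eq ?_).symm
      exact ENNReal.tendsto_ofReal (((hx.sub_const _).norm.pow 2).const_mul _)
    rw [lintegral_congr_ae hfg]
    refine (lintegral_liminf_le' fun i => ?_).trans ?_
    · exact ((measurable_norm.pow_const _).aemeasurable.mul ((((h1 _).aesm.sub
        hψ.aesm).norm.aemeasurable).pow_const 2)).ennreal_ofReal.restrict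
    · refine le_trans (liminf_le_liminf (Eventually.of_forall fun i => ?_))
        (t2.comp hns.tendsto_atTop).liminf_eq.le
      refine (setLIntegral_le_lintegral _ _).trans ?_
      rw [← eWeightedNorm_sq (fun x => φ (ns i) x - ψ x)]
      exact pow_le_pow_left' (t1 _) 2
  have hsq : eWeightedNorm (b + 1) (fun x => u x - ψ x) ^ 2 ≤ R := by
    rw [eWeightedNorm_sq]
    set K : ℕ → Set (E N) := fun j => Metric.closedBall 0 (j + 1) \ Metric.ball 0 (1 / (j + 1))
    have hK : ∀ j, IsCompact (K j) := fun j => (isCompact_closedBall _ _).diff Metric.isOpen_ball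
    have hK0 : ∀ j, K j ⊆ {0}ᶜ := fun j x hx h0 => hx.2 (by
      rw [Set.mem_singleton_iff.1 h0]; exact Metric.mem_ball_self (by positivity))
    have hmono : Monotone K := fun i j hij => by
      have : (i : ℝ) ≤ j := by exact_mod_cast hij
      refine Set.sdiff_subset_sdiff (Metric.closedBall_subset_closedBall (by linarith))
        (Metric.ball_subset_ball (one_div_le_one_div_of_le (by positivity) (by linarith)))
    have hU : (⋃ j, K j) = {0}ᶜ := by
      refine Set.Subset.antisymm (Set.iUnion_subset hK0) fun x hx => ?_
      have hn : 0 < ‖x‖ := norm_pos_iff.2 hx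
      obtain ⟨j, hj⟩ := exists_nat_ge (max ‖x‖ ‖x‖⁻¹)
      refine Set.mem_iUnion.2 ⟨j, ?_, ?_⟩
      · rw [mem_closedBall_zero_iff]
        linarith [le_max_left ‖x‖ ‖x‖⁻¹]
      · rw [mem_ball_zero_iff, not_lt, one_div]
        exact inv_le_of_inv_le₀ hn (by linarith [le_max_right ‖x‖ ‖x‖⁻¹])
    calc ∫⁻ x, f x = ∫⁻ x in ⋃ j, K j, f x := by rw [hU, restrict_compl_singleton]
      _ = ⨆ j, ∫⁻ x in K j, f x := setLIntegral_iUnion_of_directed _ hmono.directed_le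
      _ ≤ R := iSup_le fun j => local_bound _ (hK j) (hK0 j)
  exact (ENNReal.pow_le_pow_left_iff two_ne_zero).1 hsq

/-- The sequence supplied by `MemH` converges in the gradient norm, hence in the Hardy norm, but
need not converge in L²_a. Multiplying by the n-th cut-off and then going far enough along the
sequence, depending on n, gives convergence in all three norms. -/
theorem MemH.approx {u : E N → ℝ} (hu : MemH b u) (hb : (N : ℝ) - 2 * b - 2 ≠ 0)
    (ha : eWeightedNorm a u < ⊤) : Approx a b u (weakGrad u) where
  grad := hu.1.hasWeakGrad
  seq := by
    obtain ⟨hw, φ, h1, h2, h3⟩ := hu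
    set G := weakGrad u
    have hG : HasWeakGrad u G := hw.hasWeakGrad
    have mu := hG.aesm
    have mG := hG.aesm_grad
    replace h3 : Tendsto (fun n => eWeightedNorm b (fun x => G x - ∇ (φ n) x)) atTop (𝓝 0) :=
      h3.congr fun n => (hG.sub (h1 n).smoothOff.hasWeakGrad).eHNorm_eq b
    set c := ENNReal.ofReal (|N - 2 * b - 2| / 2)
    have hc0 : c⁻¹ ≠ ⊤ := ENNReal.inv_ne_top.2 (by simpa [c] using hb)
    have h4 : Tendsto (fun n => eWeightedNorm (b + 1) (fun x => u x - φ n x)) atTop (𝓝 0) := by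
      have := ENNReal.Tendsto.const_mul h3 (Or.inr hc0)
      rw [mul_zero] at this
      exact tendsto_of_tendsto_of_tendsto_of_le_of_le tendsto_const_nhds this (fun _ => zero_le)
        fun n => hardy_of_tendsto hG hb h1 h2 h3 (h1 n)
    have f1 : eWeightedNorm (b + 1) u < ⊤ := eWeightedNorm_lt_top_of_tendsto mu
      (fun n => (h1 n).aesm) h4 fun n => (h1 n).eWeightedNorm_lt_top' _
    have f2 : eWeightedNorm b G < ⊤ := eWeightedNorm_lt_top_of_tendsto mG
      (fun n => (h1 n).aesm_gradient) h3 fun n => (h1 n).eWeightedNorm_gradient_lt_top _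
    obtain ⟨C, hC0, hC⟩ := exists_cutoff_gradient_bound
    -- On the support of a fixed cut-off the weights |x|^{-a} and |x|^{-(b+1)} are comparable, with
    -- a constant that may grow with n.
    have hb1 : ∀ n, ∃ M : ℝ, 0 < M ∧ ∀ v : E N → ℝ,
        eWeightedNorm a (fun x => cutoff N n x * v x) ≤ ENNReal.ofReal M * eWeightedNorm (b + 1) v := by
      intro n
      have ht := (isTest_cutoff (N := N) n).mul (smoothOff_rpow (b + 1 - a))
      obtain ⟨M, hM⟩ := ht.smooth.continuous.bounded_above_of_compact_support ht.compact
      refine ⟨|M| + 1, by positivity, fun v => ?_⟩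
      have hMp : 0 < |M| + 1 := by positivity
      rw [← abs_of_pos hMp, ← eWeightedNorm_const_smul]
      refine eWeightedNorm_mono (ae_ne_zero.mono fun x hx => ?_)
      have hn : 0 < ‖x‖ := norm_pos_iff.2 hx
      have e : ‖x‖ ^ (-a) = ‖x‖ ^ (-(b + 1)) * ‖x‖ ^ (b + 1 - a) := by
        rw [← Real.rpow_add hn]; ring_nf
      have h5 := (hM x).trans (le_abs_self M)
      rw [norm_mul, Real.norm_of_nonneg (r := ‖x‖ ^ (b + 1 - a)) (by positivity)] at h5
      rw [e, norm_mul, norm_smul, Real.norm_of_nonneg hMp.le]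
      calc _ = ‖x‖ ^ (-(b + 1)) * ((‖cutoff N n x‖ * ‖x‖ ^ (b + 1 - a)) * ‖v x‖) := by ring
        _ ≤ _ := by gcongr; linarith
    have hb2 : ∀ n (v : E N → E N),
        eWeightedNorm b (fun x => cutoff N n x • v x) ≤ eWeightedNorm b v := by
      intro n v
      refine eWeightedNorm_mono (ae_of_all _ fun x => ?_)
      rw [norm_smul, Real.norm_of_nonneg (cutoff_nonneg n x)]
      refine mul_le_mul_of_nonneg_left ?_ (by positivity)
      exact mul_le_of_le_one_left (norm_nonneg _) (cutoff_le_one n x)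
    have hb3 : ∀ n (v : E N → ℝ),
        eWeightedNorm (b + 1) (fun x => cutoff N n x * v x) ≤ eWeightedNorm (b + 1) v := by
      intro n v
      refine eWeightedNorm_mono (ae_of_all _ fun x => ?_)
      rw [norm_mul, Real.norm_of_nonneg (cutoff_nonneg n x)]
      refine mul_le_mul_of_nonneg_left ?_ (by positivity)
      exact mul_le_of_le_one_left (norm_nonneg _) (cutoff_le_one n x)
    choose M hM0 hM using hb1
    -- Diagonal choice: the index m is taken after n, so that it beats the constant M n.
    have hex : ∀ n : ℕ, ∃ m : ℕ,
        ENNReal.ofReal (M n) * eWeightedNorm (b + 1) (fun x => u x - φ m x) ≤ (n + 1 : ℝ≥0∞)⁻¹ ∧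
        eWeightedNorm (b + 1) (fun x => u x - φ m x) ≤ (n + 1 : ℝ≥0∞)⁻¹ ∧
        eWeightedNorm b (fun x => G x - ∇ (φ m) x) +
          ENNReal.ofReal (C / (n + 1)) * eWeightedNorm (b + 1) (fun x => u x - φ m x) ≤
            (n + 1 : ℝ≥0∞)⁻¹ := by
      intro n
      have hpos : (0 : ℝ≥0∞) < (n + 1 : ℝ≥0∞)⁻¹ := by simp
      have k1 := ENNReal.Tendsto.const_mul h4 (Or.inr (ENNReal.ofReal_ne_top (r := M n)))
      have k2 := h3.add (ENNReal.Tendsto.const_mul h4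
        (Or.inr (ENNReal.ofReal_ne_top (r := C / (n + 1)))))
      rw [mul_zero] at k1
      rw [mul_zero, add_zero] at k2
      exact ((k1.eventually (ge_mem_nhds hpos)).and ((h4.eventually (ge_mem_nhds hpos)).and
        (k2.eventually (ge_mem_nhds hpos)))).exists
    choose m hm1 hm2 hm3 using hex
    have hlim : Tendsto (fun n : ℕ => (n + 1 : ℝ≥0∞)⁻¹) atTop (𝓝 0) := by
      have := ENNReal.tendsto_inv_nat_nhds_zero.comp (tendsto_add_atTop_nat 1)
      simpa [Function.comp_def] using this
    have mc : ∀ n, AEStronglyMeasurable (cutoff N n) volume := fun n => (isTest_cutoff n).aesm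
    refine ⟨fun n x => cutoff N n x * φ (m n) x,
      fun n => (isTest_cutoff n).mul (h1 _).smoothOff, ?_, ?_, ?_⟩
    · have := (tendsto_eWeightedNorm_cutoff mu ha).add hlim
      rw [add_zero] at this
      refine tendsto_of_tendsto_of_tendsto_of_le_of_le tendsto_const_nhds this (fun _ => zero_le)
        fun n => ?_
      refine le_trans ?_ (add_le_add le_rfl ((hM n _).trans (hm1 n)))
      refine le_trans (le_of_eq ?_) (eWeightedNorm_add_le a (mu.sub ((mc n).smul mu))
        ((mc n).mul (mu.sub (h1 (m n)).aesm)))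
      congr 1
      ext1 x
      change u x - _ = u x - cutoff N n x * u x + cutoff N n x * (u x - φ (m n) x)
      ring
    · have := (tendsto_eWeightedNorm_cutoff mu f1).add hlim
      rw [add_zero] at this
      refine tendsto_of_tendsto_of_tendsto_of_le_of_le tendsto_const_nhds this (fun _ => zero_le)
        fun n => ?_
      refine le_trans ?_ (add_le_add le_rfl ((hb3 n _).trans (hm2 n)))
      refine le_trans (le_of_eq ?_) (eWeightedNorm_add_le (b + 1) (mu.sub ((mc n).smul mu))
        ((mc n).mul (mu.sub (h1 (m n)).aesm)))
      congr 1
      ext1 x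
      change u x - _ = u x - cutoff N n x * u x + cutoff N n x * (u x - φ (m n) x)
      ring
    · have := ((tendsto_eWeightedNorm_cutoff mG f2).add (tendsto_const_div_mul f1 C)).add hlim
      rw [add_zero, add_zero] at this
      refine tendsto_of_tendsto_of_tendsto_of_le_of_le tendsto_const_nhds this (fun _ => zero_le)
        fun n => ?_
      have mgc := (isTest_cutoff (N := N) n).aesm_gradient
      refine le_trans ?_ (add_le_add (add_le_add le_rfl
        (eWeightedNorm_smul_gradient_cutoff hC0 hC u n)) (hm3 n))
      refine le_trans ?_ (add_le_add le_rfl (add_le_add (hb2 n _)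
        (eWeightedNorm_smul_gradient_cutoff hC0 hC _ n)))
      have d1 : AEStronglyMeasurable (fun x => G x - cutoff N n x • G x) volume :=
        mG.sub ((mc n).smul mG)
      have d2 : AEStronglyMeasurable (fun x => u x • ∇ (cutoff N n) x) volume := mu.smul mgc
      have d3 : AEStronglyMeasurable (fun x => cutoff N n x • (G x - ∇ (φ (m n)) x)) volume :=
        (mc n).smul (mG.sub (h1 _).aesm_gradient)
      have d4 : AEStronglyMeasurable (fun x => (u x - φ (m n) x) • ∇ (cutoff N n) x) volume :=
        (mu.sub (h1 _).aesm).smul mgc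
      refine le_trans ?_ (add_le_add (eWeightedNorm_sub_le b d1 d2) (eWeightedNorm_add_le b d3 d4))
      refine le_trans (le_of_eq ?_) (eWeightedNorm_add_le b (d1.sub d2) (d3.add d4))
      congr 1
      ext1 x
      simp only [gradient_cutoff_mul n ((h1 (m n)).differentiable x)]
      rw [smul_sub, sub_smul]
      abel

end

end CKN

/-! ### The extremal profiles -/

namespace CKN

variable {N : ℕ} {a b γ κ lam : ℝ}

/-- The profile `|x|^κ exp(-(lam / 2γ) |x|^{2γ})`. -/
def profile (N : ℕ) (γ κ lam : ℝ) (x : E N) : ℝ :=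
  ‖x‖ ^ κ * Real.exp (-(lam / (2 * γ)) * ‖x‖ ^ (2 * γ))

theorem profile_pos {x : E N} (hx : x ≠ 0) : 0 < profile N γ κ lam x := by
  have : 0 < ‖x‖ := norm_pos_iff.2 hx
  unfold profile; positivity

theorem profile_neg (x : E N) : profile N γ κ lam (-x) = profile N γ κ lam x := by
  simp [profile]

theorem smoothOff_profile : SmoothOff (profile N γ κ lam) := fun x hx =>
  (smoothOff_rpow κ x hx).mul (((smoothOff_rpow (2 * γ)).const_mul (-(lam / (2 * γ))) x hx).exp)

theorem gradient_profile (hγ : 0 < γ) {x : E N} (hx : x ≠ 0) :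
    ∇ (profile N γ κ lam) x =
      ((-lam * ‖x‖ ^ (2 * γ - 2) + κ * ‖x‖ ^ (-2 : ℝ)) * profile N γ κ lam x) • x := by
  have hn : 0 < ‖x‖ := norm_pos_iff.2 hx
  have hd : HasDerivAt (fun r : ℝ => r ^ κ * Real.exp (-(lam / (2 * γ)) * r ^ (2 * γ)))
      (κ * ‖x‖ ^ (κ - 1) * Real.exp (-(lam / (2 * γ)) * ‖x‖ ^ (2 * γ)) +
        ‖x‖ ^ κ * (Real.exp (-(lam / (2 * γ)) * ‖x‖ ^ (2 * γ)) *
          (-(lam / (2 * γ)) * (2 * γ * ‖x‖ ^ (2 * γ - 1))))) ‖x‖ :=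
    (Real.hasDerivAt_rpow_const (Or.inl hn.ne')).mul
      (((Real.hasDerivAt_rpow_const (Or.inl hn.ne')).const_mul _).exp)
  refine (hasGradientAt_comp_norm hx hd).gradient.trans ?_
  congr 1
  have e1 : ‖x‖ ^ (2 * γ - 1) = ‖x‖ ^ (2 * γ - 2) * ‖x‖ := by
    rw [← Real.rpow_add_one hn.ne']; ring_nf
  have e2 : ‖x‖ ^ (κ - 1) = ‖x‖ ^ κ * ‖x‖ ^ (-2 : ℝ) * ‖x‖ := by
    rw [← Real.rpow_add hn, ← Real.rpow_add_one hn.ne']; ring_nf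
  rw [e1, e2, profile]
  field_simp
  ring

theorem mem_minimizers_iff {v : E N → ℝ} (hab : a = b + 1 - 2 * γ)
    (hκ : (b < ((N : ℝ) - 2) / 2 ∧ κ = 0) ∨ (((N : ℝ) - 2) / 2 < b ∧ κ = 2 * b + 2 - N)) :
    v ∈ minimizers N a b ↔ ∃ k lam : ℝ, 0 < lam ∧ v = fun x => k * profile N γ κ lam x := by
  have e : b + 1 - a = 2 * γ := by rw [hab]; ring
  simp only [minimizers, Set.mem_ofPred_eq, e, profile, funext_iff]
  refine exists_congr fun k => exists_congr fun lam => and_congr_right fun _ =>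
    forall_congr' fun x => ?_
  rcases hκ with ⟨h, rfl⟩ | ⟨h, rfl⟩
  · rw [if_pos h, Real.rpow_zero, mul_assoc]
  · rw [if_neg (not_lt.2 h.le), mul_assoc]

section

variable [NeZero N]

theorem lintegral_rpow_mul_exp_lt_top {s β p : ℝ} (hs : -N < s) (hp : 0 < p) (hβ : 0 < β) :
    ∫⁻ x : E N, ENNReal.ofReal (‖x‖ ^ s * Real.exp (-β * ‖x‖ ^ p)) < ⊤ := by
  have h := (integrable_fun_norm_addHaar (volume : Measure (E N))
    (f := fun r : ℝ => r ^ s * Real.exp (-β * r ^ p))).2 ?_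
  · exact h.lintegral_lt_top
  · have := integrableOn_rpow_mul_exp_neg_mul_rpow (s := s + (N - 1)) (by linarith) hp hβ
    refine this.congr_fun (fun r hr => ?_) measurableSet_Ioi
    have hr0 : 0 < r := hr
    have hN : 1 ≤ N := NeZero.one_le
    simp only [smul_eq_mul, finrank_euclideanSpace, Fintype.card_fin]
    rw [Real.rpow_add hr0, ← Real.rpow_natCast, Nat.cast_sub hN]
    push_cast
    ring

theorem eWeightedNorm_profile_lt_top {q : ℝ} (hγ : 0 < γ) (hlam : 0 < lam)
    (hq : 0 < N - 2 * q + 2 * κ) : eWeightedNorm q (profile N γ κ lam) < ⊤ := by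
  have h := lintegral_rpow_mul_exp_lt_top (N := N) (s := 2 * κ - 2 * q) (β := lam / γ)
    (p := 2 * γ) (by linarith) (by positivity) (by positivity)
  have : eWeightedNorm q (profile N γ κ lam) ^ 2 < ⊤ := by
    rw [eWeightedNorm_sq]
    refine lt_of_le_of_lt (le_of_eq ?_) h
    refine lintegral_congr_ae (ae_ne_zero.mono fun x hx => ?_)
    have hn : 0 < ‖x‖ := norm_pos_iff.2 hx
    simp only
    congr 1
    rw [Real.norm_eq_abs, sq_abs, profile, mul_pow, ← Real.exp_nat_mul, ← Real.rpow_natCast,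
      ← Real.rpow_mul hn.le, ← mul_assoc, ← Real.rpow_add hn]
    congr 2
    · push_cast; ring
    · push_cast; field_simp
  by_contra hc
  rw [not_lt, top_le_iff] at hc
  simp [hc] at this

theorem approx_profile (hp : Params N a b γ κ) (hlam : 0 < lam) :
    Approx a b (profile N γ κ lam) (∇ (profile N γ κ lam)) := by
  have hγ := hp.pos
  have hs := hp.scale
  have ha := hp.a_eq
  have hN : (3 : ℝ) ≤ N := by exact_mod_cast hp.three_le
  have hm : 0 < ((N : ℝ) - 2) * γ := mul_pos (by linarith) hγ
  have h1 : eWeightedNorm a (profile N γ κ lam) < ⊤ :=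
    eWeightedNorm_profile_lt_top hγ hlam (by linarith)
  have h2 : eWeightedNorm (b + 1) (profile N γ κ lam) < ⊤ :=
    eWeightedNorm_profile_lt_top hγ hlam (by linarith)
  refine smoothOff_profile.approx h1 h2 ?_
  have e : ∇ (profile N γ κ lam) =ᵐ[volume] twisted γ (-lam) κ (profile N γ κ lam) 0 :=
    ae_ne_zero.mono fun x hx => by rw [gradient_profile hγ hx, twisted, Pi.zero_apply, zero_add]
  rw [eWeightedNorm_congr b e]
  refine (eWeightedNorm_twisted_le _ _ _ smoothOff_profile.hasWeakGrad.aesm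
    aestronglyMeasurable_zero).trans_lt ?_
  rw [← ha, show eWeightedNorm b (0 : E N → E N) = 0 from eWeightedNorm_zero b, zero_add]
  exact ENNReal.add_lt_top.2 ⟨ENNReal.mul_lt_top ENNReal.ofReal_lt_top h1,
    ENNReal.mul_lt_top ENNReal.ofReal_lt_top h2⟩

/-- The profile solves the first-order equation that makes its own twisted field zero, so adding a
multiple of it changes nothing. -/
theorem twisted_sub_profile (hγ : 0 < γ) (u : E N → ℝ) (G : E N → E N) (k : ℝ) :
    twisted γ lam (-κ) (fun x => u x + k * profile N γ κ lam x)
      (fun x => G x + k • ∇ (profile N γ κ lam) x) =ᵐ[volume] twisted γ lam (-κ) u G := by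
  filter_upwards [ae_ne_zero] with x hx
  rw [twisted, twisted, gradient_profile hγ hx, add_assoc, smul_smul, ← add_smul]
  congr 2
  ring

end

end CKN

/-! ### The Gaussian Poincaré inequality by rotation -/

namespace CKN

section Rotation

variable {V : Type*} [NormedAddCommGroup V] [InnerProductSpace ℝ V]

/-- The orthogonal reflection `(x, y) ↦ (sin θ x + cos θ y, cos θ x - sin θ y)`. -/
def reflect (V : Type*) [NormedAddCommGroup V] [InnerProductSpace ℝ V] (θ : ℝ) :
    V × V →ₗ[ℝ] V × V where
  toFun p := (Real.sin θ • p.1 + Real.cos θ • p.2, Real.cos θ • p.1 - Real.sin θ • p.2)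
  map_add' p q := by ext <;> simp <;> module
  map_smul' k p := by ext <;> simp <;> module

theorem reflect_reflect (θ : ℝ) (p : V × V) : reflect V θ (reflect V θ p) = p := by
  have h := Real.sin_sq_add_cos_sq θ
  ext
  · simp only [reflect, LinearMap.coe_mk, AddHom.coe_mk]
    conv_rhs => rw [← one_smul ℝ p.1, ← h]
    module
  · simp only [reflect, LinearMap.coe_mk, AddHom.coe_mk]
    conv_rhs => rw [← one_smul ℝ p.2, ← h]
    module

theorem norm_reflect_sq (θ : ℝ) (p : V × V) :
    ‖(reflect V θ p).1‖ ^ 2 + ‖(reflect V θ p).2‖ ^ 2 = ‖p.1‖ ^ 2 + ‖p.2‖ ^ 2 := by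
  have h := Real.sin_sq_add_cos_sq θ
  simp only [reflect, LinearMap.coe_mk, AddHom.coe_mk]
  rw [norm_add_sq_real, norm_sub_sq_real, norm_smul, norm_smul, norm_smul, norm_smul]
  simp only [inner_smul_left, inner_smul_right, mul_pow, Real.norm_eq_abs, sq_abs]
  simp only [conj_trivial]
  linear_combination (‖p.1‖ ^ 2 + ‖p.2‖ ^ 2) * h

/-- The first component of `reflect V θ p` moves from p.2 at θ = 0 to p.1 at θ = π/2, and its
θ-derivative is the second component. The difference of W is thus an integral over the arc, and
Cauchy–Schwarz applies. -/
theorem sq_sub_le_integral_reflect {W : V → ℝ} (hW : ContDiff ℝ 1 W) (p : V × V) :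
    ENNReal.ofReal ((W p.1 - W p.2) ^ 2) ≤ ENNReal.ofReal (Real.pi / 2) *
      ∫⁻ θ in Set.Ioc 0 (Real.pi / 2),
        ENNReal.ofReal ((‖fderiv ℝ W (reflect V θ p).1‖ * ‖(reflect V θ p).2‖) ^ 2) := by
  set h : ℝ → ℝ := fun θ => fderiv ℝ W (reflect V θ p).1 (reflect V θ p).2
  have hc1 : Continuous fun θ => (reflect V θ p).1 := by
    simp only [reflect, LinearMap.coe_mk, AddHom.coe_mk]; fun_prop
  have hc2 : Continuous fun θ => (reflect V θ p).2 := by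
    simp only [reflect, LinearMap.coe_mk, AddHom.coe_mk]; fun_prop
  have hcf := hW.continuous_fderiv (by simp)
  have hc : Continuous h := (hcf.comp hc1).clm_apply hc2
  have hd : ∀ θ, HasDerivAt (fun θ => W (reflect V θ p).1) (h θ) θ := fun θ => by
    refine ((hW.differentiable (by simp)) _).hasFDerivAt.comp_hasDerivAt θ ?_
    simp only [reflect, LinearMap.coe_mk, AddHom.coe_mk]
    have := ((Real.hasDerivAt_sin θ).smul_const p.1).add ((Real.hasDerivAt_cos θ).smul_const p.2)
    convert! this using 1
    simp [sub_eq_add_neg]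
  have hpi : 0 < Real.pi / 2 := by positivity
  have hcsq : Continuous fun θ => h θ ^ 2 := hc.pow 2
  have hcm : ∀ m : ℝ, Continuous fun θ => m * h θ := fun m => continuous_const.mul hc
  have hI : ∫ θ in (0:ℝ)..(Real.pi / 2), h θ = W p.1 - W p.2 := by
    rw [intervalIntegral.integral_eq_sub_of_hasDerivAt (fun θ _ => hd θ) (hc.intervalIntegrable _ _)]
    simp [reflect]
  have hsq : (W p.1 - W p.2) ^ 2 ≤ Real.pi / 2 * ∫ θ in (0:ℝ)..(Real.pi / 2), h θ ^ 2 := by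
    -- The mean of h over the arc; Cauchy–Schwarz is the nonnegativity of the variance of h.
    set m := (W p.1 - W p.2) / (Real.pi / 2) with hm
    have h0 : 0 ≤ ∫ θ in (0:ℝ)..(Real.pi / 2), (h θ - m) ^ 2 :=
      intervalIntegral.integral_nonneg hpi.le fun θ _ => sq_nonneg _
    have h4 : Continuous fun θ => h θ ^ 2 - 2 * m * h θ := hcsq.sub (hcm _)
    have e : ∀ θ, (h θ - m) ^ 2 = h θ ^ 2 - 2 * m * h θ + m ^ 2 := fun θ => by ring
    simp only [e] at h0
    rw [intervalIntegral.integral_add (h4.intervalIntegrable _ _)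
      (continuous_const.intervalIntegrable _ _), intervalIntegral.integral_sub
      (hcsq.intervalIntegrable _ _) ((hcm _).intervalIntegrable _ _),
      intervalIntegral.integral_const_mul, hI, intervalIntegral.integral_const, sub_zero,
      smul_eq_mul] at h0
    have e2 : W p.1 - W p.2 = m * (Real.pi / 2) := by rw [hm]; field_simp
    rw [e2] at h0 ⊢
    nlinarith
  refine (ENNReal.ofReal_le_ofReal hsq).trans ?_
  rw [ENNReal.ofReal_mul hpi.le, intervalIntegral.integral_of_le hpi.le,
    ofReal_integral_eq_lintegral_ofReal hcsq.integrableOn_Ioc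
      (ae_of_all _ fun θ => sq_nonneg _)]
  refine mul_le_mul_right (lintegral_mono fun θ => ENNReal.ofReal_le_ofReal ?_) _
  rw [← sq_abs, ← Real.norm_eq_abs]
  exact pow_le_pow_left₀ (norm_nonneg _) (ContinuousLinearMap.le_opNorm _ _) 2

variable [FiniteDimensional ℝ V] [MeasurableSpace V] [BorelSpace V]

/-- The map is a linear involution, so its determinant squares to 1. -/
theorem measurePreserving_reflect (θ : ℝ) :
    MeasurePreserving (reflect V θ) (volume : Measure (V × V)) volume := by
  have hd : LinearMap.det (reflect V θ) * LinearMap.det (reflect V θ) = 1 := by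
    rw [← map_mul]
    rw [show reflect V θ * reflect V θ = LinearMap.id from
      LinearMap.ext fun p => reflect_reflect θ p, LinearMap.det_id]
  have h0 : LinearMap.det (reflect V θ) ≠ 0 := fun h => by simp [h] at hd
  have h1 : |(LinearMap.det (reflect V θ))⁻¹| = 1 := by
    rw [abs_inv, inv_eq_one]
    have : |LinearMap.det (reflect V θ)| * |LinearMap.det (reflect V θ)| = 1 := by
      rw [← abs_mul, hd, abs_one]
    nlinarith [abs_nonneg (LinearMap.det (reflect V θ))]
  refine ⟨(LinearMap.continuous_of_finiteDimensional _).measurable, ?_⟩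
  have : (volume : Measure (V × V)).IsAddHaarMeasure := by
    rw [Measure.volume_eq_prod]; infer_instance
  rw [Measure.map_linearMap_addHaar_eq_smul_addHaar _ h0, h1, ENNReal.ofReal_one, one_smul]

end Rotation

variable {N : ℕ}

/-- A Poincaré inequality for the Gaussian measure. -/
theorem exists_gaussian_poincare (N : ℕ) [NeZero N] : ∃ K : ℝ, 0 < K ∧ ∀ W : E N → ℝ,
    ContDiff ℝ 1 W → ∃ k : ℝ,
      ∫⁻ x, ENNReal.ofReal ((W x - k) ^ 2 * Real.exp (-‖x‖ ^ 2)) ≤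
        ENNReal.ofReal K * ∫⁻ x, ENNReal.ofReal (‖∇ W x‖ ^ 2 * Real.exp (-‖x‖ ^ 2)) := by
  set w : E N → ℝ≥0∞ := fun x => ENNReal.ofReal (Real.exp (-‖x‖ ^ 2)) with hw
  have hwc : Continuous w := ENNReal.continuous_ofReal.comp (by fun_prop)
  have hwm : Measurable w := hwc.measurable
  have hN : (0 : ℝ) < N := by exact_mod_cast NeZero.pos N
  set Z := ∫⁻ x, w x with hZ
  set M := ∫⁻ x : E N, ENNReal.ofReal (‖x‖ ^ 2) * w x with hM
  have hZt : Z < ⊤ := by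
    have := lintegral_rpow_mul_exp_lt_top (N := N) (s := 0) (β := 1) (p := 2) (by linarith)
      two_pos one_pos
    simpa [hZ, hw] using this
  have hMt : M < ⊤ := by
    have := lintegral_rpow_mul_exp_lt_top (N := N) (s := 2) (β := 1) (p := 2) (by linarith)
      two_pos one_pos
    simpa [hM, hw, ENNReal.ofReal_mul] using this
  have hZ0 : Z ≠ 0 := by
    rw [hZ, lintegral_eq_zero_iff hwm |>.ne]
    intro h
    obtain ⟨x, hx⟩ := (show ∀ᵐ x : E N, w x = 0 from h).exists
    exact absurd (ENNReal.ofReal_eq_zero.1 hx) (not_le.2 (Real.exp_pos _))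
  have hKt : ENNReal.ofReal (Real.pi / 2) ^ 2 * M / Z ≠ ⊤ :=
    ENNReal.div_ne_top (ENNReal.mul_ne_top (by simp) hMt.ne) hZ0
  refine ⟨(ENNReal.ofReal (Real.pi / 2) ^ 2 * M / Z).toReal + 1, by positivity, fun W hW => ?_⟩
  have hcf := hW.continuous_fderiv (by simp)
  set D := ∫⁻ x, ENNReal.ofReal (‖fderiv ℝ W x‖ ^ 2) * w x with hD
  set I := ∫⁻ p : E N × E N, ENNReal.ofReal ((W p.1 - W p.2) ^ 2) * (w p.1 * w p.2) with hI
  have hcr : Continuous fun q : (E N × E N) × ℝ => reflect (E N) q.2 q.1 := by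
    simp only [reflect, LinearMap.coe_mk, AddHom.coe_mk]; fun_prop
  have hIle : I ≤ ENNReal.ofReal (Real.pi / 2) ^ 2 * M * D := by
    set Φ : E N × E N → ℝ≥0∞ := fun p =>
      ENNReal.ofReal ((‖fderiv ℝ W p.1‖ * ‖p.2‖) ^ 2) * (w p.1 * w p.2) with hΦ
    have hΦm : Measurable Φ := by
      have h1 : Continuous fun p : E N × E N => (‖fderiv ℝ W p.1‖ * ‖p.2‖) ^ 2 := by fun_prop
      exact (ENNReal.continuous_ofReal.comp h1).measurable.mul
        ((hwm.comp measurable_fst).mul (hwm.comp measurable_snd))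
    -- The product Gaussian depends only on |x|² + |y|², which is preserved. Changing variables by
    -- the reflection then decouples the integrand, at every angle, into the Dirichlet integral D
    -- times the second moment M.
    have hinv : ∀ θ (p : E N × E N),
        w p.1 * w p.2 = w (reflect (E N) θ p).1 * w (reflect (E N) θ p).2 := fun θ p => by
      simp only [hw]
      rw [← ENNReal.ofReal_mul (Real.exp_pos _).le, ← ENNReal.ofReal_mul (Real.exp_pos _).le,
        ← Real.exp_add, ← Real.exp_add, ← neg_add, ← neg_add, norm_reflect_sq]
    calc I ≤ ∫⁻ p : E N × E N, ENNReal.ofReal (Real.pi / 2) *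
          ∫⁻ θ in Set.Ioc 0 (Real.pi / 2), Φ (reflect (E N) θ p) := by
          refine lintegral_mono fun p => ?_
          refine (mul_le_mul_left (sq_sub_le_integral_reflect hW p) _).trans (le_of_eq ?_)
          rw [mul_assoc, ← lintegral_mul_const']
          · congr 1
            refine lintegral_congr fun θ => ?_
            simp only [hΦ]
            rw [hinv θ p]
          · exact ENNReal.mul_ne_top ENNReal.ofReal_ne_top ENNReal.ofReal_ne_top
      _ = ENNReal.ofReal (Real.pi / 2) *
          ∫⁻ θ in Set.Ioc 0 (Real.pi / 2), ∫⁻ p : E N × E N, Φ (reflect (E N) θ p) := by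
          rw [lintegral_const_mul' _ _ ENNReal.ofReal_ne_top, lintegral_lintegral_swap]
          exact (hΦm.comp hcr.measurable).aemeasurable
      _ = ENNReal.ofReal (Real.pi / 2) *
          ∫⁻ θ in Set.Ioc 0 (Real.pi / 2), D * M := by
          congr 1
          refine lintegral_congr fun θ => ?_
          rw [(measurePreserving_reflect θ).lintegral_comp hΦm, Measure.volume_eq_prod]
          have e : ∀ p, Φ p = (ENNReal.ofReal (‖fderiv ℝ W p.1‖ ^ 2) * w p.1) *
              (ENNReal.ofReal (‖p.2‖ ^ 2) * w p.2) := fun p => by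
            simp only [hΦ]
            rw [mul_pow, ENNReal.ofReal_mul (by positivity)]
            ring
          simp only [e]
          refine lintegral_prod_mul (f := fun x : E N => ENNReal.ofReal (‖fderiv ℝ W x‖ ^ 2) * w x)
            (g := fun x : E N => ENNReal.ofReal (‖x‖ ^ 2) * w x) ?_ ?_
          · exact ((ENNReal.continuous_ofReal.comp (hcf.norm.pow 2)).measurable.mul hwm).aemeasurable
          · exact ((ENNReal.continuous_ofReal.comp (continuous_norm.pow 2)).measurable.mul
              hwm).aemeasurable
      _ = _ := by
          rw [setLIntegral_const, Real.volume_Ioc, sub_zero]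
          ring
  set ν : Measure (E N) := volume.withDensity w with hν
  have hνu : ν Set.univ = Z := by rw [hν, withDensity_apply _ MeasurableSet.univ]; simp [hZ]
  have hν0 : ν ≠ 0 := fun h => hZ0 (by rw [← hνu, h]; simp)
  have hmeas : Measurable fun p : E N × E N => ENNReal.ofReal ((W p.2 - W p.1) ^ 2) * w p.2 := by
    have h1 : Continuous fun p : E N × E N => (W p.2 - W p.1) ^ 2 := by
      have := hW.continuous; fun_prop
    exact (ENNReal.continuous_ofReal.comp h1).measurable.mul (hwm.comp measurable_snd)
  have hmeas1 : Measurable fun y => ∫⁻ x, ENNReal.ofReal ((W x - W y) ^ 2) * w x :=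
    hmeas.lintegral_prod_right'
  have : IsFiniteMeasure ν := ⟨by rw [hνu]; exact hZt⟩
  -- Some y does no worse than the Gaussian average, so k = W y serves as the constant, and no
  -- integrability of W is needed to define a mean.
  obtain ⟨y, hy⟩ := exists_le_laverage hν0 hmeas1.aemeasurable
  refine ⟨W y, ?_⟩
  have hav : ⨍⁻ y, (∫⁻ x, ENNReal.ofReal ((W x - W y) ^ 2) * w x) ∂ν = I / Z := by
    rw [laverage_eq, hνu, hν, lintegral_withDensity_eq_lintegral_mul _ hwm hmeas1, hI,
      Measure.volume_eq_prod, lintegral_prod_symm]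
    · congr 1
      refine lintegral_congr fun y => ?_
      simp only [Pi.mul_apply]
      rw [← lintegral_const_mul' _ _ ENNReal.ofReal_ne_top]
      refine lintegral_congr fun x => ?_
      ring
    · have h1 : Continuous fun p : E N × E N => (W p.1 - W p.2) ^ 2 := by
        have := hW.continuous; fun_prop
      exact ((ENNReal.continuous_ofReal.comp h1).measurable.mul
        ((hwm.comp measurable_fst).mul (hwm.comp measurable_snd))).aemeasurable
  rw [hav] at hy
  have hDe : ∫⁻ x, ENNReal.ofReal (‖∇ W x‖ ^ 2 * Real.exp (-‖x‖ ^ 2)) = D := by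
    refine lintegral_congr fun x => ?_
    rw [ENNReal.ofReal_mul (by positivity), gradient, LinearIsometryEquiv.norm_map]
  rw [hDe]
  calc _ = ∫⁻ x, ENNReal.ofReal ((W x - W y) ^ 2) * w x :=
        lintegral_congr fun x => ENNReal.ofReal_mul (by positivity)
    _ ≤ I / Z := hy
    _ ≤ ENNReal.ofReal (Real.pi / 2) ^ 2 * M * D / Z := ENNReal.div_le_div_right hIle _
    _ = ENNReal.ofReal (Real.pi / 2) ^ 2 * M / Z * D := by
        simp only [div_eq_mul_inv]; ring
    _ ≤ _ := by
        refine mul_le_mul_left ?_ _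
        rw [ENNReal.le_ofReal_iff_toReal_le hKt (by positivity)]
        linarith

end CKN

/-! ### Radial change of variables and the stretched-exponential Poincaré inequality -/

namespace CKN

variable {N : ℕ}

section ChangeOfVariables

variable [NeZero N]

theorem lintegral_polar {f : E N → ℝ≥0∞} (hf : Measurable f) :
    ∫⁻ x, f x = ∫⁻ θ : Metric.sphere (0 : E N) 1, (∫⁻ r in Set.Ioi (0 : ℝ),
      ENNReal.ofReal (r ^ (N - 1)) * f (r • (θ : E N))) ∂(volume : Measure (E N)).toSphere := by
  have hmp := (volume : Measure (E N)).measurePreserving_homeomorphUnitSphereProd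
  have hm : Measurable fun q : Metric.sphere (0 : E N) 1 × Set.Ioi (0 : ℝ) =>
      f ((q.2 : ℝ) • (q.1 : E N)) := by
    refine hf.comp (Continuous.measurable ?_)
    fun_prop
  have e1 : ∫⁻ x, f x = ∫⁻ x : ({0}ᶜ : Set (E N)), f x
      ∂((volume : Measure (E N)).comap (↑)) := by
    rw [lintegral_subtype_comap (measurableSet_singleton _).compl, restrict_compl_singleton]
  have e2 : ∀ x : ({0}ᶜ : Set (E N)), f x =
      f (((homeomorphUnitSphereProd (E N) x).2 : ℝ) • ((homeomorphUnitSphereProd (E N) x).1 : E N)) := by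
    intro x
    have hx : ‖(x : E N)‖ ≠ 0 := norm_ne_zero_iff.2 x.2
    simp [smul_smul, hx]
  rw [e1]
  simp_rw [e2]
  rw [hmp.lintegral_comp hm, lintegral_prod _ hm.aemeasurable]
  refine lintegral_congr fun θ => ?_
  rw [Measure.volumeIoiPow, lintegral_withDensity_eq_lintegral_mul]
  · simp only [Pi.mul_apply, finrank_euclideanSpace, Fintype.card_fin]
    exact lintegral_subtype_comap measurableSet_Ioi
      (fun r : ℝ => ENNReal.ofReal (r ^ (N - 1)) * f (r • (θ : E N)))
  · fun_prop
  · exact hm.comp (measurable_const.prodMk measurable_id)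

theorem lintegral_Ioi_comp_rpow {μ p : ℝ} (hμ : 0 < μ) (hp : 0 < p) (F : ℝ → ℝ≥0∞) :
    ∫⁻ r in Set.Ioi (0 : ℝ), F r =
      ∫⁻ s in Set.Ioi (0 : ℝ), ENNReal.ofReal (μ * p * s ^ (p - 1)) * F (μ * s ^ p) := by
  have himg : (fun s : ℝ => μ * s ^ p) '' Set.Ioi 0 = Set.Ioi 0 := by
    ext r
    constructor
    · rintro ⟨s, hs, rfl⟩
      have : 0 < s := hs
      exact Set.mem_Ioi.2 (by positivity)
    · intro hr
      have hr0 : 0 < r := hr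
      refine ⟨(r / μ) ^ p⁻¹, Set.mem_Ioi.2 (by positivity), ?_⟩
      simp only
      rw [← Real.rpow_mul (by positivity), inv_mul_cancel₀ hp.ne', Real.rpow_one]
      field_simp
  have hinj : Set.InjOn (fun s : ℝ => μ * s ^ p) (Set.Ioi 0) := by
    intro s hs t ht h
    have h' : s ^ p = t ^ p := mul_left_cancel₀ hμ.ne' h
    exact (Real.rpow_left_inj (le_of_lt hs) (le_of_lt ht) hp.ne').1 h'
  have := lintegral_image_eq_lintegral_abs_deriv_mul (f := fun s : ℝ => μ * s ^ p)
    (f' := fun s => μ * (p * s ^ (p - 1))) measurableSet_Ioi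
    (fun s hs => ((Real.hasDerivAt_rpow_const (Or.inl (ne_of_gt hs))).const_mul μ).hasDerivWithinAt)
    hinj F
  rw [himg] at this
  rw [this]
  refine setLIntegral_congr_fun measurableSet_Ioi fun s hs => ?_
  have hs0 : 0 < s := hs
  rw [abs_of_pos (by positivity), mul_assoc]

/-- The radial map `y ↦ μ |y|^{p-1} y`. -/
def radial (N : ℕ) (μ p : ℝ) (y : E N) : E N := (μ * ‖y‖ ^ (p - 1)) • y

omit [NeZero N] in
theorem norm_radial {μ p : ℝ} (hμ : 0 < μ) {y : E N} (hy : y ≠ 0) :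
    ‖radial N μ p y‖ = μ * ‖y‖ ^ p := by
  have hn : 0 < ‖y‖ := norm_pos_iff.2 hy
  rw [radial, norm_smul, Real.norm_of_nonneg (by positivity), mul_assoc, Real.rpow_sub_one hn.ne']
  field_simp

/-- In polar coordinates the map fixes the direction and substitutes r = μ s^p; the Jacobian comes
from r^{N-1} dr. -/
theorem lintegral_radial {μ p : ℝ} (hμ : 0 < μ) (hp : 0 < p) {f : E N → ℝ≥0∞} (hf : Measurable f) :
    ∫⁻ x, f x = ∫⁻ y, ENNReal.ofReal (p * μ ^ (N : ℝ) * ‖y‖ ^ (N * (p - 1))) *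
      f (radial N μ p y) := by
  have hR : Measurable (radial N μ p) :=
    ((measurable_norm.pow_const _).const_mul μ).smul measurable_id
  rw [lintegral_polar hf, lintegral_polar]
  · refine lintegral_congr fun θ => ?_
    rw [lintegral_Ioi_comp_rpow hμ hp]
    refine setLIntegral_congr_fun measurableSet_Ioi fun s hs => ?_
    have hs0 : 0 < s := hs
    have hθ : ‖(θ : E N)‖ = 1 := by simp
    have hn : ‖s • (θ : E N)‖ = s := by rw [norm_smul, hθ, mul_one, Real.norm_of_nonneg hs0.le]
    have hN : 1 ≤ N := NeZero.one_le
    rw [hn, radial, hn, smul_smul, ← mul_assoc, ← mul_assoc, ← ENNReal.ofReal_mul (by positivity),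
      ← ENNReal.ofReal_mul (by positivity)]
    congr 2
    · have e1 : (μ * s ^ p) ^ (N - 1) = μ ^ ((N : ℝ) - 1) * s ^ (p * (N - 1)) := by
        rw [mul_pow, ← Real.rpow_natCast, ← Real.rpow_natCast, ← Real.rpow_mul hs0.le,
          Nat.cast_sub hN, Nat.cast_one]
      have e2 : s ^ (N - 1) = s ^ ((N : ℝ) - 1) := by
        rw [← Real.rpow_natCast, Nat.cast_sub hN, Nat.cast_one]
      have e3 : μ ^ (N : ℝ) = μ ^ ((N : ℝ) - 1) * μ := by
        rw [← Real.rpow_add_one hμ.ne']; ring_nf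
      rw [e1, e2, e3]
      have e4 : s ^ (p - 1) * s ^ (p * (N - 1)) = s ^ ((N : ℝ) - 1) * s ^ (N * (p - 1)) := by
        rw [← Real.rpow_add hs0, ← Real.rpow_add hs0]; ring_nf
      linear_combination (μ * p * μ ^ ((N : ℝ) - 1)) * e4
    · congr 1
      rw [mul_assoc, ← Real.rpow_add_one hs0.ne']
      ring_nf
  · exact (((measurable_norm.pow_const _).const_mul _).ennreal_ofReal).mul (hf.comp hR)

end ChangeOfVariables

theorem contDiffAt_radial {μ p : ℝ} {y : E N} (hy : y ≠ 0) : ContDiffAt ℝ ∞ (radial N μ p) y :=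
  (contDiffAt_const.mul (smoothOff_rpow (p - 1) y hy)).smul contDiffAt_id

/-- By the product rule the derivative is μ|y|^{p-1} times the identity plus a rank-one term of size
|p-1| μ|y|^{p-1}. -/
theorem norm_fderiv_radial_le {μ p : ℝ} (hμ : 0 < μ) {y : E N} (hy : y ≠ 0) :
    ‖fderiv ℝ (radial N μ p) y‖ ≤ μ * (1 + |p - 1|) * ‖y‖ ^ (p - 1) := by
  have hn : 0 < ‖y‖ := norm_pos_iff.2 hy
  have h1 : HasFDerivAt (fun x : E N => μ * ‖x‖ ^ (p - 1))
      (μ • InnerProductSpace.toDual ℝ (E N) (((p - 1) * ‖y‖ ^ (p - 1 - 2)) • y)) y :=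
    (hasGradientAt_iff_hasFDerivAt.1 (hasGradientAt_rpow (p - 1) hy)).const_mul μ
  have h2 := h1.smul (hasFDerivAt_id y)
  have h3 : fderiv ℝ (radial N μ p) y = _ := h2.fderiv
  rw [h3]
  refine ContinuousLinearMap.opNorm_le_bound _ (by positivity) fun v => ?_
  simp only [_root_.add_apply, _root_.smul_apply,
    ContinuousLinearMap.smulRight_apply, InnerProductSpace.toDual_apply_apply, id_eq,
    ContinuousLinearMap.id_apply, inner_smul_left, conj_trivial, smul_eq_mul]
  refine (norm_add_le _ _).trans ?_
  rw [norm_smul, norm_smul, Real.norm_of_nonneg (by positivity : 0 ≤ μ * ‖y‖ ^ (p - 1)),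
    norm_mul, norm_mul, norm_mul, Real.norm_of_nonneg hμ.le, Real.norm_of_nonneg
      (by positivity : 0 ≤ ‖y‖ ^ (p - 1 - 2)), Real.norm_eq_abs (p - 1)]
  have e : ‖y‖ ^ (p - 1) = ‖y‖ ^ (p - 1 - 2) * ‖y‖ ^ 2 := by
    rw [← Real.rpow_natCast, ← Real.rpow_add hn]; norm_num
  have hi := norm_inner_le_norm (𝕜 := ℝ) y v
  calc _ ≤ μ * ‖y‖ ^ (p - 1) * ‖v‖ +
        μ * (|p - 1| * ‖y‖ ^ (p - 1 - 2) * (‖y‖ * ‖v‖)) * ‖y‖ := by gcongr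
    _ = _ := by rw [e]; ring

/-- The radial map may fail to be smooth at 0, but it is continuous there and w vanishes near 0. -/
theorem IsTest.contDiff_comp_radial {w : E N → ℝ} (hw : IsTest w) {μ p : ℝ} (hμ : 0 < μ)
    (hp : 0 < p) : ContDiff ℝ ∞ fun y => w (radial N μ p y) := by
  refine contDiff_iff_contDiffAt.2 fun y => ?_
  by_cases hy : y = 0
  · have ht : Tendsto (radial N μ p) (𝓝 0) (𝓝 0) := by
      rw [tendsto_zero_iff_norm_tendsto_zero]
      have : Tendsto (fun y : E N => μ * ‖y‖ ^ p) (𝓝 0) (𝓝 0) := by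
        have hc : Continuous fun y : E N => μ * ‖y‖ ^ p :=
          continuous_const.mul (continuous_norm.rpow_const fun _ => Or.inr hp.le)
        have := hc.tendsto 0
        simpa [hp.ne'] using this
      refine this.congr fun y => ?_
      by_cases h0 : y = 0
      · simp [h0, radial, hp.ne']
      · rw [norm_radial hμ h0]
    rw [hy]
    exact contDiffAt_const.congr_of_eventuallyEq (ht.eventually hw.eventuallyEq_zero)
  · exact hw.smooth.contDiffAt.comp y (contDiffAt_radial hy)

theorem IsTest.norm_gradient_comp_radial_le {w : E N → ℝ} (hw : IsTest w) {μ p : ℝ} (hμ : 0 < μ)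
    {y : E N} (hy : y ≠ 0) :
    ‖∇ (fun y => w (radial N μ p y)) y‖ ≤
      μ * (1 + |p - 1|) * ‖y‖ ^ (p - 1) * ‖∇ w (radial N μ p y)‖ := by
  simp only [gradient, LinearIsometryEquiv.norm_map]
  have : fderiv ℝ (fun y => w (radial N μ p y)) y =
      (fderiv ℝ w (radial N μ p y)).comp (fderiv ℝ (radial N μ p) y) :=
    fderiv_comp y (hw.differentiable _) ((contDiffAt_radial hy).differentiableAt (by simp))
  rw [this, mul_comm]
  exact (ContinuousLinearMap.opNorm_comp_le _ _).trans
    (mul_le_mul_of_nonneg_left (norm_fderiv_radial_le hμ hy) (norm_nonneg _))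

/-- A weighted Poincaré inequality for the stretched-exponential measures. -/
theorem exists_stretched_poincare (N : ℕ) [NeZero N] {γ : ℝ} (hγ : 0 < γ) :
    ∃ C : ℝ, 0 < C ∧ ∀ lam : ℝ, 0 < lam → ∀ w : E N → ℝ, IsTest w → ∃ k : ℝ,
      ∫⁻ x, ENNReal.ofReal (‖x‖ ^ (N * γ - N) * Real.exp (-(lam / γ) * ‖x‖ ^ (2 * γ)) *
        (w x - k) ^ 2) ≤
      ENNReal.ofReal (C / lam) * ∫⁻ x, ENNReal.ofReal (‖x‖ ^ (N * γ - N + 2 - 2 * γ) *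
        Real.exp (-(lam / γ) * ‖x‖ ^ (2 * γ)) * ‖∇ w x‖ ^ 2) := by
  obtain ⟨K, hK, hP⟩ := exists_gaussian_poincare N
  set p : ℝ := 1 / γ with hp
  have hp0 : 0 < p := by positivity
  have hpγ : p * γ = 1 := by rw [hp]; field_simp
  set A : ℝ := 1 + |p - 1| with hA
  have hA0 : 0 < A := by positivity
  refine ⟨K * A ^ 2 * γ, by positivity, fun lam hlam w hw => ?_⟩
  -- With p = 1/γ, this μ turns (λ/γ)|x|^{2γ} into exactly |y|².
  set μ : ℝ := (γ / lam) ^ (1 / (2 * γ)) with hμd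
  have hμ : 0 < μ := by positivity
  have hμγ : μ ^ (2 * γ) = γ / lam := by
    rw [hμd, ← Real.rpow_mul (by positivity), one_div, inv_mul_cancel₀ (by positivity), Real.rpow_one]
  obtain ⟨k, hk⟩ := hP _ ((hw.contDiff_comp_radial hμ hp0).of_le (by simp))
  refine ⟨k, ?_⟩
  have hexp : ∀ y : E N, y ≠ 0 → Real.exp (-(lam / γ) * ‖radial N μ p y‖ ^ (2 * γ)) =
      Real.exp (-‖y‖ ^ 2) := fun y hy => by
    rw [norm_radial hμ hy, Real.mul_rpow hμ.le (by positivity), hμγ, ← Real.rpow_mul (norm_nonneg _),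
      show p * (2 * γ) = 2 by linear_combination 2 * hpγ, Real.rpow_two]
    congr 1
    field_simp
  have hrad : ∀ (s : ℝ) (y : E N), y ≠ 0 →
      p * μ ^ (N : ℝ) * ‖y‖ ^ (N * (p - 1)) * ‖radial N μ p y‖ ^ s =
        p * μ ^ (N + s) * ‖y‖ ^ (N * (p - 1) + p * s) := fun s y hy => by
    have hn : 0 < ‖y‖ := norm_pos_iff.2 hy
    rw [norm_radial hμ hy, Real.mul_rpow hμ.le (by positivity), ← Real.rpow_mul hn.le,
      Real.rpow_add hμ, Real.rpow_add hn]
    ring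
  have hwc := hw.smooth.continuous
  have hgm : Measurable (∇ w) :=
    (hw.continuous_of_support (ContinuousOn.gradient_of_smoothOff hw.smoothOff)
      fun _ => IsTest.gradient_eq_zero).1.measurable
  have hexpm : ∀ s : ℝ, Measurable fun x : E N =>
      ‖x‖ ^ s * Real.exp (-(lam / γ) * ‖x‖ ^ (2 * γ)) := fun s =>
    (measurable_norm.pow_const _).mul
      (Real.measurable_exp.comp ((measurable_norm.pow_const _).const_mul _))
  set X := ∫⁻ y : E N, ENNReal.ofReal (‖y‖ ^ (2 * (p - 1)) * ‖∇ w (radial N μ p y)‖ ^ 2 *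
    Real.exp (-‖y‖ ^ 2)) with hX
  have eL : ∫⁻ x, ENNReal.ofReal (‖x‖ ^ (N * γ - N) * Real.exp (-(lam / γ) * ‖x‖ ^ (2 * γ)) *
        (w x - k) ^ 2) = ENNReal.ofReal (p * μ ^ (N * γ)) *
      ∫⁻ y, ENNReal.ofReal ((w (radial N μ p y) - k) ^ 2 * Real.exp (-‖y‖ ^ 2)) := by
    rw [lintegral_radial hμ hp0, ← lintegral_const_mul' _ _ ENNReal.ofReal_ne_top]
    · refine lintegral_congr_ae (ae_ne_zero.mono fun y hy => ?_)
      simp only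
      rw [← ENNReal.ofReal_mul (by positivity), ← ENNReal.ofReal_mul (by positivity), hexp y hy,
        ← mul_assoc, ← mul_assoc, hrad _ y hy,
        show N * (p - 1) + p * (N * γ - N) = 0 by linear_combination N * hpγ, Real.rpow_zero]
      congr 1
      ring_nf
    · exact ((hexpm _).mul ((hwc.measurable.sub_const k).pow_const 2)).ennreal_ofReal
  have eR : ∫⁻ x, ENNReal.ofReal (‖x‖ ^ (N * γ - N + 2 - 2 * γ) *
        Real.exp (-(lam / γ) * ‖x‖ ^ (2 * γ)) * ‖∇ w x‖ ^ 2) =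
      ENNReal.ofReal (p * μ ^ (N * γ + 2 - 2 * γ)) * X := by
    rw [lintegral_radial hμ hp0, hX, ← lintegral_const_mul' _ _ ENNReal.ofReal_ne_top]
    · refine lintegral_congr_ae (ae_ne_zero.mono fun y hy => ?_)
      simp only
      rw [← ENNReal.ofReal_mul (by positivity), ← ENNReal.ofReal_mul (by positivity), hexp y hy,
        ← mul_assoc, ← mul_assoc, hrad _ y hy,
        show N * (p - 1) + p * (N * γ - N + 2 - 2 * γ) = 2 * (p - 1) by
          linear_combination (N - 2) * hpγ]
      congr 1
      ring_nf
    · exact ((hexpm _).mul (hgm.norm.pow_const 2)).ennreal_ofReal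
  have hle : ∫⁻ y, ENNReal.ofReal (‖∇ (fun y => w (radial N μ p y)) y‖ ^ 2 * Real.exp (-‖y‖ ^ 2)) ≤
      ENNReal.ofReal ((μ * A) ^ 2) * X := by
    rw [hX, ← lintegral_const_mul' _ _ ENNReal.ofReal_ne_top]
    refine lintegral_mono_ae (ae_ne_zero.mono fun y hy => ?_)
    rw [← ENNReal.ofReal_mul (by positivity)]
    refine ENNReal.ofReal_le_ofReal ?_
    have h1 := pow_le_pow_left₀ (norm_nonneg _) (hw.norm_gradient_comp_radial_le (p := p) hμ hy) 2
    have e : ‖y‖ ^ (2 * (p - 1)) = (‖y‖ ^ (p - 1)) ^ 2 := by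
      rw [← Real.rpow_natCast, ← Real.rpow_mul (norm_nonneg _), mul_comm]; norm_num
    calc _ ≤ (μ * (1 + |p - 1|) * ‖y‖ ^ (p - 1) * ‖∇ w (radial N μ p y)‖) ^ 2 *
          Real.exp (-‖y‖ ^ 2) := by gcongr
      _ = _ := by rw [e, hA]; ring
  rw [eL, eR]
  calc _ ≤ ENNReal.ofReal (p * μ ^ (N * γ)) * (ENNReal.ofReal K *
        (ENNReal.ofReal ((μ * A) ^ 2) * X)) := by gcongr; exact hk.trans (by gcongr)
    _ = ENNReal.ofReal (p * μ ^ (N * γ) * (K * (μ * A) ^ 2)) * X := by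
      rw [ENNReal.ofReal_mul (p := p * μ ^ (N * γ)) (by positivity), ENNReal.ofReal_mul hK.le]; ring
    _ = ENNReal.ofReal (K * A ^ 2 * γ / lam * (p * μ ^ (N * γ + 2 - 2 * γ))) * X := by
      congr 2
      -- The factor 1/λ in the constant arises here, from μ^{2γ} = γ/λ.
      have e : μ ^ (N * γ) * μ ^ 2 = γ / lam * μ ^ (N * γ + 2 - 2 * γ) := by
        rw [← hμγ, ← Real.rpow_add hμ, ← Real.rpow_two, ← Real.rpow_add hμ]
        ring_nf
      linear_combination (p * K * A ^ 2) * e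
    _ = _ := by rw [ENNReal.ofReal_mul (by positivity), mul_assoc]

end CKN

/-! ### Stability of the inequality and the best constant -/

namespace CKN

variable {N : ℕ} {a b γ κ lam : ℝ} {F : Type*} [NormedAddCommGroup F] [NormedSpace ℝ F]

theorem Params.neZero (hp : Params N a b γ κ) : NeZero N := ⟨by have := hp.three_le; omega⟩

theorem Params.sharp_pos (hp : Params N a b γ κ) : 0 < N * γ / 2 := by
  have := hp.pos
  have hN : (3 : ℝ) ≤ N := by exact_mod_cast hp.three_le
  positivity

/-- If the Hardy constant vanished, `Params.power` would force κ = 0, and `Params.scale` would give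
(N-2)γ = 0. -/
theorem Params.hardy_ne (hp : Params N a b γ κ) : (N : ℝ) - 2 * b - 2 ≠ 0 := by
  intro h
  have hN : (3 : ℝ) ≤ N := by exact_mod_cast hp.three_le
  have h1 : 0 < ((N : ℝ) - 2) * γ := mul_pos (by linarith) hp.pos
  have h2 := hp.power
  have h3 := hp.scale
  have h4 : κ ^ 2 = 0 := by linear_combination -h2 - κ * h
  have h5 : κ = 0 := by simpa using h4
  rw [h5] at h3
  linarith

theorem toReal_eWeightedNorm_const_smul (f : E N → F) (a k : ℝ) :
    (eWeightedNorm a (fun x => k • f x)).toReal = |k| * (eWeightedNorm a f).toReal := by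
  rw [eWeightedNorm_const_smul, ENNReal.toReal_mul, ENNReal.toReal_ofReal (abs_nonneg _)]

theorem toReal_eWeightedNorm_add_le {f g : E N → F} (a : ℝ) (hf : AEStronglyMeasurable f volume)
    (hg : AEStronglyMeasurable g volume) (hf' : eWeightedNorm a f < ⊤) (hg' : eWeightedNorm a g < ⊤) :
    (eWeightedNorm a (fun x => f x + g x)).toReal ≤
      (eWeightedNorm a f).toReal + (eWeightedNorm a g).toReal := by
  rw [← ENNReal.toReal_add hf'.ne hg'.ne]
  exact ENNReal.toReal_mono (ENNReal.add_ne_top.2 ⟨hf'.ne, hg'.ne⟩) (eWeightedNorm_add_le a hf hg)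

theorem eWeightedNorm_comp_neg {f : E N → ℝ} (a : ℝ) :
    eWeightedNorm a (fun x => f (-x)) = eWeightedNorm a f := by
  have h : eWeightedNorm a (fun x => f (-x)) ^ 2 = eWeightedNorm a f ^ 2 := by
    rw [eWeightedNorm_sq, eWeightedNorm_sq,
      ← lintegral_neg_eq_self (μ := (volume : Measure (E N)))
        (fun x => ENNReal.ofReal (‖x‖ ^ (-(2 * a)) * ‖f x‖ ^ 2))]
    simp only [norm_neg]
  exact (ENNReal.pow_right_strictMono two_ne_zero).injective h

/-- The difference of a function and a minimizer controls twice the odd part. -/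
theorem eWeightedNorm_odd_le {f h : E N → ℝ} (a : ℝ) (hf : AEStronglyMeasurable f volume)
    (hh : AEStronglyMeasurable h volume) (hodd : ∀ x, h (-x) = - h x) (heven : ∀ x, f (-x) = f x) :
    eWeightedNorm a h ≤ eWeightedNorm a (fun x => f x + h x) ∧
      eWeightedNorm a f ≤ eWeightedNorm a (fun x => f x + h x) := by
  have e : eWeightedNorm a (fun x => f x - h x) = eWeightedNorm a (fun x => f x + h x) := by
    rw [← eWeightedNorm_comp_neg (f := fun x => f x + h x)]
    simp only [hodd, heven, sub_eq_add_neg]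
  have two : ∀ q : E N → ℝ, eWeightedNorm a (fun x => (2 : ℝ) • q x) = 2 * eWeightedNorm a q :=
    fun q => by rw [eWeightedNorm_const_smul]; simp
  have h2 : (2 : ℝ≥0∞) ≠ 0 := two_ne_zero
  constructor
  · have := eWeightedNorm_sub_le a (hf.add hh) (hf.sub hh)
    rw [show eWeightedNorm a (f - h) = _ from e,
      show eWeightedNorm a (f + h) = eWeightedNorm a (fun x => f x + h x) from rfl, ← two_mul] at this
    rw [← ENNReal.mul_le_mul_iff_right h2 ENNReal.ofNat_ne_top, ← two]
    refine le_trans (le_of_eq ?_) this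
    congr 1; ext x; simp only [Pi.add_apply, Pi.sub_apply, smul_eq_mul]; ring
  · have := eWeightedNorm_add_le a (hf.add hh) (hf.sub hh)
    rw [show eWeightedNorm a (f - h) = _ from e,
      show eWeightedNorm a (f + h) = eWeightedNorm a (fun x => f x + h x) from rfl, ← two_mul] at this
    rw [← ENNReal.mul_le_mul_iff_right h2 ENNReal.ofNat_ne_top, ← two]
    refine le_trans (le_of_eq ?_) this
    congr 1; ext x; simp only [Pi.add_apply, Pi.sub_apply, smul_eq_mul]; ring

section

variable [NeZero N]

theorem ae_eq_zero_of_eWeightedNorm_eq_zero {f : E N → F} (hf : AEStronglyMeasurable f volume)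
    (h : eWeightedNorm a f = 0) : f =ᵐ[volume] 0 := by
  rw [eWeightedNorm, eLpNorm_eq_zero_iff (aesm_weight a hf) (by norm_num)] at h
  filter_upwards [h, ae_ne_zero] with x hx h0
  have : ‖x‖ ^ (-a) ≠ 0 := (Real.rpow_pos_of_pos (norm_pos_iff.2 h0) _).ne'
  simpa [this] using hx

theorem Approx.memL {u : E N → ℝ} {G : E N → E N} (h : Approx a b u G) : MemL a u := by
  obtain ⟨φ, h1, h2, -⟩ := h.seq
  exact ⟨h.grad.aesm, φ, h1, h2⟩

omit [NeZero N] in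
theorem setLIntegral_enorm_le_eWeightedNorm {f : E N → ℝ} {K : Set (E N)} {M : ℝ}
    (hK : IsCompact K) (hK0 : K ⊆ {0}ᶜ) (hM : ∀ x ∈ K, ‖‖x‖ ^ b‖ ≤ M)
    (hf : AEStronglyMeasurable f volume) :
    ∫⁻ x in K, ‖f x‖ₑ ≤ ENNReal.ofReal |M| * eWeightedNorm b f * volume K ^ (1 / 2 : ℝ) := by
  have k1 : eLpNorm f 1 (volume.restrict K) ≤ eLpNorm f 2 (volume.restrict K) *
      (volume.restrict K) Set.univ ^ (1 / ENNReal.toReal 1 - 1 / ENNReal.toReal 2) :=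
    eLpNorm_le_eLpNorm_mul_rpow_measure_univ (by norm_num) hf.restrict
  have k2 : (1 / ENNReal.toReal 1 - 1 / ENNReal.toReal 2 : ℝ) = 1 / 2 := by norm_num
  rw [eLpNorm_one_eq_lintegral_enorm, Measure.restrict_apply_univ, k2] at k1
  have k3 : eLpNorm f 2 (volume.restrict K) ≤
      eLpNorm (fun x => ‖x‖ ^ (-b) • (|M| • f x)) 2 (volume.restrict K) := by
    refine eLpNorm_mono_ae ?_
    filter_upwards [ae_restrict_mem hK.measurableSet] with x hx
    have hn : 0 < ‖x‖ := norm_pos_iff.2 (hK0 hx)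
    have hMx := (hM x hx).trans (le_abs_self M)
    rw [Real.norm_of_nonneg (by positivity)] at hMx
    rw [norm_smul, norm_smul, Real.norm_of_nonneg (r := ‖x‖ ^ _) (by positivity),
      Real.norm_of_nonneg (abs_nonneg M), ← mul_assoc]
    refine le_mul_of_one_le_left (norm_nonneg _) ?_
    rw [Real.rpow_neg hn.le, inv_mul_eq_div, one_le_div (by positivity)]
    exact hMx
  have k4 : eLpNorm (fun x => ‖x‖ ^ (-b) • (|M| • f x)) 2 (volume.restrict K) ≤
      eWeightedNorm b (fun x => |M| • f x) := eLpNorm_mono_measure _ Measure.restrict_le_self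
  rw [eWeightedNorm_const_smul, abs_abs] at k4
  exact k1.trans (mul_le_mul_left (k3.trans k4) _)

/-- On a compact set avoiding 0 the weight is bounded below, so convergence in the Hardy norm
implies L¹ convergence there. -/
theorem Approx.memH {u : E N → ℝ} {G : E N → E N} (h : Approx a b u G) : MemH b u := by
  obtain ⟨φ, h1, -, h3, h4⟩ := h.seq
  refine ⟨⟨G, h.grad⟩, φ, h1, fun K hK hK0 => ?_, ?_⟩
  · obtain ⟨M, hM⟩ := hK.exists_bound_of_continuousOn
      (((smoothOff_rpow (N := N) (b + 1)).continuousOn).mono hK0)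
    have hle : ∀ n, ∫⁻ x in K, ‖u x - φ n x‖ₑ ≤ ENNReal.ofReal |M| *
        eWeightedNorm (b + 1) (fun x => u x - φ n x) * volume K ^ (1 / 2 : ℝ) :=
      fun n => setLIntegral_enorm_le_eWeightedNorm hK hK0 hM (h.grad.aesm.sub (h1 n).aesm)
    have hlim := ENNReal.Tendsto.mul_const (b := volume K ^ (1 / 2 : ℝ))
      (ENNReal.Tendsto.const_mul h3 (Or.inr (ENNReal.ofReal_ne_top (r := |M|))))
      (Or.inr (ENNReal.rpow_ne_top_of_nonneg (by norm_num) hK.measure_lt_top.ne))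
    simp only [mul_zero, zero_mul] at hlim
    exact tendsto_of_tendsto_of_tendsto_of_le_of_le tendsto_const_nhds hlim (fun _ => zero_le) hle
  · exact h4.congr fun n => ((h.grad.sub (h1 n).smoothOff.hasWeakGrad).eHNorm_eq b).symm

omit [NeZero N] in
theorem MemL.norm_lt_top {u : E N → ℝ} (h : MemL a u) : eWeightedNorm a u < ⊤ := by
  obtain ⟨hm, φ, h1, h2⟩ := h
  exact eWeightedNorm_lt_top_of_tendsto hm (fun n => (h1 n).aesm) h2
    fun n => (h1 n).eWeightedNorm_lt_top' a

/-- Ground-state substitution: for u = w g the twisted field of u is g∇w, because that of g is zero.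
By `Params.scale` the weights |x|^{-2c}g² and |x|^{-2b}g² are exactly those of
`exists_stretched_poincare`. -/
theorem exists_twisted_poincare (hp : Params N a b γ κ) :
    ∃ C : ℝ, 0 < C ∧ ∀ lam : ℝ, 0 < lam → ∀ u : E N → ℝ, IsTest u → ∃ k : ℝ,
      (eWeightedNorm ((a + b + 1) / 2) (fun x => u x + k * profile N γ κ lam x)).toReal ^ 2 ≤
        C / lam * (eWeightedNorm b (twisted γ lam (-κ) u (∇ u))).toReal ^ 2 := by
  have hγ := hp.pos
  have ea := hp.a_eq
  have es := hp.scale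
  obtain ⟨C, hC, h⟩ := exists_stretched_poincare N hγ
  refine ⟨C, hC, fun lam hlam u hu => ?_⟩
  set g := profile N γ κ lam with hg
  have hg0 : ∀ x : E N, x ≠ 0 → g x ≠ 0 := fun x hx => (profile_pos hx).ne'
  have hw : IsTest fun x => u x * (g x)⁻¹ :=
    hu.mul fun x hx => (smoothOff_profile x hx).inv (hg0 x hx)
  set w : E N → ℝ := fun x => u x * (g x)⁻¹ with hwd
  have huw : u = fun x => w x * g x := by
    ext x
    by_cases hx : x = 0
    · have : u x = 0 := by rw [hx]; exact hu.eventuallyEq_zero.self_of_nhds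
      simp [hwd, this]
    · simp only [hwd]
      field_simp [hg0 x hx]
  obtain ⟨k, hk⟩ := h lam hlam w hw
  refine ⟨-k, ?_⟩
  have hg2 : ∀ (x : E N), x ≠ 0 → ∀ s : ℝ, ‖x‖ ^ s * g x ^ 2 =
      ‖x‖ ^ (s + 2 * κ) * Real.exp (-(lam / γ) * ‖x‖ ^ (2 * γ)) := fun x hx s => by
    have hn : 0 < ‖x‖ := norm_pos_iff.2 hx
    rw [hg, profile, mul_pow, ← Real.exp_nat_mul, ← Real.rpow_natCast, ← Real.rpow_mul hn.le,
      ← mul_assoc, ← Real.rpow_add hn]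
    congr 2
    · push_cast; ring
    · push_cast; field_simp
  have e1 : eWeightedNorm ((a + b + 1) / 2) (fun x => u x + -k * g x) ^ 2 =
      ∫⁻ x, ENNReal.ofReal (‖x‖ ^ (N * γ - N) * Real.exp (-(lam / γ) * ‖x‖ ^ (2 * γ)) *
        (w x - k) ^ 2) := by
    rw [eWeightedNorm_sq]
    refine lintegral_congr_ae (ae_ne_zero.mono fun x hx => ?_)
    simp only
    congr 1
    have := hg2 x hx (-(2 * ((a + b + 1) / 2)))
    rw [show -(2 * ((a + b + 1) / 2)) + 2 * κ = N * γ - N by rw [ea]; linear_combination es] at this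
    rw [← this, Real.norm_eq_abs, sq_abs, huw]
    ring
  have e2 : eWeightedNorm b (twisted γ lam (-κ) u (∇ u)) ^ 2 =
      ∫⁻ x, ENNReal.ofReal (‖x‖ ^ (N * γ - N + 2 - 2 * γ) *
        Real.exp (-(lam / γ) * ‖x‖ ^ (2 * γ)) * ‖∇ w x‖ ^ 2) := by
    rw [eWeightedNorm_sq]
    refine lintegral_congr_ae (ae_ne_zero.mono fun x hx => ?_)
    simp only
    congr 1
    have ht : twisted γ lam (-κ) u (∇ u) x = g x • ∇ w x := by
      rw [twisted]
      conv_lhs => rw [huw]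
      rw [gradient_mul (hw.differentiable x) (smoothOff_profile.differentiableAt hx),
        hg, gradient_profile hγ hx]
      module
    have := hg2 x hx (-(2 * b))
    rw [show -(2 * b) + 2 * κ = N * γ - N + 2 - 2 * γ by linear_combination es] at this
    rw [← this, ht, norm_smul, mul_pow, Real.norm_eq_abs, sq_abs]
    ring
  rw [← e1, ← e2] at hk
  have hfin : eWeightedNorm b (twisted γ lam (-κ) u (∇ u)) < ⊤ := by
    refine (eWeightedNorm_twisted_le γ lam (-κ) hu.aesm hu.aesm_gradient).trans_lt ?_
    exact ENNReal.add_lt_top.2 ⟨ENNReal.add_lt_top.2 ⟨hu.eWeightedNorm_gradient_lt_top b,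
      ENNReal.mul_lt_top ENNReal.ofReal_lt_top (hu.eWeightedNorm_lt_top' _)⟩,
      ENNReal.mul_lt_top ENNReal.ofReal_lt_top (hu.eWeightedNorm_lt_top' _)⟩
  have := ENNReal.toReal_mono (ENNReal.mul_ne_top ENNReal.ofReal_ne_top
    (ENNReal.pow_lt_top hfin).ne) hk
  rwa [ENNReal.toReal_mul, ENNReal.toReal_pow, ENNReal.toReal_pow,
    ENNReal.toReal_ofReal (by positivity)] at this

/-- Stability of the additive form of the inequality on test functions. -/
theorem exists_stability_test (hp : Params N a b γ κ) :
    ∃ C : ℝ, 0 < C ∧ ∀ lam : ℝ, 0 < lam → ∀ u : E N → ℝ, IsTest u → ∃ k : ℝ,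
      (eWeightedNorm b (fun x => ∇ u x + k • ∇ (profile N γ κ lam) x)).toReal ^ 2 +
        lam ^ 2 * (eWeightedNorm a (fun x => u x + k * profile N γ κ lam x)).toReal ^ 2 ≤
      C * (eWeightedNorm b (twisted γ lam (-κ) u (∇ u))).toReal ^ 2 := by
  obtain ⟨C, hC, h⟩ := exists_twisted_poincare hp
  have hS := hp.sharp_pos
  refine ⟨1 + N * γ * C, by nlinarith, fun lam hlam u hu => ?_⟩
  obtain ⟨k, hk⟩ := h lam hlam u hu
  refine ⟨k, ?_⟩
  have hz : Approx a b (fun x => u x + k * profile N γ κ lam x)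
      (fun x => ∇ u x + k • ∇ (profile N γ κ lam) x) :=
    hu.approx.add ((approx_profile hp hlam).const_mul k)
  have hid := hz.norm_identity hp lam
  -- The identity for u + kg has the twisted norm of u on one side, and its negative L²_c term is
  -- absorbed by the Poincaré bound; the λ in the identity cancels the 1/λ there.
  rw [eWeightedNorm_congr b (twisted_sub_profile hp.pos u (∇ u) k)] at hid
  set D := (eWeightedNorm b (twisted γ lam (-κ) u (∇ u))).toReal ^ 2
  have hγ := hp.pos
  have h1 := mul_le_mul_of_nonneg_left hk (by positivity : 0 ≤ lam * (N * γ))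
  have h2 : lam * (N * γ) * (C / lam * D) = N * γ * C * D := by field_simp
  nlinarith

omit [NeZero N] in
-- Here e and f are approximation errors that will tend to zero. The main term t s is bounded by
-- AM–GM on t² + λ²s², which is where X/(2λ) comes from.
theorem add_mul_add_le {e f s t X : ℝ} (hl : 0 < lam) (he : 0 ≤ e)
    (hf : 0 ≤ f) (h : t ^ 2 + lam ^ 2 * s ^ 2 ≤ X) :
    (f + t) * (e + s) ≤ f * e + f * (Real.sqrt X / lam) + Real.sqrt X * e + X / (2 * lam) := by
  have h1 : t ≤ Real.sqrt X := Real.le_sqrt_of_sq_le (by nlinarith [sq_nonneg (lam * s)])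
  have h2 : s ≤ Real.sqrt X / lam := by
    rw [le_div_iff₀ hl]
    exact Real.le_sqrt_of_sq_le (by nlinarith [sq_nonneg t])
  have h3 : t * s ≤ X / (2 * lam) := by
    rw [le_div_iff₀ (by positivity)]
    nlinarith [sq_nonneg (t - lam * s)]
  calc (f + t) * (e + s) = f * e + f * s + t * e + t * s := by ring
    _ ≤ _ := by gcongr

/-- Stability of the multiplicative form of the inequality. -/
theorem exists_stability (hp : Params N a b γ κ) :
    ∃ C : ℝ, 0 < C ∧ ∀ (u : E N → ℝ) (G : E N → E N), Approx a b u G →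
      0 < (eWeightedNorm a u).toReal → 0 < (eWeightedNorm b G).toReal → ∀ η : ℝ, 0 < η →
      ∃ k lam : ℝ, 0 < lam ∧
        (eWeightedNorm b (fun x => G x + k • ∇ (profile N γ κ lam) x)).toReal *
          (eWeightedNorm a (fun x => u x + k * profile N γ κ lam x)).toReal ≤
        C * ((eWeightedNorm b G).toReal * (eWeightedNorm a u).toReal -
          N * γ / 2 * (eWeightedNorm ((a + b + 1) / 2) u).toReal ^ 2) + η := by
  obtain ⟨C, hC, h⟩ := exists_stability_test hp
  refine ⟨C, hC, fun u G hu hA hB η hη => ?_⟩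
  have hγ := hp.pos
  have ea := hp.a_eq
  have htop := hu.norm_lt_top
  have mu := hu.grad.aesm
  have mG := hu.grad.aesm_grad
  have hctop := hu.norm_c_lt_top hp
  obtain ⟨φ, h1, h2, h3, h4⟩ := hu.seq
  have h5 : Tendsto (fun n => eWeightedNorm ((a + b + 1) / 2) (fun x => u x - φ n x)) atTop
      (𝓝 0) := by
    have := h2.add h3
    rw [add_zero] at this
    exact tendsto_of_tendsto_of_tendsto_of_le_of_le tendsto_const_nhds this (fun _ => zero_le)
      fun n => eWeightedNorm_interpolate (by linarith) (by linarith) (mu.sub (h1 n).aesm)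
  have r1 := (ENNReal.tendsto_toReal htop.1.ne).comp
    (eWeightedNorm_tendsto a mu (fun n => (h1 n).aesm) h2)
  have r4 := (ENNReal.tendsto_toReal htop.2.2.ne).comp
    (eWeightedNorm_tendsto b mG (fun n => (h1 n).aesm_gradient) h4)
  have r5 := (ENNReal.tendsto_toReal hctop.ne).comp
    (eWeightedNorm_tendsto _ mu (fun n => (h1 n).aesm) h5)
  set A := (eWeightedNorm a u).toReal with hAd
  set B := (eWeightedNorm b G).toReal with hBd
  set Q := (eWeightedNorm ((a + b + 1) / 2) u).toReal with hQd
  -- This λ makes B² + λ²A² equal to 2λBA, so the additive deficit becomes 2λ times the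
  -- multiplicative one.
  set lam := B / A with hlam
  have hl : 0 < lam := by positivity
  set D : ℕ → ℝ := fun n => (eWeightedNorm b (twisted γ lam (-κ) (φ n) (∇ (φ n)))).toReal ^ 2
  have hD : Tendsto D atTop (𝓝 (2 * lam * (B * A - N * γ / 2 * Q ^ 2))) := by
    have := ((r4.pow 2).add ((r1.pow 2).const_mul (lam ^ 2))).sub
      ((r5.pow 2).const_mul (lam * (N * γ)))
    rw [show B ^ 2 + lam ^ 2 * A ^ 2 - lam * (N * γ) * Q ^ 2 =
      2 * lam * (B * A - N * γ / 2 * Q ^ 2) by rw [hlam]; field_simp; ring] at this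
    refine this.congr fun n => ?_
    exact ((h1 n).approx.norm_identity hp lam).symm
  have e2 := (ENNReal.tendsto_toReal ENNReal.zero_ne_top).comp h2
  have e4 := (ENNReal.tendsto_toReal ENNReal.zero_ne_top).comp h4
  simp only [Function.comp_def, ENNReal.toReal_zero] at e2 e4
  set e : ℕ → ℝ := fun n => (eWeightedNorm a (fun x => u x - φ n x)).toReal
  set f : ℕ → ℝ := fun n => (eWeightedNorm b (fun x => G x - ∇ (φ n) x)).toReal
  have hlim : Tendsto (fun n => f n * e n + f n * (Real.sqrt (C * D n) / lam) +
      Real.sqrt (C * D n) * e n + C * D n / (2 * lam)) atTop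
      (𝓝 (C * (B * A - N * γ / 2 * Q ^ 2))) := by
    have hs := (hD.const_mul C).sqrt
    have := (((e4.mul e2).add (e4.mul (hs.div_const lam))).add (hs.mul e2)).add
      ((hD.const_mul C).div_const (2 * lam))
    convert! this using 2
    field_simp
    ring
  have e2' : ∀ᶠ n in atTop, eWeightedNorm a (fun x => u x - φ n x) < ⊤ :=
    h2.eventually (gt_mem_nhds ENNReal.zero_lt_top)
  have e4' : ∀ᶠ n in atTop, eWeightedNorm b (fun x => G x - ∇ (φ n) x) < ⊤ :=
    h4.eventually (gt_mem_nhds ENNReal.zero_lt_top)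
  -- The coefficient k depends on the approximant, so no limit of k is taken: one sufficiently late
  -- n is used, at the price of η.
  obtain ⟨n, hn, hn2, hn4⟩ := ((hlim.eventually (gt_mem_nhds (lt_add_of_pos_right _ hη))).and
    (e2'.and e4')).exists
  obtain ⟨k, hk⟩ := h lam hl (φ n) (h1 n)
  refine ⟨k, lam, hl, le_trans ?_ hn.le⟩
  have hz := (h1 n).approx.add ((approx_profile hp hl).const_mul k)
  have ztop := hz.norm_lt_top
  have t1 := toReal_eWeightedNorm_add_le a (mu.sub (h1 n).aesm) hz.grad.aesm hn2 ztop.1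
  have t2 := toReal_eWeightedNorm_add_le b (mG.sub (h1 n).aesm_gradient) hz.grad.aesm_grad hn4
    ztop.2.2
  have s1 : (fun x => (u - φ n) x + (φ n x + k * profile N γ κ lam x)) =
      fun x => u x + k * profile N γ κ lam x := by
    ext x; simp only [Pi.sub_apply]; ring
  have s2 : (fun x => (G - ∇ (φ n)) x + (∇ (φ n) x + k • ∇ (profile N γ κ lam) x)) =
      fun x => G x + k • ∇ (profile N γ κ lam) x := by
    ext1 x; simp only [Pi.sub_apply]; abel
  rw [s1] at t1
  rw [s2] at t2
  change _ ≤ e n + _ at t1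
  change _ ≤ f n + _ at t2
  set az := (eWeightedNorm a (fun x => φ n x + k * profile N γ κ lam x)).toReal
  set bz := (eWeightedNorm b (fun x => ∇ (φ n) x + k • ∇ (profile N γ κ lam) x)).toReal
  change bz ^ 2 + lam ^ 2 * az ^ 2 ≤ C * D n at hk
  have az0 : 0 ≤ az := ENNReal.toReal_nonneg
  have bz0 : 0 ≤ bz := ENNReal.toReal_nonneg
  have en0 : 0 ≤ e n := ENNReal.toReal_nonneg
  have fn0 : 0 ≤ f n := ENNReal.toReal_nonneg
  have hfin := add_mul_add_le hl en0 fn0 hk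
  exact (mul_le_mul t2 t1 ENNReal.toReal_nonneg (add_nonneg fn0 bz0)).trans hfin

theorem profile_c_pos (hp : Params N a b γ κ) (hlam : 0 < lam) :
    0 < (eWeightedNorm ((a + b + 1) / 2) (profile N γ κ lam)).toReal := by
  have hg := approx_profile hp hlam
  refine ENNReal.toReal_pos (fun h => ?_) (hg.norm_c_lt_top hp).ne
  have h0 := ae_eq_zero_of_eWeightedNorm_eq_zero hg.grad.aesm h
  obtain ⟨x, hx, hx0⟩ := (h0.and ae_ne_zero).exists
  exact (profile_pos hx0).ne' hx

/-- Optimality is tested on approximants of the profile with λ = 1. Its twisted field is zero, so A²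
+ B² = NγQ², while any admissible S gives SQ² ≤ AB ≤ (A² + B²)/2. -/
theorem isGreatest_sharp (hp : Params N a b γ κ) :
    IsGreatest {S : ℝ | ∀ φ : E N → ℝ, IsTest φ →
      S * lNorm ((a + b + 1) / 2) φ ^ 2 ≤ hNorm b φ * lNorm a φ} (N * γ / 2) := by
  have hh : ∀ φ : E N → ℝ, IsTest φ → hNorm b φ = (eWeightedNorm b (∇ φ)).toReal := fun φ hφ => by
    rw [hNorm, hφ.smoothOff.hasWeakGrad.eHNorm_eq]
  refine ⟨fun φ hφ => ?_, fun S hS => ?_⟩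
  · rw [hh φ hφ]
    exact hφ.approx.inequality hp
  have hg := approx_profile hp one_pos
  have hpos := profile_c_pos hp one_pos
  have htop := hg.norm_lt_top
  have hctop := hg.norm_c_lt_top hp
  have mu := hg.grad.aesm
  have hγ := hp.pos
  have ea := hp.a_eq
  have hid := hg.norm_identity hp 1
  have hz : eWeightedNorm b (twisted γ 1 (-κ) (profile N γ κ 1) (∇ (profile N γ κ 1))) = 0 := by
    have := eWeightedNorm_congr b
      (twisted_sub_profile (lam := 1) (κ := κ) hγ (fun _ : E N => 0) (fun _ => 0) 1)
    simp only [zero_add, one_mul, one_smul] at this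
    refine this.trans ?_
    rw [show twisted γ 1 (-κ) (fun _ : E N => 0) (fun _ => 0) = fun _ => 0 by
      ext1 x; simp [twisted]]
    exact eWeightedNorm_zero b
  obtain ⟨φ, h1, h2, h3, h4⟩ := hg.seq
  have h5 : Tendsto (fun n => eWeightedNorm ((a + b + 1) / 2)
      (fun x => profile N γ κ 1 x - φ n x)) atTop (𝓝 0) := by
    have := h2.add h3
    rw [add_zero] at this
    exact tendsto_of_tendsto_of_tendsto_of_le_of_le tendsto_const_nhds this (fun _ => zero_le)
      fun n => eWeightedNorm_interpolate (by linarith) (by linarith) (mu.sub (h1 n).aesm)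
  have r1 := (ENNReal.tendsto_toReal htop.1.ne).comp
    (eWeightedNorm_tendsto a mu (fun n => (h1 n).aesm) h2)
  have r4 := (ENNReal.tendsto_toReal htop.2.2.ne).comp
    (eWeightedNorm_tendsto b hg.grad.aesm_grad (fun n => (h1 n).aesm_gradient) h4)
  have r5 := (ENNReal.tendsto_toReal hctop.ne).comp
    (eWeightedNorm_tendsto _ mu (fun n => (h1 n).aesm) h5)
  have hle := le_of_tendsto_of_tendsto' ((r5.pow 2).const_mul S) (r4.mul r1) fun n => by
    have := hS (φ n) (h1 n)
    rwa [hh _ (h1 n)] at this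
  rw [hz] at hid
  simp only [ENNReal.toReal_zero] at hid
  set A := (eWeightedNorm a (profile N γ κ 1)).toReal
  set B := (eWeightedNorm b (∇ (profile N γ κ 1))).toReal
  set Q := (eWeightedNorm ((a + b + 1) / 2) (profile N γ κ 1)).toReal
  have : S * Q ^ 2 ≤ N * γ / 2 * Q ^ 2 := by nlinarith [sq_nonneg (A - B)]
  exact le_of_mul_le_mul_right this (by positivity)

theorem bestConst_eq (hp : Params N a b γ κ) : bestConst N a b = N * γ / 2 :=
  (isGreatest_sharp hp).csSup_eq

end

end CKN

/-! ### Distance and deficit: the linear bound and the optimality of its exponent -/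

namespace CKN

variable {N : ℕ} {a b γ κ lam : ℝ}

/-- An odd test function. -/
def oddTest (N : ℕ) [NeZero N] (x : E N) : ℝ := cutoff N 0 x * x 0

section

variable [NeZero N]

theorem isTest_oddTest : IsTest (oddTest N) :=
  (isTest_cutoff 0).mul fun x _ => ContDiff.contDiffAt (f := fun x : E N => x 0) (by fun_prop)

theorem oddTest_neg (x : E N) : oddTest N (-x) = - oddTest N x := by
  simp [oddTest, cutoff_neg]

theorem oddTest_norm_ne_zero (c : ℝ) : eWeightedNorm c (oddTest N) ≠ 0 := by
  intro h
  have h0 := ae_eq_zero_of_eWeightedNorm_eq_zero isTest_oddTest.aesm h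
  have h1 := (isTest_oddTest (N := N)).smooth.continuous.ae_eq_iff_eq volume continuous_zero |>.1 h0
  have h2 := congrFun h1 (EuclideanSpace.single 0 (1 : ℝ))
  have h3 : (EuclideanSpace.single 0 (1 : ℝ) : E N) ≠ 0 := fun h => by
    have := congrArg (fun x : E N => ‖x‖) h
    simp at this
  rw [oddTest, cutoff_eq_one h3 (by simp)] at h2
  simp at h2

theorem Approx.hNorm_eq {u : E N → ℝ} {G : E N → E N} (h : Approx a b u G) :
    hNorm b u = (eWeightedNorm b G).toReal := by rw [hNorm, h.grad.eHNorm_eq]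

theorem Approx.sub_minimizer (hp : Params N a b γ κ)
    (hκ : (b < ((N : ℝ) - 2) / 2 ∧ κ = 0) ∨ (((N : ℝ) - 2) / 2 < b ∧ κ = 2 * b + 2 - N))
    {u : E N → ℝ} {G : E N → E N} (h : Approx a b u G) {v : E N → ℝ} (hv : v ∈ minimizers N a b) :
    ∃ k lam : ℝ, 0 < lam ∧ v = (fun x => k * profile N γ κ lam x) ∧
      Approx a b (u - v) (fun x => G x - k • ∇ (profile N γ κ lam) x) := by
  obtain ⟨k, lam, hl, rfl⟩ := (mem_minimizers_iff hp.a_eq hκ).1 hv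
  exact ⟨k, lam, hl, rfl, h.sub ((approx_profile hp hl).const_mul k)⟩

omit [NeZero N] in
theorem bddBelow_strongDist (u : E N → ℝ) : BddBelow (Set.range fun v : minimizers N a b =>
    hNorm b (u - v.1) * lNorm a (u - v.1) / (hNorm b u * lNorm a u)) := by
  refine ⟨0, ?_⟩
  rintro _ ⟨v, rfl⟩
  simp only [hNorm, lNorm]
  positivity

/-- The stability estimate is divided by ‖u‖_{H²_b}‖u‖_{L²_a}; the sharp inequality replaces this
denominator by (Nγ/2)‖u‖_{L²_c}², the one occurring in the deficit. -/
theorem exists_strongDist_le_deficit (hp : Params N a b γ κ)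
    (hκ : (b < ((N : ℝ) - 2) / 2 ∧ κ = 0) ∨ (((N : ℝ) - 2) / 2 < b ∧ κ = 2 * b + 2 - N)) :
    ∃ C : ℝ, 0 < C ∧ ∀ u : E N → ℝ, MemH b u → MemL a u → ¬ u =ᵐ[volume] 0 →
      strongDist a b u ≤ C * deficit a b u := by
  obtain ⟨C, hC, h⟩ := exists_stability hp
  have hS := hp.sharp_pos
  refine ⟨C / (N * γ / 2), by positivity, fun u hH hL hu0 => ?_⟩
  have hu := hH.approx hp.hardy_ne hL.norm_lt_top
  set G := weakGrad u
  have hA : 0 < (eWeightedNorm a u).toReal := ENNReal.toReal_pos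
    (fun h0 => hu0 (ae_eq_zero_of_eWeightedNorm_eq_zero hu.grad.aesm h0)) hu.norm_lt_top.1.ne
  have hQ : 0 < (eWeightedNorm ((a + b + 1) / 2) u).toReal := ENNReal.toReal_pos
    (fun h0 => hu0 (ae_eq_zero_of_eWeightedNorm_eq_zero hu.grad.aesm h0)) (hu.norm_c_lt_top hp).ne
  have hin := hu.inequality hp
  have h1 := h u G hu hA
  have ehu := hu.hNorm_eq
  have key : ∀ η : ℝ, 0 < η → 0 < (eWeightedNorm b G).toReal →
      strongDist a b u ≤ (C * ((eWeightedNorm b G).toReal * (eWeightedNorm a u).toReal -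
        N * γ / 2 * (eWeightedNorm ((a + b + 1) / 2) u).toReal ^ 2) + η) /
          ((eWeightedNorm b G).toReal * (eWeightedNorm a u).toReal) := by
    intro η hη hB
    obtain ⟨k, lam, hl, hk⟩ := h1 hB η hη
    have hv : (fun x => -k * profile N γ κ lam x) ∈ minimizers N a b :=
      (mem_minimizers_iff hp.a_eq hκ).2 ⟨-k, lam, hl, rfl⟩
    refine (ciInf_le (bddBelow_strongDist u) ⟨_, hv⟩).trans ?_
    have hz := hu.add ((approx_profile hp hl).const_mul k)
    have e : u - (fun x => -k * profile N γ κ lam x) = fun x => u x + k * profile N γ κ lam x := by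
      ext x; simp only [Pi.sub_apply]; ring
    simp only [e]
    rw [hz.hNorm_eq, ehu]
    exact div_le_div_of_nonneg_right hk (by positivity)
  rw [deficit, bestConst_eq hp, ehu]
  simp only [lNorm, eLNorm]
  set A := (eWeightedNorm a u).toReal
  set B := (eWeightedNorm b G).toReal
  set Q := (eWeightedNorm ((a + b + 1) / 2) u).toReal
  have hB : 0 < B := by
    have : 0 < B * A := lt_of_lt_of_le (by positivity) hin
    exact pos_of_mul_pos_left this hA.le
  have hlim : strongDist a b u ≤ C * (B * A - N * γ / 2 * Q ^ 2) / (B * A) := by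
    -- The infimum in `strongDist` absorbs the slack η, taken as ε times the denominator.
    refine le_of_forall_pos_le_add fun ε hε => ?_
    refine (key (ε * (B * A)) (by positivity) hB).trans (le_of_eq ?_)
    field_simp
  refine hlim.trans ?_
  have e : C / (N * γ / 2) * (B * A / Q ^ 2 - N * γ / 2) =
      C * (B * A - N * γ / 2 * Q ^ 2) / (N * γ / 2 * Q ^ 2) := by
    field_simp
  rw [e]
  exact div_le_div_of_nonneg_left (mul_nonneg hC.le (by linarith)) (by positivity) hin

omit [NeZero N] in
/-- The real-number part of `exists_deficit_le_strongDist`. -/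
theorem deficit_bounds {S A B Q P Γ D A₁ B₁ ε d : ℝ} (hε : 0 < ε) (hS : 0 < S) (hP : 0 < P)
    (hΓ : 0 < Γ) (hQ : Γ ≤ Q) (hA0 : 0 ≤ A) (hB0 : 0 ≤ B) (hA : A ≤ A₁) (hB : B ≤ B₁)
    (hin : S * Q ^ 2 ≤ B * A) (hid : B ^ 2 + A ^ 2 - 2 * S * Q ^ 2 = ε ^ 2 * D)
    (hd : S * (ε * P) ^ 2 / (B * A) ≤ d) :
    0 < d ∧ 0 ≤ B * A / Q ^ 2 - S ∧
      B * A / Q ^ 2 - S ≤ D / (2 * Γ ^ 2) * (B₁ * A₁ / (S * P ^ 2)) * d ∧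
      B * A / Q ^ 2 - S ≤ D / (2 * Γ ^ 2) * ε ^ 2 := by
  have hQ0 : 0 < Q := hΓ.trans_le hQ
  have hBA : 0 < B * A := lt_of_lt_of_le (by positivity) hin
  have hle : B * A ≤ B₁ * A₁ := mul_le_mul hB hA hA0 (hB0.trans hB)
  have hD : 0 ≤ D := by
    have : 0 ≤ ε ^ 2 * D := by nlinarith [sq_nonneg (A - B)]
    exact nonneg_of_mul_nonneg_right this (by positivity)
  have hd0 : 0 < d := lt_of_lt_of_le (by positivity) hd
  have hd1 : B * A / Q ^ 2 - S ≤ D / (2 * Γ ^ 2) * ε ^ 2 := by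
    -- AM–GM on BA, followed by the norm identity with λ = 1.
    have h1 : B * A - S * Q ^ 2 ≤ ε ^ 2 * D / 2 := by nlinarith [sq_nonneg (A - B)]
    have h2 : B * A / Q ^ 2 - S = (B * A - S * Q ^ 2) / Q ^ 2 := by field_simp
    rw [h2]
    calc _ ≤ (ε ^ 2 * D / 2) / Q ^ 2 := by gcongr
      _ ≤ (ε ^ 2 * D / 2) / Γ ^ 2 := by gcongr
      _ = _ := by field_simp
  have hlow : ε ^ 2 ≤ B₁ * A₁ / (S * P ^ 2) * d := by
    have h1 : S * (ε * P) ^ 2 ≤ d * (B * A) := (div_le_iff₀ hBA).1 hd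
    rw [div_mul_eq_mul_div, le_div_iff₀ (by positivity)]
    calc _ = S * (ε * P) ^ 2 := by ring
      _ ≤ d * (B * A) := h1
      _ ≤ d * (B₁ * A₁) := by gcongr
      _ = _ := by ring
  refine ⟨hd0, ?_, hd1.trans ?_, hd1⟩
  · rw [sub_nonneg, le_div_iff₀ (by positivity)]
    exact hin
  · rw [mul_assoc]
    gcongr

/-- Odd perturbations of a minimizer show that the deficit cannot be raised to a power. -/
theorem exists_deficit_le_strongDist (hp : Params N a b γ κ)
    (hκ : (b < ((N : ℝ) - 2) / 2 ∧ κ = 0) ∨ (((N : ℝ) - 2) / 2 < b ∧ κ = 2 * b + 2 - N)) :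
    ∃ M R : ℝ, 0 ≤ M ∧ ∀ ε : ℝ, 0 < ε → ε ≤ 1 → ∃ u : E N → ℝ, MemH b u ∧ MemL a u ∧
      ¬ u =ᵐ[volume] 0 ∧ 0 < strongDist a b u ∧ 0 ≤ deficit a b u ∧
      deficit a b u ≤ M * strongDist a b u ∧ deficit a b u ≤ R * ε ^ 2 := by
  have hS := hp.sharp_pos
  have hg := approx_profile hp one_pos
  set g := profile N γ κ 1 with hgd
  set φ := oddTest N with hφd
  have hφ : IsTest φ := isTest_oddTest
  set c := (a + b + 1) / 2 with hc
  have hPc : 0 < (eWeightedNorm c φ).toReal :=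
    ENNReal.toReal_pos (oddTest_norm_ne_zero c) (hφ.eWeightedNorm_lt_top' c).ne
  have hgc : 0 < (eWeightedNorm c g).toReal := profile_c_pos hp one_pos
  set D := (eWeightedNorm b (twisted γ 1 (-κ) φ (∇ φ))).toReal ^ 2 with hD
  set A₁ := (eWeightedNorm a g).toReal + (eWeightedNorm a φ).toReal with hA1
  set B₁ := (eWeightedNorm b (∇ g)).toReal + (eWeightedNorm b (∇ φ)).toReal with hB1
  set P := (eWeightedNorm c φ).toReal
  set Γ := (eWeightedNorm c g).toReal
  have hA1p : 0 ≤ A₁ := by positivity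
  have hB1p : 0 ≤ B₁ := by positivity
  have hD0 : 0 ≤ D := by positivity
  refine ⟨D / (2 * Γ ^ 2) * (B₁ * A₁ / (N * γ / 2 * P ^ 2)), D / (2 * Γ ^ 2), by positivity,
    fun ε hε hε1 => ?_⟩
  have hu0 : Approx a b (fun x => ε * φ x + 1 * g x) (fun x => ε • ∇ φ x + (1 : ℝ) • ∇ g x) :=
    (hφ.approx.const_mul ε).add (hg.const_mul 1)
  have htw := eWeightedNorm_congr b (twisted_sub_profile (lam := 1) (κ := κ) hp.pos
    (fun x : E N => ε * φ x) (fun x => ε • ∇ φ x) 1)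
  have hid := hu0.norm_identity hp 1
  rw [htw, show twisted γ 1 (-κ) (fun x => ε * φ x) (fun x => ε • ∇ φ x) =
    fun x => ε • twisted γ 1 (-κ) φ (∇ φ) x by
      ext1 x; simp only [twisted]; module, toReal_eWeightedNorm_const_smul, mul_pow, sq_abs,
    ← hD] at hid
  have hu : Approx a b (fun x => g x + ε * φ x) (fun x => ∇ g x + ε • ∇ φ x) :=
    hg.add (hφ.approx.const_mul ε)
  have ef : (fun x => ε * φ x + 1 * g x) = fun x => g x + ε * φ x := by ext x; ring
  have eG : (fun x => ε • ∇ φ x + (1 : ℝ) • ∇ g x) = fun x => ∇ g x + ε • ∇ φ x := by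
    ext1 x; rw [one_smul, add_comm]
  rw [ef, eG] at hid
  set u : E N → ℝ := fun x => g x + ε * φ x with hud
  set G : E N → E N := fun x => ∇ g x + ε • ∇ φ x with hGd
  have odd_bound : ∀ f : E N → ℝ, AEStronglyMeasurable f volume → (∀ x, f (-x) = f x) →
      eWeightedNorm c (fun x => ε * φ x) ≤ eWeightedNorm c (fun x => f x + ε * φ x) ∧
      eWeightedNorm c f ≤ eWeightedNorm c (fun x => f x + ε * φ x) := fun f hf he =>
    eWeightedNorm_odd_le c hf (hφ.const_mul ε).aesm
      (fun x => by rw [hφd, oddTest_neg]; ring) he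
  have hQ : Γ ≤ (eWeightedNorm c u).toReal :=
    ENNReal.toReal_mono (hu.norm_c_lt_top hp).ne
      (odd_bound g hg.grad.aesm fun x => profile_neg x).2
  have hQ0 : 0 < (eWeightedNorm c u).toReal := hgc.trans_le hQ
  have hA : (eWeightedNorm a u).toReal ≤ A₁ := by
    refine (toReal_eWeightedNorm_add_le a hg.grad.aesm (hφ.const_mul ε).aesm hg.norm_lt_top.1
      ((hφ.const_mul ε).eWeightedNorm_lt_top' a)).trans ?_
    have := toReal_eWeightedNorm_const_smul φ a ε
    simp only [smul_eq_mul] at this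
    rw [this, abs_of_pos hε]
    have : 0 ≤ (eWeightedNorm a φ).toReal := ENNReal.toReal_nonneg
    nlinarith
  have hB : (eWeightedNorm b G).toReal ≤ B₁ := by
    have hφε : Approx a b (fun x => ε * φ x) (fun x => ε • ∇ φ x) := hφ.approx.const_mul ε
    refine (toReal_eWeightedNorm_add_le b hg.grad.aesm_grad hφε.grad.aesm_grad
      hg.norm_lt_top.2.2 hφε.norm_lt_top.2.2).trans ?_
    rw [toReal_eWeightedNorm_const_smul, abs_of_pos hε]
    have : 0 ≤ (eWeightedNorm b (∇ φ)).toReal := ENNReal.toReal_nonneg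
    nlinarith
  have hin := hu.inequality hp
  have ehu := hu.hNorm_eq
  -- The difference u - v is an even function plus εφ, so its L²_c norm is at least εP; the sharp
  -- inequality for u - v then bounds the numerator from below.
  have hdist : ∀ v : minimizers N a b, N * γ / 2 * (ε * P) ^ 2 /
      ((eWeightedNorm b G).toReal * (eWeightedNorm a u).toReal) ≤
      hNorm b (u - v.1) * lNorm a (u - v.1) / (hNorm b u * lNorm a u) := by
    intro v
    obtain ⟨k, lam, hl, hvk, hz⟩ := hu.sub_minimizer hp hκ v.2
    rw [ehu]
    refine div_le_div_of_nonneg_right ?_ (mul_nonneg ENNReal.toReal_nonneg ENNReal.toReal_nonneg)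
    rw [hz.hNorm_eq]
    refine le_trans ?_ (hz.inequality hp)
    have h1 := (odd_bound (fun x => g x - k * profile N γ κ lam x)
      (hg.sub ((approx_profile hp hl).const_mul k)).grad.aesm
      fun x => by rw [hgd, profile_neg, profile_neg]).1
    have e1 : (fun x => g x - k * profile N γ κ lam x + ε * φ x) = u - v.1 := by
      ext x; rw [hvk]; simp only [Pi.sub_apply, hud]; ring
    rw [e1] at h1
    have h2 := ENNReal.toReal_mono (hz.norm_c_lt_top hp).ne h1
    have h3 := toReal_eWeightedNorm_const_smul φ c ε
    simp only [smul_eq_mul] at h3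
    rw [h3, abs_of_pos hε] at h2
    gcongr
  have hne : Nonempty (minimizers N a b) :=
    ⟨⟨_, (mem_minimizers_iff hp.a_eq hκ).2 ⟨1, 1, one_pos, rfl⟩⟩⟩
  have hdist' := le_ciInf hdist
  change _ ≤ strongDist a b u at hdist'
  refine ⟨u, hu.memH, hu.memL, fun h0 => ?_, ?_⟩
  · have : eWeightedNorm c u = 0 := by
      rw [eWeightedNorm_congr c h0]; exact eWeightedNorm_zero c
    rw [this] at hQ0
    simp at hQ0
  rw [deficit, bestConst_eq hp, ehu]
  simp only [lNorm, eLNorm]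
  rw [← hc] at hin hid ⊢
  exact deficit_bounds hε hS hPc hgc hQ ENNReal.toReal_nonneg ENNReal.toReal_nonneg hA hB hin
    (by linear_combination -hid) hdist'

/-- With δ the deficit and d the distance, δ ≤ Md and δ ≤ Rε² turn d ≤ Cδ^t into d ≤
|C|M(|R|ε²)^{t-1}d, which is impossible for small ε since d > 0. -/
theorem not_exists_strongDist_le_rpow (hp : Params N a b γ κ)
    (hκ : (b < ((N : ℝ) - 2) / 2 ∧ κ = 0) ∨ (((N : ℝ) - 2) / 2 < b ∧ κ = 2 * b + 2 - N))
    {t : ℝ} (ht : 1 < t) :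
    ¬ ∃ C : ℝ, ∀ u : E N → ℝ, MemH b u → MemL a u → ¬ u =ᵐ[volume] 0 →
      strongDist a b u ≤ C * deficit a b u ^ t := by
  rintro ⟨C, hC⟩
  obtain ⟨M, R, hM, h⟩ := exists_deficit_le_strongDist hp hκ
  have hlim : Tendsto (fun ε : ℝ => |C| * M * (|R| * ε ^ 2) ^ (t - 1)) (𝓝[>] 0) (𝓝 0) := by
    have hc : Continuous fun ε : ℝ => |C| * M * (|R| * ε ^ 2) ^ (t - 1) :=
      continuous_const.mul ((continuous_const.mul (continuous_id.pow 2)).rpow_const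
        fun _ => Or.inr (by linarith))
    have := (hc.tendsto 0).mono_left (nhdsWithin_le_nhds (s := Set.Ioi 0))
    simpa [Real.zero_rpow (show t - 1 ≠ 0 by linarith)] using this
  have hpos : ∀ᶠ ε in 𝓝[>] (0 : ℝ), 0 < ε := self_mem_nhdsWithin
  have hone : ∀ᶠ ε in 𝓝[>] (0 : ℝ), ε ≤ 1 := mem_nhdsWithin_of_mem_nhds (ge_mem_nhds one_pos)
  obtain ⟨ε, h1, h2, h3⟩ :=
    ((hlim.eventually (gt_mem_nhds one_pos)).and (hpos.and hone)).exists
  obtain ⟨u, uH, uL, u0, hd, hδ, hδM, hδR⟩ := h ε h2 h3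
  have hle := hC u uH uL u0
  set δ := deficit a b u
  set d := strongDist a b u
  -- A zero deficit would give d ≤ 0 under the assumed bound.
  have hδ0 : 0 < δ := by
    rcases hδ.lt_or_eq with h | h
    · exact h
    · rw [← h, Real.zero_rpow (by linarith), mul_zero] at hle
      linarith
  have e : δ ^ t = δ * δ ^ (t - 1) := by
    rw [mul_comm, ← Real.rpow_add_one hδ0.ne']; ring_nf
  have hp1 : δ ^ (t - 1) ≤ (|R| * ε ^ 2) ^ (t - 1) :=
    Real.rpow_le_rpow hδ (hδR.trans (by gcongr; exact le_abs_self R)) (by linarith)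
  have : d ≤ (|C| * M * (|R| * ε ^ 2) ^ (t - 1)) * d := calc
    d ≤ C * (δ * δ ^ (t - 1)) := by rw [← e]; exact hle
    _ ≤ |C| * ((M * d) * (|R| * ε ^ 2) ^ (t - 1)) := by
      gcongr
      exact le_abs_self C
    _ = _ := by ring
  nlinarith

end

/-- The linear relation between a and b in each regime is `Params.scale`. Both force N > 2, and γ >
0 because (N-2)γ equals N - 2b - 2 in the first regime and 2b + 2 - N in the second. -/
theorem exists_params (N : ℕ) (a b : ℝ)
    (hab : (0 ≤ b ∧ b < ((N : ℝ) - 2) / 2 ∧ a < (N : ℝ) * b / ((N : ℝ) - 2) ∧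
              a + b + 1 = 2 * b * (N : ℝ) / ((N : ℝ) - 2)) ∨
           (((N : ℝ) - 2) / 2 < b ∧ b ≤ (N : ℝ) - 2 ∧
              (N : ℝ) * (b - a + 3) = 2 * (3 * b - a + 3))) :
    ∃ γ κ : ℝ, Params N a b γ κ ∧
      ((b < ((N : ℝ) - 2) / 2 ∧ κ = 0) ∨ (((N : ℝ) - 2) / 2 < b ∧ κ = 2 * b + 2 - N)) := by
  have hN2 : (2 : ℝ) < N := by
    rcases hab with ⟨h1, h2, -⟩ | ⟨h1, h2, -⟩ <;> linarith
  have hN3 : 3 ≤ N := by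
    have : 2 < N := by exact_mod_cast hN2
    omega
  have hN0 : (0 : ℝ) < N - 2 := by linarith
  rcases hab with ⟨h1, h2, h3, h4⟩ | ⟨h1, h2, h3⟩
  · have h5 : (a + b + 1) * ((N : ℝ) - 2) = 2 * b * N := by rw [h4]; field_simp
    have hs : (N : ℝ) - 2 * b - 2 = (N - 2) * ((b + 1 - a) / 2) := by linear_combination h5 / 2
    refine ⟨(b + 1 - a) / 2, 0, ⟨hN3, ?_, by ring, by ring, by linarith⟩, Or.inl ⟨h2, rfl⟩⟩
    refine pos_of_mul_pos_right (a := (N : ℝ) - 2) ?_ hN0.le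
    linarith
  · have hs : (N : ℝ) - 2 * b - 2 + 2 * (2 * b + 2 - N) = (N - 2) * ((b + 1 - a) / 2) := by
      linear_combination -h3 / 2
    refine ⟨(b + 1 - a) / 2, 2 * b + 2 - N, ⟨hN3, ?_, by ring, by ring, hs⟩, Or.inr ⟨h1, rfl⟩⟩
    refine pos_of_mul_pos_right (a := (N : ℝ) - 2) ?_ hN0.le
    linarith

end CKN

end

theorem theorem1p4 (N : ℕ) (a b : ℝ)
    (hab : (0 ≤ b ∧ b < ((N : ℝ) - 2) / 2 ∧ a < (N : ℝ) * b / ((N : ℝ) - 2) ∧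
              a + b + 1 = 2 * b * (N : ℝ) / ((N : ℝ) - 2)) ∨
           (((N : ℝ) - 2) / 2 < b ∧ b ≤ (N : ℝ) - 2 ∧
              (N : ℝ) * (b - a + 3) = 2 * (3 * b - a + 3))) :
    (∃ C : ℝ, 0 < C ∧ ∀ u : CKN.E N → ℝ, CKN.MemH b u → CKN.MemL a u →
      ¬ u =ᵐ[MeasureTheory.volume] 0 →
        CKN.strongDist a b u ≤ C * CKN.deficit a b u) ∧
    (∀ t : ℝ, 1 < t → ¬ ∃ C : ℝ, ∀ u : CKN.E N → ℝ, CKN.MemH b u → CKN.MemL a u →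
      ¬ u =ᵐ[MeasureTheory.volume] 0 →
        CKN.strongDist a b u ≤ C * CKN.deficit a b u ^ t) := by
  obtain ⟨γ, κ, hp, hκ⟩ := CKN.exists_params N a b hab
  have := hp.neZero
  exact ⟨CKN.exists_strongDist_le_deficit hp hκ,
    fun t ht => CKN.not_exists_strongDist_le_rpow hp hκ ht⟩
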